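/- Let $n\in\mathbb N$ and let $\mathbb H^n=\mathbb R^n\times\mathbb R^n\times\mathbb R$ be the Heisenberg group with group law $(x,u,t)(y,v,s)=(x+y,\,u+v,\,t+s+\tfrac12(u\cdot y-v\cdot x))$ and Haar measure $dx\,du\,dt$. For $\lambda\in\mathbb R\setminus\{0\}$ let $\pi_\lambda$ be the Schrödinger representation of $\mathbb H^n$ on $V=L^2(\mathbb R^n)$, $$\pi_\lambda(x,u,t)\varphi(\xi)=e^{i\lambda t}e^{i\lambda(x\cdot\xi+\frac12x\cdot u)}\varphi(\xi+u),$$ and for $f\in L^1(\mathbb H^n)$ put $\pi_\lambda(f)\varphi=\int_{\mathbb H^n}f(p)\,\pi_\lambda(p)\varphi\,dp$. Let $V^\omega$ be the space of analytic vectors of $\pi_\lambda$, that is, of those $\varphi\in V$ for which $p\mapsto\pi_\lambda(p)\varphi$ is a real analytic map from $\mathbb H^n$ to $V$. Convolution on $L^1(\mathbb H^n)$ is $(f*g)(p)=\int_{\mathbb H^n}f(pq^{-1})g(q)\,dq$. For $f\in L^1(\mathbb H^n)$ let $f^\lambda(x,u)=\int_{\mathbb R}f(x,u,t)e^{i\lambda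 t}\,dt$, and let $$\mathcal F_1f^\lambda(x,u)=(2\pi)^{-n/2}\int_{\mathbb R^n}f^\lambda(y,u)e^{-ix\cdot y}\,dy,\qquad \mathcal F_2f^\lambda(x,u)=(2\pi)^{-n/2}\int_{\mathbb R^n}f^\lambda(x,v)e^{-iu\cdot v}\,dv$$ be its partial Fourier transforms. Let $\mathcal B^\lambda$ be the set of all $f\in L^1(\mathbb H^n)$ for which there are $t>0$ and $C$ such that, for almost all $(x,u)\in\mathbb R^{2n}$, $$|\mathcal F_1f^\lambda(x,u)|\le C e^{-t\left(\frac1{|\lambda|}|x|^2+\frac{|\lambda|}4|u|^2\right)^{1/2}},\qquad |\mathcal F_2f^\lambda(x,u)|\le C e^{-t\left(\frac{|\lambda|}4|x|^2+\frac1{|\lambda|}|u|^2\right)^{1/2}}.$$ Then $\mathcal B^\lambda$ is an algebra under convolution (a complex linear subspace of $L^1(\mathbb H^n)$ closed under the associative and bilinear product $*$), and $$\pi_\lambda(\mathcal B^\lambda)V:=\{\pi_\lambda(f)\varphi : f\in\mathcal B^\lambda,\ \varphi\in V\}=V^\omega .$$ -/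

import Mathlib

open MeasureTheory

noncomputable section

namespace HeisenbergGroup

/-- Euclidean space `ℝⁿ`. -/
abbrev E (n : ℕ) := EuclideanSpace ℝ (Fin n)

/-- The Heisenberg group `ℍⁿ = ℝⁿ × ℝⁿ × ℝ` as a manifold, with its Haar measure `dx du dt`.
A point is written `(x, u, t)`. -/
abbrev H (n : ℕ) := E n × E n × ℝ

/-- The group law `(x,u,t)(y,v,s) = (x+y, u+v, t+s+(u·y - v·x)/2)`. -/
def mul {n : ℕ} (p q : H n) : H n :=
  (p.1 + q.1, p.2.1 + q.2.1,
    p.2.2 + q.2.2 + (1 / 2) * (inner ℝ p.2.1 q.1 - inner ℝ q.2.1 p.1))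

/-- The group inverse `(x,u,t)⁻¹ = (-x,-u,-t)`. -/
def inv {n : ℕ} (p : H n) : H n := (-p.1, -p.2.1, -p.2.2)

/-- `V = L²(ℝⁿ)`. -/
abbrev V (n : ℕ) := Lp ℂ 2 (volume : Measure (E n))

/-- `L¹(ℍⁿ)`. -/
abbrev L1 (n : ℕ) := Lp ℂ 1 (volume : Measure (H n))

/-- `(π_lam(x,u,t)φ)(ξ) = e^{i lam t} e^{i lam (x·ξ + x·u/2)} φ(ξ+u)`, for functions `φ`. -/
def schrodingerFun {n : ℕ} (lam : ℝ) (p : H n) (φ : E n → ℂ) (ξ : E n) : ℂ :=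
  Complex.exp (Complex.I * ((lam * p.2.2 : ℝ) : ℂ)) *
    Complex.exp (Complex.I *
      ((lam * (inner ℝ p.1 ξ + (1 / 2) * inner ℝ p.1 p.2.1) : ℝ) : ℂ)) *
    φ (ξ + p.2.1)

theorem memLp_schrodingerFun {n : ℕ} (lam : ℝ) (p : H n) (φ : V n) :
    MemLp (schrodingerFun lam p φ) 2 volume := by
  have h1 : MemLp (fun ξ => φ (ξ + p.2.1)) 2 volume :=
    (Lp.memLp φ).comp_measurePreserving (measurePreserving_add_right volume p.2.1)
  refine h1.of_le ?_ (Filter.Eventually.of_forall fun ξ => ?_)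
  · refine AEStronglyMeasurable.mul (Continuous.aestronglyMeasurable ?_) h1.1
    fun_prop
  · simp only [schrodingerFun, norm_mul, Complex.norm_exp_I_mul_ofReal, one_mul]
    exact le_rfl

/-- The Schrödinger representation `π_lam` of `ℍⁿ` on `L²(ℝⁿ)`. -/
def schrodinger {n : ℕ} (lam : ℝ) (p : H n) (φ : V n) : V n :=
  (memLp_schrodingerFun lam p φ).toLp

/-- The integrated representation `π_lam(f)φ = ∫ f(p) π_lam(p)φ dp`, `f ∈ L¹(ℍⁿ)`
(a Bochner integral in `L²(ℝⁿ)`). -/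
def schrodingerInt {n : ℕ} (lam : ℝ) (f : L1 n) (φ : V n) : V n :=
  ∫ p : H n, f p • schrodinger lam p φ

/-- The analytic vectors of `π_lam`: those `φ` whose orbit map `p ↦ π_lam(p)φ` is real analytic
from `ℍⁿ` to `L²(ℝⁿ)`. -/
def analyticVectors (n : ℕ) (lam : ℝ) : Set (V n) :=
  {φ | AnalyticOnNhd ℝ (fun p : H n => schrodinger lam p φ) Set.univ}

/-- `p ↦ p q⁻¹`, together with the second variable, preserves the measure. -/
theorem measurePreserving_mul_inv (n : ℕ) :
    MeasurePreserving (fun z : H n × H n => (mul z.1 (inv z.2), z.2))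
      (volume.prod volume) (volume.prod volume) := by
  have hm : Continuous (fun z : H n × H n => mul z.1 (inv z.2)) := by
    unfold mul inv; fun_prop
  have hfib : ∀ q : H n, MeasurePreserving (fun p : H n => mul p (inv q)) volume volume := by
    rintro ⟨y, v, s⟩
    refine MeasurePreserving.skew_product (f := fun x : E n => x + -y)
      (g := fun (x : E n) (w : E n × ℝ) =>
        (w.1 + -v, w.2 + -s + (1 / 2) * (inner ℝ w.1 (-y) - inner ℝ (-v) x)))
      (measurePreserving_add_right volume (-y)) ?_ (Filter.Eventually.of_forall fun x => ?_)
    · exact Continuous.measurable (by fun_prop)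
    · refine (MeasurePreserving.skew_product (f := fun u : E n => u + -v)
        (g := fun (u : E n) (t : ℝ) =>
          t + -s + (1 / 2) * (inner ℝ u (-y) - inner ℝ (-v) x))
        (measurePreserving_add_right volume (-v)) ?_
        (Filter.Eventually.of_forall fun u => ?_)).map_eq
      · exact Continuous.measurable (by fun_prop)
      · have := (measurePreserving_add_right (volume : Measure ℝ)
          (-s + (1 / 2) * (inner ℝ u (-y) - inner ℝ (-v) x))).map_eq
        simpa only [add_assoc] using this
  have h1 : MeasurePreserving (fun z : H n × H n => (z.1, mul z.2 (inv z.1)))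
      (volume.prod volume) (volume.prod volume) := by
    refine MeasurePreserving.skew_product (f := fun q : H n => q)
      (g := fun (q p : H n) => mul p (inv q)) (MeasurePreserving.id volume) ?_
      (Filter.Eventually.of_forall fun q => (hfib q).map_eq)
    exact (hm.comp continuous_swap).measurable
  exact (Measure.measurePreserving_swap.comp h1).comp Measure.measurePreserving_swap

theorem integrable_conv {n : ℕ} (f g : L1 n) :
    Integrable (fun p : H n => ∫ q : H n, f (mul p (inv q)) * g q) volume := by
  have h : Integrable (fun z : H n × H n => f z.1 * g z.2) (volume.prod volume) :=
    (L1.integrable_coeFn f).mul_prod (L1.integrable_coeFn g)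
  exact ((measurePreserving_mul_inv n).integrable_comp_of_integrable h).integral_prod_left

/-- Convolution on `L¹(ℍⁿ)`: `(f * g)(p) = ∫ f(p q⁻¹) g(q) dq`. -/
def conv {n : ℕ} (f g : L1 n) : L1 n := (integrable_conv f g).toL1 _

/-- `S ⊆ L¹(ℍⁿ)` is an algebra under convolution: a complex linear subspace closed under
convolution, on which convolution is associative and bilinear. -/
structure IsConvolutionAlgebra {n : ℕ} (S : Set (L1 n)) : Prop where
  zero_mem : (0 : L1 n) ∈ S
  add_mem : ∀ f ∈ S, ∀ g ∈ S, f + g ∈ S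
  smul_mem : ∀ (c : ℂ), ∀ f ∈ S, c • f ∈ S
  conv_mem : ∀ f ∈ S, ∀ g ∈ S, conv f g ∈ S
  conv_assoc : ∀ f ∈ S, ∀ g ∈ S, ∀ h ∈ S, conv (conv f g) h = conv f (conv g h)
  add_conv : ∀ f ∈ S, ∀ g ∈ S, ∀ h ∈ S, conv (f + g) h = conv f h + conv g h
  conv_add : ∀ f ∈ S, ∀ g ∈ S, ∀ h ∈ S, conv f (g + h) = conv f g + conv f h
  smul_conv : ∀ (c : ℂ), ∀ f ∈ S, ∀ g ∈ S, conv (c • f) g = c • conv f g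
  conv_smul : ∀ (c : ℂ), ∀ f ∈ S, ∀ g ∈ S, conv f (c • g) = c • conv f g

/-- `f^lam(x,u) = ∫ f(x,u,t) e^{i lam t} dt`. -/
def centralFourier {n : ℕ} (lam : ℝ) (f : H n → ℂ) (x u : E n) : ℂ :=
  ∫ t : ℝ, f (x, u, t) * Complex.exp (Complex.I * ((lam * t : ℝ) : ℂ))

/-- The partial Fourier transform in the first variable,
`(ℱ₁F)(x,u) = (2π)^{-n/2} ∫ F(y,u) e^{-i x·y} dy`. -/
def fourier1 {n : ℕ} (F : E n → E n → ℂ) (x u : E n) : ℂ :=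
  (((2 * Real.pi) ^ (-(n : ℝ) / 2) : ℝ) : ℂ) *
    ∫ y : E n, F y u * Complex.exp (-Complex.I * ((inner ℝ x y : ℝ) : ℂ))

/-- The partial Fourier transform in the second variable,
`(ℱ₂F)(x,u) = (2π)^{-n/2} ∫ F(x,v) e^{-i u·v} dv`. -/
def fourier2 {n : ℕ} (F : E n → E n → ℂ) (x u : E n) : ℂ :=
  (((2 * Real.pi) ^ (-(n : ℝ) / 2) : ℝ) : ℂ) *
    ∫ v : E n, F x v * Complex.exp (-Complex.I * ((inner ℝ u v : ℝ) : ℂ))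

/-- The space `𝓑^lam`. The elements of `L¹(ℍⁿ)` are classes of functions, so the
two pointwise estimates are required almost everywhere. -/
def B (n : ℕ) (lam : ℝ) : Set (L1 n) :=
  {f | ∃ t : ℝ, 0 < t ∧ ∃ C : ℝ,
    (∀ᵐ z : E n × E n, ‖fourier1 (centralFourier lam f) z.1 z.2‖ ≤
      C * Real.exp (-t * √((1 / |lam|) * ‖z.1‖ ^ 2 + (|lam| / 4) * ‖z.2‖ ^ 2))) ∧
    (∀ᵐ z : E n × E n, ‖fourier2 (centralFourier lam f) z.1 z.2‖ ≤
      C * Real.exp (-t * √((|lam| / 4) * ‖z.1‖ ^ 2 + (1 / |lam|) * ‖z.2‖ ^ 2)))}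

end HeisenbergGroup

end

noncomputable section

namespace HeisenbergGroup

open scoped ENNReal NNReal

/-! ### Exponential multipliers depend analytically on the exponent -/

/-! The operator `π_lam(f)` has integral kernel `(ξ, η) ↦ kern lam f ((ξ+η)/2) (η-ξ)`, and `kern lam
f m u` is, up to a constant, the first partial Fourier transform of `f^lam` at `(-lam m, u)`. So the
first estimate defining `𝓑^lam` says that this kernel decays exponentially in `ξ` and `η`. The
Fourier transform conjugates `π_lam(p)` into `π_lam(J p)` for a linear, measure preserving
automorphism `J = fourierAut lam` of the group that exchanges `x` and `u`, and the second estimate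
is the first one for `f ∘ J`. This is `mem_B_iff`: `f` belongs to `𝓑^lam` exactly when the kernels
of `f` and of `f ∘ J` decay exponentially.

The algebra property follows. The kernel of a convolution is the composition of the kernels
(`kern_convF`), a composition of exponentially decaying kernels decays exponentially
(`KernDecay.conv`), and composition with `J` respects convolution. Associativity and bilinearity
hold on all of `L¹`.

For the identity with `V^ω`, both sides are shown to be the space of `ψ` such that `ψ` and its
Fourier transform decay exponentially (`DecayPair`).

An operator with exponentially decaying kernel has exponentially decaying functions in its range;
the same argument for `f ∘ J³` treats the Fourier transform (`exists_decayPair_schrodingerInt`). For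
an analytic vector `ψ`, Cauchy estimates along the modulations `s ↦ e^{i lam s a·ξ} ψ` bound the
moments `(a·ξ)^k ψ` by `C R^k k!`, which sums to an exponential weight (`exists_memLp_exp_mul`); the
Fourier transform of `ψ` is analytic too, because `J` is linear. Weighted `L²` bounds on both sides
become pointwise decay, since each side makes the other Lipschitz (`exists_decayPair`).

Conversely, let `ψ` decay together with its Fourier transform. A central Gaussian times the matrix
coefficient `⟨π_lam(x,u,0) gauss, ψ⟩`, suitably normalised, has as operator the rank one map
`⟨gauss, ·⟩ψ` (`kern_coherent`). It lies in `𝓑^lam`, so `ψ` is in the range. It also decays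
exponentially in `(x,u)`, and `π_lam(q) π_lam(f) φ = π_lam(e^{ℓ(q)} f) π_lam(q) φ`, where `ℓ(q)` is
an imaginary form linear in `q` coming from commutators. As `q ↦ e^{ℓ(q)} f` is analytic into `L¹`
(`analyticAt_expMultiplier`) and the Gaussian is an analytic vector, `ψ` is analytic
(`analyticAt_schrodinger_integral`). -/

theorem exp_smul_sub_sum_le {s z : ℝ} (hs : 0 ≤ s) (hs1 : s ≤ 1) (hz : 0 ≤ z) (k : ℕ) :
    Real.exp (s * z) - ∑ m ∈ Finset.range k, (s * z) ^ m / m.factorial ≤ s ^ k * Real.exp z := by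
  have hsum : ∀ x : ℝ, HasSum (fun m : ℕ => x ^ m / m.factorial) (Real.exp x) := fun x => by
    simpa [Real.exp_eq_exp_ℝ] using NormedSpace.expSeries_div_hasSum_exp (𝔸 := ℝ) x
  -- The tails from index `k` on are compared term by term: there `s^m ≤ s^k`, because `s ≤ 1`.
  have h1 := (hasSum_nat_add_iff' k).mpr (hsum (s * z))
  have h2 := ((hasSum_nat_add_iff' k).mpr (hsum z)).mul_left (s ^ k)
  refine (hasSum_le (fun m => ?_) h1 h2).trans ?_
  · rw [mul_pow, mul_div_assoc]
    refine mul_le_mul_of_nonneg_right ?_ (by positivity)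
    exact pow_le_pow_of_le_one hs hs1 (by omega)
  · refine mul_le_mul_of_nonneg_left ?_ (by positivity)
    have : 0 ≤ ∑ m ∈ Finset.range k, z ^ m / m.factorial := Finset.sum_nonneg fun _ _ => by positivity
    linarith

section ExpMultiplier

variable {Ω W : Type*} [NormedAddCommGroup W] [NormedSpace ℝ W]

/-- The factorial absorbs `N^k` at the cost of the weight: `(rN)^k / k! ≤ e^{rN}`. The factor `r⁻¹ ^
k` is what gives the power series radius of convergence at least `r`. -/
theorem norm_prod_mul_div_factorial_le {L : Ω → W →L[ℝ] ℂ} {N : Ω → ℝ} (hN : ∀ a, ‖L a‖ ≤ N a)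
    (φ : Ω → ℂ) {r : ℝ} (hr : 0 < r) (k : ℕ) (m : Fin k → W) (a : Ω) :
    ‖(∏ i, L a (m i)) * φ a / (k.factorial : ℂ)‖ ≤
      ((r⁻¹) ^ k * ∏ i, ‖m i‖) * ‖Real.exp (r * N a) * ‖φ a‖‖ := by
  have hN0 : 0 ≤ N a := (norm_nonneg _).trans (hN a)
  have h1 : ‖∏ i, L a (m i)‖ ≤ N a ^ k * ∏ i, ‖m i‖ := by
    rw [norm_prod]
    calc ∏ i, ‖L a (m i)‖ ≤ ∏ i, (N a * ‖m i‖) :=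
          Finset.prod_le_prod (fun _ _ => norm_nonneg _) fun i _ =>
            ((L a).le_opNorm _).trans (mul_le_mul_of_nonneg_right (hN a) (norm_nonneg _))
      _ = _ := by rw [Finset.prod_mul_distrib]; simp
  have h2 : N a ^ k / k.factorial ≤ r⁻¹ ^ k * Real.exp (r * N a) := by
    have := Real.pow_div_factorial_le_exp (r * N a) (by positivity) k
    calc N a ^ k / k.factorial = r⁻¹ ^ k * ((r * N a) ^ k / k.factorial) := by
          rw [mul_pow, inv_pow]; field_simp
      _ ≤ _ := mul_le_mul_of_nonneg_left this (by positivity)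
  rw [norm_div, norm_mul, norm_mul, norm_norm, Real.norm_of_nonneg (Real.exp_pos _).le]
  simp only [Complex.norm_natCast]
  have hP : 0 ≤ ∏ i, ‖m i‖ := Finset.prod_nonneg fun _ _ => norm_nonneg _
  calc ‖∏ i, L a (m i)‖ * ‖φ a‖ / k.factorial ≤ (N a ^ k * ∏ i, ‖m i‖) * ‖φ a‖ / k.factorial := by gcongr
    _ = (N a ^ k / k.factorial) * ((∏ i, ‖m i‖) * ‖φ a‖) := by ring
    _ ≤ (r⁻¹ ^ k * Real.exp (r * N a)) * ((∏ i, ‖m i‖) * ‖φ a‖) := by gcongr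
    _ = _ := by ring

variable [MeasurableSpace Ω] {μ : Measure Ω} {p : ℝ≥0∞}

theorem memLp_prod_mul_div_factorial {L : Ω → W →L[ℝ] ℂ} (hL : ∀ w, AEStronglyMeasurable (fun a => L a w) μ)
    {N : Ω → ℝ} (hN : ∀ a, ‖L a‖ ≤ N a) {φ : Ω → ℂ} (hφ : AEStronglyMeasurable φ μ) {r : ℝ}
    (hr : 0 < r) (hφr : MemLp (fun a => Real.exp (r * N a) * ‖φ a‖) p μ)
    (k : ℕ) (m : Fin k → W) :
    MemLp (fun a => (∏ i, L a (m i)) * φ a / (k.factorial : ℂ)) p μ := by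
  refine hφr.of_le_mul (c := (r⁻¹) ^ k * ∏ i, ‖m i‖) ?_
    (Filter.Eventually.of_forall fun a => norm_prod_mul_div_factorial_le hN φ hr k m a)
  have : AEStronglyMeasurable (fun a => ∏ i, L a (m i)) μ :=
    Finset.aestronglyMeasurable_fun_prod _ fun i _ => hL (m i)
  simp only [div_eq_mul_inv]
  exact (this.mul hφ).mul_const _

section Term

variable {L : Ω → W →L[ℝ] ℂ} (hL : ∀ w, AEStronglyMeasurable (fun a => L a w) μ)
  {N : Ω → ℝ} (hN : ∀ a, ‖L a‖ ≤ N a) {φ : Ω → ℂ} (hφ : AEStronglyMeasurable φ μ) {r : ℝ}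
  (hr : 0 < r) (hφr : MemLp (fun a => Real.exp (r * N a) * ‖φ a‖) p μ)

/-- The homogeneous terms of the expansion of `w ↦ exp (L w) φ`. -/
def expMultiplierTerm [Fact (1 ≤ p)] (k : ℕ) :
    ContinuousMultilinearMap ℝ (fun _ : Fin k => W) (Lp ℂ p μ) :=
  MultilinearMap.mkContinuous
    { toFun := fun m => (memLp_prod_mul_div_factorial hL hN hφ hr hφr k m).toLp
      map_update_add' := by
        intro _ m i x y
        rw [← MemLp.toLp_add, MemLp.toLp_eq_toLp_iff]
        refine Filter.Eventually.of_forall fun a => ?_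
        have := ((MultilinearMap.mkPiAlgebra ℝ (Fin k) ℂ).compLinearMap
          (fun _ => (L a : W →ₗ[ℝ] ℂ))).map_update_add m i x y
        simp only [MultilinearMap.compLinearMap_apply, MultilinearMap.mkPiAlgebra_apply,
          ContinuousLinearMap.coe_coe] at this
        simp only [Pi.add_apply]
        convert congrArg (fun z : ℂ => z * φ a / (k.factorial : ℂ)) this using 1
        ring
      map_update_smul' := by
        intro _ m i c x
        rw [← MemLp.toLp_const_smul, MemLp.toLp_eq_toLp_iff]
        refine Filter.Eventually.of_forall fun a => ?_
        have := ((MultilinearMap.mkPiAlgebra ℝ (Fin k) ℂ).compLinearMap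
          (fun _ => (L a : W →ₗ[ℝ] ℂ))).map_update_smul m i c x
        simp only [MultilinearMap.compLinearMap_apply, MultilinearMap.mkPiAlgebra_apply,
          ContinuousLinearMap.coe_coe] at this
        simp only [Pi.smul_apply]
        rw [this]
        simp only [Complex.real_smul]
        ring }
    ((r⁻¹) ^ k * ‖hφr.toLp‖) (by
      intro m
      have h := Lp.norm_le_mul_norm_of_ae_le_mul (c := (r⁻¹) ^ k * ∏ i, ‖m i‖)
        (f := (memLp_prod_mul_div_factorial hL hN hφ hr hφr k m).toLp) (g := hφr.toLp) ?_
      · refine h.trans_eq ?_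
        ring
      · filter_upwards [MemLp.coeFn_toLp (memLp_prod_mul_div_factorial hL hN hφ hr hφr k m),
          MemLp.coeFn_toLp hφr] with a h1 h2
        rw [h1, h2]
        exact norm_prod_mul_div_factorial_le hN φ hr k m a)

theorem expMultiplierTerm_coeFn [Fact (1 ≤ p)] (k : ℕ) (m : Fin k → W) :
    expMultiplierTerm hL hN hφ hr hφr k m =ᵐ[μ]
      fun a => (∏ i, L a (m i)) * φ a / (k.factorial : ℂ) :=
  MemLp.coeFn_toLp (memLp_prod_mul_div_factorial hL hN hφ hr hφr k m)

theorem norm_expMultiplierTerm_le [Fact (1 ≤ p)] (k : ℕ) :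
    ‖expMultiplierTerm hL hN hφ hr hφr k‖ ≤ (r⁻¹) ^ k * ‖hφr.toLp‖ :=
  MultilinearMap.mkContinuous_norm_le _ (by positivity) _

end Term

/-- If `e^{rN}φ ∈ Lᵖ` and `‖L‖ ≤ N`, then `w ↦ e^{L w} φ` is analytic at `0` with values
in `Lᵖ`. -/
theorem analyticAt_expMultiplier [Fact (1 ≤ p)]
    {L : Ω → W →L[ℝ] ℂ} (hL : ∀ w, AEStronglyMeasurable (fun a => L a w) μ)
    {N : Ω → ℝ} (hN : ∀ a, ‖L a‖ ≤ N a) {φ : Ω → ℂ} (hφ : AEStronglyMeasurable φ μ) {r : ℝ}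
    (hr : 0 < r) (hφr : MemLp (fun a => Real.exp (r * N a) * ‖φ a‖) p μ)
    {G : W → Lp ℂ p μ}
    (hG : ∀ w, ‖w‖ < r → G w =ᵐ[μ] fun a => Complex.exp (L a w) * φ a) : AnalyticAt ℝ G 0 := by
  let P : FormalMultilinearSeries ℝ W (Lp ℂ p μ) := fun k => expMultiplierTerm hL hN hφ hr hφr k
  refine ⟨P, ENNReal.ofReal r, ?_, by simpa using hr, ?_⟩
  · refine P.le_radius_of_bound (r := r.toNNReal) ‖hφr.toLp‖ fun k => ?_
    have := norm_expMultiplierTerm_le hL hN hφ hr hφr k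
    rw [Real.coe_toNNReal _ hr.le]
    calc ‖P k‖ * r ^ k ≤ (r⁻¹ ^ k * ‖hφr.toLp‖) * r ^ k := by gcongr
      _ = _ := by rw [inv_pow]; field_simp
  · intro w hw
    have hw' : ‖w‖ < r := by
      rw [Metric.eball_ofReal] at hw; simpa using hw
    rw [zero_add]
    -- `s < 1` is the ratio of the geometric series that controls both convergence and remainder.
    set s : ℝ := ‖w‖ / r with hs
    have hs0 : 0 ≤ s := by positivity
    have hs1 : s < 1 := (div_lt_one hr).2 hw'
    have hsummable : Summable fun k : ℕ => P k fun _ => w := by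
      refine Summable.of_norm_bounded (g := fun k => s ^ k * ‖hφr.toLp‖)
        ((summable_geometric_of_lt_one hs0 hs1).mul_right _) fun k => ?_
      refine ((P k).le_opNorm _).trans ?_
      have := norm_expMultiplierTerm_le hL hN hφ hr hφr k
      calc ‖P k‖ * ∏ _i : Fin k, ‖w‖ ≤ (r⁻¹ ^ k * ‖hφr.toLp‖) * ‖w‖ ^ k := by
            simp only [Finset.prod_const, Finset.card_univ, Fintype.card_fin]; gcongr
        _ = _ := by rw [hs, div_pow, inv_pow]; ring
    refine (hsummable.hasSum_iff_tendsto_nat).2 ?_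
    rw [tendsto_iff_norm_sub_tendsto_zero]
    refine squeeze_zero (fun _ => norm_nonneg _) (g := fun k => s ^ k * ‖hφr.toLp‖)
      (fun k => ?_) (by simpa using (tendsto_pow_atTop_nhds_zero_of_lt_one hs0 hs1).mul_const _)
    rw [norm_sub_rev]
    refine Lp.norm_le_mul_norm_of_ae_le_mul ?_
    have hterms : ∀ᵐ a ∂μ, ∀ j : ℕ, (P j fun _ => w) a = (L a w) ^ j * φ a / (j.factorial : ℂ) := by
      rw [ae_all_iff]
      intro j
      filter_upwards [expMultiplierTerm_coeFn hL hN hφ hr hφr j (fun _ => w)] with a ha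
      simpa using ha
    filter_upwards [hG w hw', Lp.coeFn_sub (G w) (∑ j ∈ Finset.range k, P j fun _ => w),
      Lp.coeFn_fun_finsetSum (Finset.range k) (fun j => P j fun _ => w), hterms,
      MemLp.coeFn_toLp hφr] with a h1 h2 h3 h4 h5
    rw [h2, Pi.sub_apply, h1, h3, h5]
    simp only [h4]
    have hN0 : 0 ≤ N a := (norm_nonneg _).trans (hN a)
    have e1 : Complex.exp (L a w) * φ a - ∑ j ∈ Finset.range k, (L a w) ^ j * φ a / (j.factorial : ℂ)
        = (Complex.exp (L a w) - ∑ j ∈ Finset.range k, (L a w) ^ j / (j.factorial : ℂ)) * φ a := by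
      rw [sub_mul, Finset.sum_mul]
      congr 1
      exact Finset.sum_congr rfl fun j _ => by ring
    rw [e1, norm_mul, norm_mul, norm_norm, Real.norm_of_nonneg (Real.exp_pos _).le, ← mul_assoc]
    refine mul_le_mul_of_nonneg_right ?_ (norm_nonneg _)
    set z := ‖L a w‖ with hz
    have hzle : z ≤ s * (r * N a) := by
      have := ((L a).le_opNorm w).trans (mul_le_mul_of_nonneg_right (hN a) (norm_nonneg w))
      rw [hs]; field_simp; linarith
    -- The complex remainder is at most the real one at `z = ‖L a w‖`. Since `z` is at most `s`
    -- times `r * N a`, the tail estimate yields `s^k e^{rN}`; the case `N a = 0` is separated only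
    -- because `z` is divided by `r * N a`.
    refine (Complex.norm_exp_sub_sum_le_exp_norm_sub_sum (L a w) k).trans ?_
    rcases hN0.eq_or_lt with h0 | h0
    · have hz0 : z = s * 0 := by
        refine le_antisymm ?_ (by simp [hz])
        simpa [← h0] using hzle
      have := exp_smul_sub_sum_le hs0 hs1.le le_rfl k
      rw [← hz0] at this
      simpa [← h0] using this
    · have hz1 : z = (z / (r * N a)) * (r * N a) := by field_simp
      have hq0 : 0 ≤ z / (r * N a) := by positivity
      have hqs : z / (r * N a) ≤ s := by rw [div_le_iff₀ (by positivity)]; exact hzle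
      have := exp_smul_sub_sum_le hq0 (hqs.trans hs1.le) (by positivity : 0 ≤ r * N a) k
      rw [← hz1] at this
      exact this.trans (mul_le_mul_of_nonneg_right (pow_le_pow_left₀ hq0 hqs k)
        (Real.exp_pos _).le)

end ExpMultiplier

end HeisenbergGroup

namespace HeisenbergGroup

open FourierTransform
open scoped ENNReal NNReal ContDiff

/-! ### The Fourier transform on `L¹ ∩ L²` -/

section Fourier

variable {n : ℕ}

theorem continuous_fourier {f : E n → ℂ} (hf : Integrable f) : Continuous (𝓕 f) :=
  VectorFourier.fourierIntegral_continuous Real.continuous_fourierChar continuous_inner hf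

theorem norm_fourier_le (f : E n → ℂ) (w : E n) : ‖𝓕 f w‖ ≤ ∫ v, ‖f v‖ :=
  VectorFourier.norm_fourierIntegral_le_integral_norm _ _ _ _ _

theorem integral_fourier_mul {f g : E n → ℂ} (hf : Integrable f) (hg : Integrable g) :
    ∫ ξ, 𝓕 f ξ * g ξ = ∫ x, f x * 𝓕 g x := by
  simpa using! VectorFourier.integral_bilin_fourierIntegral_eq_flip (ContinuousLinearMap.mul ℂ ℂ)
    (L := innerₗ (E n)) Real.continuous_fourierChar continuous_inner hf hg

/-- The `L²` Fourier transform is given by the Fourier integral on `L¹ ∩ L²`. -/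
theorem fourier_ae_eq (f : V n) (hf : Integrable f) :
    (𝓕 f : V n) =ᵐ[volume] 𝓕 (f : E n → ℂ) := by
  refine ae_eq_of_integral_contDiff_smul_eq
    ((Lp.memLp (𝓕 f : V n)).locallyIntegrable (by norm_num))
    (continuous_fourier hf).locallyIntegrable fun g hg hgc => ?_
  have hg₁ : HasCompactSupport (Complex.ofRealCLM ∘ g) := hgc.comp_left rfl
  have hg₂ : ContDiff ℝ ∞ (Complex.ofRealCLM ∘ g) := by fun_prop
  set s : SchwartzMap (E n) ℂ := hg₁.toSchwartzMap hg₂ with hs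
  have hs' : ∀ x, s x = (g x : ℂ) := fun x => rfl
  -- The distributional definition moves the transform onto the test function; the multiplication
  -- formula, available as `f` is integrable, moves it back as a Fourier integral of `f`.
  have h1 := congrArg (fun T => T s) (Lp.fourier_toTemperedDistribution_eq f)
  simp only [TemperedDistribution.fourier_apply, Lp.toTemperedDistribution_apply] at h1
  have h2 := integral_fourier_mul s.integrable hf
  rw [SchwartzMap.fourier_coe] at h1
  simp only [smul_eq_mul] at h1
  rw [h2] at h1
  simpa only [hs', Complex.real_smul] using h1.symm

theorem fourier_neg_apply (f : E n → ℂ) (w : E n) : 𝓕 (fun x => f (-x)) w = 𝓕 f (-w) := by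
  have := Real.fourier_comp_linearIsometry (LinearIsometryEquiv.neg ℝ (E := E n)) f w
  simpa [Function.comp_def] using this

theorem integral_fourierInv_mul {f g : E n → ℂ} (hf : Integrable f) (hg : Integrable g) :
    ∫ ξ, 𝓕⁻ f ξ * g ξ = ∫ x, f x * 𝓕⁻ g x := by
  have h := integral_fourier_mul hf.comp_neg hg
  simp only [fourier_neg_apply] at h
  simp only [Real.fourierInv_eq_fourier_neg]
  rw [h, ← integral_neg_eq_self]
  simp

/-- The inverse `L²` Fourier transform is given by the Fourier integral on `L¹ ∩ L²`. -/
theorem fourierInv_ae_eq (f : V n) (hf : Integrable f) :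
    (𝓕⁻ f : V n) =ᵐ[volume] 𝓕⁻ (f : E n → ℂ) := by
  have hc : Continuous (𝓕⁻ (f : E n → ℂ)) := by
    simp only [Real.fourierInv_eq_fourier_comp_neg]
    exact continuous_fourier hf.comp_neg
  refine ae_eq_of_integral_contDiff_smul_eq
    ((Lp.memLp (𝓕⁻ f : V n)).locallyIntegrable (by norm_num))
    hc.locallyIntegrable fun g hg hgc => ?_
  have hg₁ : HasCompactSupport (Complex.ofRealCLM ∘ g) := hgc.comp_left rfl
  have hg₂ : ContDiff ℝ ∞ (Complex.ofRealCLM ∘ g) := by fun_prop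
  set s : SchwartzMap (E n) ℂ := hg₁.toSchwartzMap hg₂ with hs
  have hs' : ∀ x, s x = (g x : ℂ) := fun x => rfl
  have h1 := congrArg (fun T => T s) (Lp.fourierInv_toTemperedDistribution_eq f)
  simp only [TemperedDistribution.fourierInv_apply, Lp.toTemperedDistribution_apply] at h1
  have h2 := integral_fourierInv_mul s.integrable hf
  rw [SchwartzMap.fourierInv_coe] at h1
  simp only [smul_eq_mul] at h1
  rw [h2] at h1
  simpa only [hs', Complex.real_smul] using h1.symm

/-- Characters satisfy `|e^{iθ} - e^{iη}| ≤ |θ - η|`, so the first moment is a Lipschitz constant up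
to `2π`. This regularity is what allows `ExpWeighted.expDecay` to be applied. -/
theorem lipschitz_fourier {f : E n → ℂ} (hf : Integrable f)
    (hf1 : Integrable fun v => ‖v‖ * ‖f v‖) :
    ∃ K : ℝ, 0 ≤ K ∧ ∀ a b, ‖𝓕 f a - 𝓕 f b‖ ≤ K * ‖a - b‖ := by
  refine ⟨2 * Real.pi * ∫ v, ‖v‖ * ‖f v‖, by positivity, fun a b => ?_⟩
  have hint : ∀ w : E n, Integrable fun v : E n =>
      Complex.exp (((-2 * Real.pi * inner ℝ v w : ℝ) : ℂ) * Complex.I) • f v := fun w => by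
    refine hf.norm.mono' ?_ (Filter.Eventually.of_forall fun v => ?_)
    · have hc : Continuous fun v : E n =>
          Complex.exp (((-2 * Real.pi * inner ℝ v w : ℝ) : ℂ) * Complex.I) := by fun_prop
      exact hc.aestronglyMeasurable.smul hf.1
    · rw [norm_smul, Complex.norm_exp_ofReal_mul_I, one_mul]
  rw [Real.fourier_eq', Real.fourier_eq', ← integral_sub (hint a) (hint b)]
  calc _ ≤ ∫ v, (2 * Real.pi * ‖a - b‖) * (‖v‖ * ‖f v‖) := by
        refine norm_integral_le_of_norm_le (hf1.const_mul _)
          (Filter.Eventually.of_forall fun v => ?_)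
        rw [← sub_smul, norm_smul]
        set θ : ℝ := -2 * Real.pi * inner ℝ v a
        set η : ℝ := -2 * Real.pi * inner ℝ v b
        have e1 : Complex.exp ((θ : ℂ) * Complex.I) - Complex.exp ((η : ℂ) * Complex.I) =
            Complex.exp ((η : ℂ) * Complex.I) *
              (Complex.exp (Complex.I * ((θ - η : ℝ) : ℂ)) - 1) := by
          rw [mul_sub, ← Complex.exp_add, mul_one]
          congr 2
          push_cast; ring
        rw [e1, norm_mul, Complex.norm_exp_ofReal_mul_I, one_mul]
        have e2 : ‖θ - η‖ ≤ 2 * Real.pi * ‖a - b‖ * ‖v‖ := by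
          have : θ - η = -2 * Real.pi * inner ℝ v (a - b) := by rw [inner_sub_right]; ring
          rw [this, norm_mul, norm_mul, norm_neg, Real.norm_two,
            Real.norm_of_nonneg Real.pi_pos.le, mul_assoc _ ‖a - b‖, mul_comm ‖a - b‖]
          gcongr
          exact norm_inner_le_norm _ _
        calc _ ≤ (2 * Real.pi * ‖a - b‖ * ‖v‖) * ‖f v‖ := by
              gcongr
              exact Real.norm_exp_I_mul_ofReal_sub_one_le.trans e2
          _ = _ := by ring
    _ = _ := by rw [integral_const_mul]; ring

end Fourier

/-! ### Exponential decay -/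

section Decay

variable {n : ℕ}

theorem integrable_exp_neg_mul_norm {t : ℝ} (ht : 0 < t) :
    Integrable fun x : E n => Real.exp (-t * ‖x‖) := by
  have h := integrable_one_add_norm (E := E n) (μ := volume) (r := (n : ℝ) + 1) (by simp)
  obtain ⟨C, hC⟩ : ∃ C, ∀ y : ℝ, 0 ≤ y → (1 + y) ^ ((n : ℝ) + 1) * Real.exp (-t * y) ≤ C := by
    -- The constant comes from `(t(1+y))^{n+1} / (n+1)! ≤ e^{t(1+y)}`; the exponent `n + 1` is large
    -- enough for `(1+|x|)^{-(n+1)}` to be integrable on `ℝⁿ`.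
    refine ⟨(t⁻¹) ^ (n + 1) * ((n + 1).factorial * Real.exp t), fun y hy => ?_⟩
    have h1 := Real.pow_div_factorial_le_exp (t * (1 + y)) (by positivity) (n + 1)
    rw [div_le_iff₀ (by positivity)] at h1
    have h2 : (1 + y) ^ ((n : ℝ) + 1) = (1 + y) ^ (n + 1) := by
      rw [← Nat.cast_succ, Real.rpow_natCast]
    rw [h2]
    have h3 : (1 + y) ^ (n + 1) = t⁻¹ ^ (n + 1) * (t * (1 + y)) ^ (n + 1) := by
      rw [mul_pow, inv_pow]; field_simp
    rw [h3, mul_assoc]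
    refine mul_le_mul_of_nonneg_left ?_ (by positivity)
    calc _ ≤ (Real.exp (t * (1 + y)) * (n + 1).factorial) * Real.exp (-t * y) := by gcongr
      _ = (n + 1).factorial * (Real.exp (t * (1 + y)) * Real.exp (-t * y)) := by ring
      _ = _ := by rw [← Real.exp_add]; congr 2; ring
  refine (h.const_mul C).mono' (Continuous.aestronglyMeasurable (by fun_prop))
    (Filter.Eventually.of_forall fun x => ?_)
  rw [Real.norm_of_nonneg (Real.exp_pos _).le, Real.rpow_neg (by positivity),
    ← div_eq_mul_inv, le_div_iff₀ (by positivity), mul_comm]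
  exact hC _ (norm_nonneg x)

theorem memLp_exp_neg_mul_norm {t : ℝ} (ht : 0 < t) :
    MemLp (fun x : E n => Real.exp (-t * ‖x‖)) 2 volume := by
  rw [memLp_two_iff_integrable_sq (Continuous.aestronglyMeasurable (by fun_prop))]
  convert integrable_exp_neg_mul_norm (n := n) (mul_pos two_pos ht) using 2 with x
  rw [← Real.exp_nat_mul]
  congr 1
  push_cast; ring

/-- `φ` decays exponentially. -/
def ExpDecay (φ : E n → ℂ) : Prop :=
  ∃ t : ℝ, 0 < t ∧ ∃ C : ℝ, ∀ ξ, ‖φ ξ‖ ≤ C * Real.exp (-t * ‖ξ‖)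

theorem ExpDecay.integrable {φ : E n → ℂ} (h : ExpDecay φ) (hm : AEStronglyMeasurable φ volume) :
    Integrable φ := by
  obtain ⟨t, ht, C, hC⟩ := h
  exact ((integrable_exp_neg_mul_norm ht).const_mul C).mono' hm (Filter.Eventually.of_forall hC)

theorem ExpDecay.memLp {φ : E n → ℂ} (h : ExpDecay φ) (hm : AEStronglyMeasurable φ volume) :
    MemLp φ 2 volume := by
  obtain ⟨t, ht, C, hC⟩ := h
  refine (memLp_exp_neg_mul_norm ht).of_le_mul (c := C) hm (Filter.Eventually.of_forall fun ξ => ?_)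
  rw [Real.norm_of_nonneg (Real.exp_pos _).le]
  exact hC ξ

/-- `e^{r|ξ|} φ` is square integrable for some `r > 0`. -/
def ExpWeighted (φ : E n → ℂ) : Prop :=
  ∃ r : ℝ, 0 < r ∧ MemLp (fun ξ => Real.exp (r * ‖ξ‖) * ‖φ ξ‖) 2 volume

theorem ExpWeighted.congr {φ ψ : E n → ℂ} (h : ExpWeighted φ) (e : φ =ᵐ[volume] ψ) :
    ExpWeighted ψ := by
  obtain ⟨r, hr, h⟩ := h
  refine ⟨r, hr, (memLp_congr_ae ?_).1 h⟩
  filter_upwards [e] with x hx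
  rw [hx]

/-- Half of the weight is spent on Cauchy–Schwarz against `e^{-r|ξ|/2}`. The remaining integrable
function `e^{r|ξ|/2}|φ|` dominates `|φ|` and, up to a constant, `|ξ||φ|`. -/
theorem ExpWeighted.integrable_mul {φ : E n → ℂ} (h : ExpWeighted φ)
    (hm : AEStronglyMeasurable φ volume) : Integrable φ ∧ Integrable fun v => ‖v‖ * ‖φ v‖ := by
  obtain ⟨r, hr, h⟩ := h
  have h1 : Integrable fun ξ : E n =>
      Real.exp (-(r / 2) * ‖ξ‖) * (Real.exp (r * ‖ξ‖) * ‖φ ξ‖) := by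
    have := (memLp_exp_neg_mul_norm (n := n) (half_pos hr)).integrable_mul h
    exact this
  have h2 : ∀ ξ : E n, Real.exp (-(r / 2) * ‖ξ‖) * (Real.exp (r * ‖ξ‖) * ‖φ ξ‖) =
      Real.exp ((r / 2) * ‖ξ‖) * ‖φ ξ‖ := fun ξ => by
    rw [← mul_assoc, ← Real.exp_add]; congr 2; ring
  simp only [h2] at h1
  constructor
  · refine h1.mono' hm (Filter.Eventually.of_forall fun ξ => ?_)
    exact le_mul_of_one_le_left (norm_nonneg _) (Real.one_le_exp (by positivity))
  · refine (h1.const_mul (r / 2)⁻¹).mono' (by fun_prop) (Filter.Eventually.of_forall fun ξ => ?_)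
    rw [norm_mul, norm_norm, norm_norm, ← mul_assoc]
    refine mul_le_mul_of_nonneg_right ?_ (norm_nonneg _)
    have := Real.add_one_le_exp (r / 2 * ‖ξ‖)
    rw [inv_mul_eq_div, le_div_iff₀ (by positivity)]
    linarith

/-- A bounded Lipschitz function with an exponentially weighted `L²` bound decays
exponentially: a large value at a point forces a large integral on a ball around it. -/
theorem ExpWeighted.expDecay {φ : E n → ℂ} (h : ExpWeighted φ) {K : ℝ} (hK : 0 ≤ K)
    (hLip : ∀ a b, ‖φ a - φ b‖ ≤ K * ‖a - b‖) {M : ℝ} (hM : ∀ a, ‖φ a‖ ≤ M) : ExpDecay φ := by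
  obtain ⟨r, hr, h⟩ := h
  have hM0 : 0 ≤ M := (norm_nonneg _).trans (hM 0)
  have hint : Integrable fun ξ : E n => (Real.exp (r * ‖ξ‖) * ‖φ ξ‖) ^ 2 :=
    (memLp_two_iff_integrable_sq h.1).1 h
  set I := ∫ ξ : E n, (Real.exp (r * ‖ξ‖) * ‖φ ξ‖) ^ 2 with hI
  set K' := K + M + 1 with hK'
  have hK'0 : 0 < K' := by positivity
  set b := (volume (Metric.ball (0 : E n) 1)).toReal with hb
  have hb0 : 0 < b :=
    ENNReal.toReal_pos (Metric.measure_ball_pos _ _ one_pos).ne' measure_ball_lt_top.ne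
  -- Two powers of `‖φ ξ‖` come from the square in the integrand, and `n` from the volume of a ball
  -- whose radius is proportional to `‖φ ξ‖`. Taking the root of order `n + 2` at the end costs only
  -- a smaller rate.
  have key : ∀ ξ : E n, ‖φ ξ‖ ^ (n + 2) ≤
      (I * (2 * K') ^ n * 4 / b * Real.exp (2 * r)) * Real.exp (-(2 * r) * ‖ξ‖) := by
    intro ξ
    set δ := ‖φ ξ‖ with hδ
    rcases (norm_nonneg (φ ξ)).eq_or_lt with h0 | h0
    · rw [hδ, ← h0, zero_pow (by omega)]
      positivity
    -- On this ball the Lipschitz bound loses at most `δ / 2`. Including `M` in `K'` forces `ρ ≤ 1`,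
    -- so the weight changes by a bounded factor.
    set ρ := δ / (2 * K') with hρ
    have hρ0 : 0 < ρ := by positivity
    have hρ1 : ρ ≤ 1 := by
      rw [hρ, div_le_one (by positivity)]
      have := hM ξ
      linarith
    have hlow : ∀ η ∈ Metric.ball ξ ρ,
        (Real.exp (r * (‖ξ‖ - 1)) * (δ / 2)) ^ 2 ≤ (Real.exp (r * ‖η‖) * ‖φ η‖) ^ 2 := by
      intro η hη
      rw [mem_ball_iff_norm] at hη
      have h1 : ‖ξ‖ - 1 ≤ ‖η‖ := by
        have := norm_sub_norm_le ξ η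
        rw [norm_sub_rev] at this
        linarith
      have h2 : δ / 2 ≤ ‖φ η‖ := by
        have h3 := hLip ξ η
        have h4 : K * ‖ξ - η‖ ≤ K' * ρ := by
          rw [norm_sub_rev]
          exact mul_le_mul (by linarith) hη.le (norm_nonneg _) hK'0.le
        have h5 : K' * ρ = δ / 2 := by rw [hρ]; field_simp
        have := norm_sub_norm_le (φ ξ) (φ η)
        linarith
      gcongr
    have hvol : (volume (Metric.ball ξ ρ)).toReal = ρ ^ n * b := by
      rw [Measure.addHaar_ball_of_pos _ _ hρ0, ENNReal.toReal_mul, ENNReal.toReal_ofReal (by positivity)]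
      simp [hb]
    have hle : (Real.exp (r * (‖ξ‖ - 1)) * (δ / 2)) ^ 2 * (ρ ^ n * b) ≤ I := by
      calc _ = ∫ _ in Metric.ball ξ ρ, (Real.exp (r * (‖ξ‖ - 1)) * (δ / 2)) ^ 2 := by
            rw [setIntegral_const, Measure.real, hvol, smul_eq_mul, mul_comm]
        _ ≤ ∫ η in Metric.ball ξ ρ, (Real.exp (r * ‖η‖) * ‖φ η‖) ^ 2 :=
            setIntegral_mono_on (integrableOn_const measure_ball_lt_top.ne) hint.integrableOn
              measurableSet_ball hlow
        _ ≤ I := setIntegral_le_integral hint (Filter.Eventually.of_forall fun _ => by positivity)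
    have e1 : (Real.exp (r * (‖ξ‖ - 1)) * (δ / 2)) ^ 2 * (ρ ^ n * b) =
        δ ^ (n + 2) * (b / ((2 * K') ^ n * 4)) * Real.exp (2 * r * (‖ξ‖ - 1)) := by
      rw [mul_pow, ← Real.exp_nat_mul, hρ, div_pow, div_pow]
      push_cast
      rw [← mul_assoc 2 r]
      field_simp
      ring
    rw [e1] at hle
    have e2 : Real.exp (2 * r) * Real.exp (-(2 * r) * ‖ξ‖) =
        (Real.exp (2 * r * (‖ξ‖ - 1)))⁻¹ := by
      rw [← Real.exp_add, ← Real.exp_neg]; congr 1; ring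
    rw [mul_assoc, e2, ← div_eq_mul_inv, le_div_iff₀ (Real.exp_pos _)]
    have : δ ^ (n + 2) * Real.exp (2 * r * (‖ξ‖ - 1)) =
        (δ ^ (n + 2) * (b / ((2 * K') ^ n * 4)) * Real.exp (2 * r * (‖ξ‖ - 1))) *
          (((2 * K') ^ n * 4) / b) := by field_simp
    rw [this]
    calc _ ≤ I * (((2 * K') ^ n * 4) / b) := by gcongr
      _ = _ := by ring
  set A := I * (2 * K') ^ n * 4 / b * Real.exp (2 * r) with hA
  have hA0 : 0 ≤ A := by positivity
  have hn2 : (0 : ℝ) < (n + 2 : ℕ) := by positivity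
  refine ⟨2 * r / (n + 2 : ℕ), by positivity, A ^ (1 / (n + 2 : ℕ) : ℝ), fun ξ => ?_⟩
  have h1 := Real.rpow_le_rpow (by positivity) (key ξ) (by positivity : 0 ≤ (1 / (n + 2 : ℕ) : ℝ))
  rw [← Real.rpow_natCast, ← Real.rpow_mul (norm_nonneg _), mul_one_div_cancel hn2.ne',
    Real.rpow_one, Real.mul_rpow hA0 (Real.exp_pos _).le, ← Real.exp_mul] at h1
  refine h1.trans_eq ?_
  congr 2
  field_simp

/-- A function whose pairings with `L²` are dominated by those of `w` is dominated by `w`. -/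
theorem norm_le_of_inner_le (ψ : V n) {w : E n → ℝ} (hw : MemLp w 2 volume) (hw0 : ∀ ξ, 0 ≤ w ξ)
    (h : ∀ g : V n, ‖inner ℂ g ψ‖ ≤ ∫ ξ, ‖g ξ‖ * w ξ) : ∀ᵐ ξ, ‖ψ ξ‖ ≤ w ξ := by
  obtain ⟨w', hw'm, hww'⟩ := hw.1
  obtain ⟨ψ', hψ'm, hψψ'⟩ := (Lp.memLp ψ).1
  -- The bad set is defined through measurable representatives so that `1_A ψ` is an admissible test
  -- vector; pairing with it forces `∫_A ‖ψ‖(‖ψ‖ - w) ≤ 0`.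
  set A : Set (E n) := {ξ | w' ξ < ‖ψ' ξ‖} with hA
  have hAm : MeasurableSet A := measurableSet_lt hw'm.measurable hψ'm.norm.measurable
  have hg : MemLp (A.indicator ψ) 2 volume := (Lp.memLp ψ).indicator hAm
  have h1 := h hg.toLp
  have e1 : inner ℂ hg.toLp ψ = ((∫ ξ, A.indicator (fun ξ => ‖ψ ξ‖ ^ 2) ξ : ℝ) : ℂ) := by
    rw [L2.inner_def, ← integral_complex_ofReal]
    refine integral_congr_ae ?_
    filter_upwards [hg.coeFn_toLp] with ξ hξ
    rw [hξ]
    by_cases hx : ξ ∈ A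
    · simp only [Set.indicator_of_mem hx]
      rw [inner_self_eq_norm_sq_to_K]
      simp
    · simp [Set.indicator_of_notMem hx]
  have e2 : ∫ ξ, ‖(hg.toLp : V n) ξ‖ * w ξ = ∫ ξ, A.indicator (fun ξ => ‖ψ ξ‖ * w ξ) ξ := by
    refine integral_congr_ae ?_
    filter_upwards [hg.coeFn_toLp] with ξ hξ
    rw [hξ]
    by_cases hx : ξ ∈ A
    · simp only [Set.indicator_of_mem hx]
    · simp [Set.indicator_of_notMem hx]
  have i1 : Integrable (A.indicator fun ξ => ‖ψ ξ‖ ^ 2) :=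
    ((memLp_two_iff_integrable_sq_norm (Lp.memLp ψ).1).1 (Lp.memLp ψ)).indicator hAm
  have i2 : Integrable (A.indicator fun ξ => ‖ψ ξ‖ * w ξ) :=
    ((Lp.memLp ψ).norm.integrable_mul hw).indicator hAm
  rw [e1, e2] at h1
  have h2 : ∫ ξ, A.indicator (fun ξ => ‖ψ ξ‖ ^ 2) ξ ≤ ∫ ξ, A.indicator (fun ξ => ‖ψ ξ‖ * w ξ) ξ := by
    refine le_trans (le_abs_self _) ?_
    simpa using h1
  have h3 : ∫ ξ, (A.indicator (fun ξ => ‖ψ ξ‖ ^ 2) ξ - A.indicator (fun ξ => ‖ψ ξ‖ * w ξ) ξ) ≤ 0 := by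
    rw [integral_sub i1 i2]; linarith
  have h4 : 0 ≤ᵐ[volume] fun ξ =>
      A.indicator (fun ξ => ‖ψ ξ‖ ^ 2) ξ - A.indicator (fun ξ => ‖ψ ξ‖ * w ξ) ξ := by
    filter_upwards [hww', hψψ'] with ξ hx1 hx2
    by_cases hx : ξ ∈ A
    · simp only [Set.indicator_of_mem hx, Pi.zero_apply]
      have : w ξ < ‖ψ ξ‖ := by rw [hx1, hx2]; exact hx
      nlinarith [norm_nonneg (ψ ξ)]
    · simp [Set.indicator_of_notMem hx]
  have h5 := (integral_eq_zero_iff_of_nonneg_ae h4 (i1.sub i2)).1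
    (le_antisymm h3 (integral_nonneg_of_ae h4))
  filter_upwards [h5, hww', hψψ'] with ξ hx3 hx1 hx2
  by_contra hx
  push Not at hx
  have hxA : ξ ∈ A := by
    simp only [hA, Set.mem_ofPred_eq, ← hx1, ← hx2]; exact hx
  simp only [Set.indicator_of_mem hxA, Pi.zero_apply] at hx3
  have hz : ‖ψ ξ‖ * (‖ψ ξ‖ - w ξ) = 0 := by linarith
  rcases mul_eq_zero.1 hz with h | h
  · exact absurd (hw0 ξ) (by rw [not_le, ← h]; exact hx)
  · linarith

end Decay

end HeisenbergGroup

namespace HeisenbergGroup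

open FourierTransform
open scoped ENNReal NNReal

/-! ### The Schrödinger representation -/

section Representation

variable {n : ℕ} (lam : ℝ)

theorem schrodinger_coeFn (p : H n) (φ : V n) :
    schrodinger lam p φ =ᵐ[volume] schrodingerFun lam p φ :=
  (memLp_schrodingerFun lam p φ).coeFn_toLp

theorem ae_comp_add_right {P : E n → Prop} (h : ∀ᵐ ξ, P ξ) (u : E n) : ∀ᵐ ξ, P (ξ + u) :=
  (measurePreserving_add_right volume u).quasiMeasurePreserving.ae h

theorem schrodingerFun_congr (p : H n) {φ ψ : E n → ℂ} (h : φ =ᵐ[volume] ψ) :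
    schrodingerFun lam p φ =ᵐ[volume] schrodingerFun lam p ψ := by
  filter_upwards [ae_comp_add_right h p.2.1] with ξ hξ
  simp only [schrodingerFun, hξ]

theorem norm_schrodingerFun (p : H n) (φ : E n → ℂ) (ξ : E n) :
    ‖schrodingerFun lam p φ ξ‖ = ‖φ (ξ + p.2.1)‖ := by
  simp only [schrodingerFun, norm_mul, Complex.norm_exp_I_mul_ofReal, one_mul]

/-- `π_lam(p)` as a linear isometry. -/
def schrodingerₗᵢ (p : H n) : V n →ₗᵢ[ℂ] V n where
  toFun := schrodinger lam p
  map_add' φ ψ := by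
    refine Lp.ext ?_
    filter_upwards [schrodinger_coeFn lam p (φ + ψ), schrodinger_coeFn lam p φ,
      schrodinger_coeFn lam p ψ, Lp.coeFn_add (schrodinger lam p φ) (schrodinger lam p ψ),
      schrodingerFun_congr lam p (Lp.coeFn_add φ ψ)] with ξ h1 h2 h3 h4 h5
    rw [h1, h4, h5, Pi.add_apply, h2, h3]
    simp only [schrodingerFun, Pi.add_apply, mul_add]
  map_smul' c φ := by
    refine Lp.ext ?_
    filter_upwards [schrodinger_coeFn lam p (c • φ), schrodinger_coeFn lam p φ,
      Lp.coeFn_smul c (schrodinger lam p φ),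
      schrodingerFun_congr lam p (Lp.coeFn_smul c φ)] with ξ h1 h2 h4 h5
    rw [h1, RingHom.id_apply, h4, h5, Pi.smul_apply, h2]
    simp only [schrodingerFun, Pi.smul_apply, smul_eq_mul]
    ring
  norm_map' φ := by
    change ‖schrodinger lam p φ‖ = ‖φ‖
    rw [schrodinger, Lp.norm_toLp, Lp.norm_def]
    congr 1
    rw [eLpNorm_congr_norm_ae (g := fun ξ => φ (ξ + p.2.1))
      (Filter.Eventually.of_forall fun ξ => norm_schrodingerFun lam p φ ξ)]
    exact eLpNorm_comp_measurePreserving (Lp.memLp φ).1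
      (measurePreserving_add_right volume p.2.1)

@[simp] theorem schrodingerₗᵢ_apply (p : H n) (φ : V n) :
    schrodingerₗᵢ lam p φ = schrodinger lam p φ := rfl

theorem norm_schrodinger (p : H n) (φ : V n) : ‖schrodinger lam p φ‖ = ‖φ‖ :=
  (schrodingerₗᵢ lam p).norm_map φ

theorem schrodingerFun_mul (p q : H n) (φ : E n → ℂ) :
    schrodingerFun lam p (schrodingerFun lam q φ) = schrodingerFun lam (mul p q) φ := by
  obtain ⟨x, u, t⟩ := p
  obtain ⟨y, v, s⟩ := q
  funext ξ
  simp only [schrodingerFun, mul]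
  rw [add_assoc ξ u v]
  simp only [← mul_assoc, ← Complex.exp_add, ← mul_add, ← Complex.ofReal_add]
  congr 4
  simp only [inner_add_left, inner_add_right]
  rw [real_inner_comm u y, real_inner_comm x v]
  ring

theorem schrodinger_mul (p q : H n) (φ : V n) :
    schrodinger lam p (schrodinger lam q φ) = schrodinger lam (mul p q) φ := by
  refine Lp.ext ?_
  filter_upwards [schrodinger_coeFn lam p (schrodinger lam q φ), schrodinger_coeFn lam (mul p q) φ,
    schrodingerFun_congr lam p (schrodinger_coeFn lam q φ)] with ξ h1 h2 h3
  rw [h1, h2, h3, schrodingerFun_mul]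

theorem schrodinger_central (s : ℝ) (φ : V n) :
    schrodinger lam (0, 0, s) φ = Complex.exp (Complex.I * ((lam * s : ℝ) : ℂ)) • φ := by
  refine Lp.ext ?_
  filter_upwards [schrodinger_coeFn lam (0, 0, s) φ,
    Lp.coeFn_smul (Complex.exp (Complex.I * ((lam * s : ℝ) : ℂ))) φ] with ξ h1 h2
  rw [h1, h2]
  simp [schrodingerFun]

theorem schrodinger_zero (φ : V n) : schrodinger lam 0 φ = φ := by
  have h := schrodinger_central lam 0 φ
  rw [mul_zero, Complex.ofReal_zero, mul_zero, Complex.exp_zero, one_smul] at h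
  exact h

/-- The automorphism of `ℍⁿ` that corresponds to the Fourier transform. -/
def fourierAut (p : H n) : H n :=
  ((2 * Real.pi / lam) • p.2.1, -((lam / (2 * Real.pi)) • p.1), p.2.2)

variable {lam}

/-- On `(x, u)` the map is `(c u, -c⁻¹ x)`, which preserves the symplectic form `u·y - v·x` of the
group law. -/
theorem fourierAut_mul (hlam : lam ≠ 0) (p q : H n) :
    fourierAut lam (mul p q) = mul (fourierAut lam p) (fourierAut lam q) := by
  have : (2 * Real.pi / lam) * (lam / (2 * Real.pi)) = 1 := by
    have := Real.pi_ne_zero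
    field_simp
  refine Prod.ext ?_ (Prod.ext ?_ ?_)
  · simp [fourierAut, mul]
  · simp [fourierAut, mul, add_comm]
  · simp only [fourierAut, mul, inner_neg_left, real_inner_smul_left, real_inner_smul_right]
    rw [real_inner_comm q.2.1 p.1, real_inner_comm p.2.1 q.1]
    linear_combination (-(1 / 2) * (inner ℝ p.2.1 q.1 - inner ℝ q.2.1 p.1) : ℝ) * this

/-- The Fourier transform exchanges translations and modulations; the factors `2π/lam` and `lam/2π`
reconcile the phase `e^{i lam x·ξ}` with the character `e^{-2πi x·ξ}`. The symmetric term `x·u/2`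
makes the remaining phases agree. -/
theorem fourier_schrodingerFun (hlam : lam ≠ 0) (p : H n) (φ : E n → ℂ) :
    𝓕 (schrodingerFun lam p φ) = schrodingerFun lam (fourierAut lam p) (𝓕 φ) := by
  obtain ⟨x, u, t⟩ := p
  funext ω
  have hpi := Real.pi_ne_zero
  simp only [schrodingerFun, fourierAut]
  rw [Real.fourier_eq', Real.fourier_eq', ← integral_const_mul,
    ← integral_sub_right_eq_self _ u]
  refine integral_congr_ae (Filter.Eventually.of_forall fun ξ => ?_)
  simp only [smul_eq_mul, schrodingerFun, sub_add_cancel, ← mul_assoc]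
  congr 1
  simp only [← Complex.exp_add]
  congr 1
  simp only [inner_sub_left, inner_sub_right, inner_add_right, inner_neg_right,
    real_inner_smul_left, real_inner_smul_right]
  rw [real_inner_comm x u, real_inner_comm x ξ]
  have hl : (lam : ℂ) ≠ 0 := by exact_mod_cast hlam
  have hp : (Real.pi : ℂ) ≠ 0 := by exact_mod_cast hpi
  push_cast
  field_simp
  ring

/-- The Fourier transform intertwines `π_lam` with its twist by `fourierAut`. -/
theorem fourier_schrodinger (hlam : lam ≠ 0) (p : H n) (φ : V n) :
    (𝓕 (schrodinger lam p φ) : V n) = schrodinger lam (fourierAut lam p) (𝓕 φ) := by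
  -- Both sides are continuous in `φ`, so Schwartz functions suffice, and for them the `L²`
  -- transform is a Fourier integral.
  have hd := SchwartzMap.denseRange_toLpCLM (E := E n) (F := ℂ) (p := 2)
    (μ := (volume : Measure (E n))) ENNReal.ofNat_ne_top
  refine hd.induction_on (p := fun φ : V n =>
    (𝓕 (schrodinger lam p φ) : V n) = schrodinger lam (fourierAut lam p) (𝓕 φ)) φ ?_ fun s => ?_
  · refine isClosed_eq ?_ ?_
    · exact (Lp.fourierTransformₗᵢ (E n) ℂ).continuous.comp (schrodingerₗᵢ lam p).continuous
    · exact (schrodingerₗᵢ lam (fourierAut lam p)).continuous.comp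
        (Lp.fourierTransformₗᵢ (E n) ℂ).continuous
  · set f : V n := s.toLp 2 with hf
    change (𝓕 (schrodinger lam p f) : V n) = schrodinger lam (fourierAut lam p) (𝓕 f)
    have hsf : f =ᵐ[volume] s := s.coeFn_toLp 2
    have hfi : Integrable f := (integrable_congr hsf).2 s.integrable
    have hi : Integrable (schrodinger lam p f) := by
      refine (Integrable.congr ?_ (schrodinger_coeFn lam p f).symm)
      have := hfi.comp_add_right p.2.1
      refine this.norm.mono' (memLp_schrodingerFun lam p f).1
        (Filter.Eventually.of_forall fun ξ => (norm_schrodingerFun lam p f ξ).le)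
    refine Lp.ext ?_
    have h1 := fourier_ae_eq _ hi
    have h2 : 𝓕 (schrodinger lam p f : E n → ℂ) = 𝓕 (schrodingerFun lam p f) :=
      funext fun w => Real.fourier_congr_ae (schrodinger_coeFn lam p f) w
    rw [h2, fourier_schrodingerFun hlam] at h1
    refine h1.trans ?_
    refine (schrodingerFun_congr lam _ (fourier_ae_eq f hfi)).symm.trans ?_
    exact (schrodinger_coeFn lam _ _).symm

theorem continuous_schrodinger_translation (φ : V n) :
    Continuous fun u : E n => schrodinger lam (0, u, 0) φ := by
  have h := Continuous.compMeasurePreservingLp (X := E n) (Y := E n) (μ := volume) (ν := volume)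
    (p := 2) (E := ℂ) (Z := E n)
    (g := fun u => (⟨fun ξ => ξ + u, by fun_prop⟩ : C(E n, E n))) (f := fun _ => φ)
    continuous_const (ContinuousMap.continuous_of_continuous_uncurry _ (by
      simp only [Function.uncurry_def]; exact continuous_snd.add continuous_fst))
    (fun u => measurePreserving_add_right volume u) (by norm_num)
  refine h.congr fun u => Lp.ext ?_
  filter_upwards [schrodinger_coeFn lam (0, u, 0) φ,
    Lp.coeFn_compMeasurePreserving φ (measurePreserving_add_right volume u)] with ξ h1 h2
  rw [h1]
  refine h2.trans ?_
  simp [schrodingerFun]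

theorem fourierAut_fst (x : E n) :
    fourierAut lam (x, 0, 0) = (0, -((lam / (2 * Real.pi)) • x), 0) := by
  simp [fourierAut]

/-- Modulations are conjugate to translations under the Fourier transform, so continuity of
translations in `L²` is enough. -/
theorem continuous_schrodinger_modulation (hlam : lam ≠ 0) (φ : V n) :
    Continuous fun x : E n => schrodinger lam (x, 0, 0) φ := by
  have h : ∀ x : E n, schrodinger lam (x, 0, 0) φ = (Lp.fourierTransformₗᵢ (E n) ℂ).symm
      (schrodinger lam (0, -((lam / (2 * Real.pi)) • x), 0) (𝓕 φ)) := fun x => by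
    rw [← fourierAut_fst, ← fourier_schrodinger hlam]
    exact ((Lp.fourierTransformₗᵢ (E n) ℂ).symm_apply_apply _).symm
  simp only [h]
  refine (Lp.fourierTransformₗᵢ (E n) ℂ).symm.continuous.comp ?_
  exact (continuous_schrodinger_translation (𝓕 φ)).comp
    (f := fun x : E n => -((lam / (2 * Real.pi)) • x)) (by fun_prop)

theorem schrodinger_eq_comp (p : H n) (φ : V n) : schrodinger lam p φ =
    Complex.exp (Complex.I * ((lam * (p.2.2 + 1 / 2 * inner ℝ p.2.1 p.1) : ℝ) : ℂ)) •
      schrodinger lam (p.1, 0, 0) (schrodinger lam (0, p.2.1, 0) φ) := by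
  rw [← schrodinger_central, schrodinger_mul, schrodinger_mul]
  congr 1
  simp [mul]

/-- `π_lam` is strongly continuous. -/
theorem continuous_schrodinger (hlam : lam ≠ 0) (φ : V n) :
    Continuous fun p : H n => schrodinger lam p φ := by
  rw [funext fun p : H n => schrodinger_eq_comp (lam := lam) p φ]
  have hc : Continuous fun p : H n =>
      Complex.exp (Complex.I * ((lam * (p.2.2 + 1 / 2 * inner ℝ p.2.1 p.1) : ℝ) : ℂ)) := by
    fun_prop
  refine hc.smul ?_
  rw [continuous_iff_continuousAt]
  intro p
  rw [ContinuousAt, tendsto_iff_norm_sub_tendsto_zero]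
  -- The intermediate vector is frozen at `p`: since modulations are isometries, the error splits
  -- into a pure translation error of `φ` and a pure modulation error of `ψ`.
  set ψ := schrodinger lam (0, p.2.1, 0) φ with hψ
  have h1 : Filter.Tendsto (fun q : H n => ‖schrodinger lam (0, q.2.1, 0) φ - ψ‖) (nhds p)
      (nhds 0) := by
    rw [← tendsto_iff_norm_sub_tendsto_zero]
    exact ((continuous_schrodinger_translation φ).comp
      (continuous_fst.comp continuous_snd)).continuousAt
  have h2 : Filter.Tendsto (fun q : H n => ‖schrodinger lam (q.1, 0, 0) ψ -
      schrodinger lam (p.1, 0, 0) ψ‖) (nhds p) (nhds 0) := by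
    rw [← tendsto_iff_norm_sub_tendsto_zero]
    exact ((continuous_schrodinger_modulation hlam ψ).comp continuous_fst).continuousAt
  refine squeeze_zero (fun _ => norm_nonneg _) (fun q => ?_) (by simpa using h1.add h2)
  have e : ‖schrodinger lam (q.1, 0, 0) (schrodinger lam (0, q.2.1, 0) φ) -
      schrodinger lam (q.1, 0, 0) ψ‖ = ‖schrodinger lam (0, q.2.1, 0) φ - ψ‖ := by
    rw [← schrodingerₗᵢ_apply, ← schrodingerₗᵢ_apply lam _ ψ, ← map_sub, LinearIsometry.norm_map]
  rw [← e]
  exact norm_sub_le_norm_sub_add_norm_sub _ _ _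

theorem integrable_smul_schrodinger (hlam : lam ≠ 0) {f : H n → ℂ} (hf : Integrable f)
    (φ : V n) : Integrable fun p => f p • schrodinger lam p φ := by
  refine (hf.norm.mul_const ‖φ‖).mono'
    (hf.1.smul (continuous_schrodinger hlam φ).aestronglyMeasurable)
    (Filter.Eventually.of_forall fun p => ?_)
  rw [norm_smul, norm_schrodinger]

/-- The integrated representation as a continuous bilinear map. -/
def schrodingerIntCLM (hlam : lam ≠ 0) : L1 n →L[ℂ] V n →L[ℂ] V n :=
  LinearMap.mkContinuous₂
    (LinearMap.mk₂ ℂ (fun f φ => schrodingerInt lam f φ)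
      (fun f g φ => by
        simp only [schrodingerInt]
        rw [← integral_add (integrable_smul_schrodinger hlam (L1.integrable_coeFn f) φ)
          (integrable_smul_schrodinger hlam (L1.integrable_coeFn g) φ)]
        refine integral_congr_ae ?_
        filter_upwards [Lp.coeFn_add f g] with p hp
        rw [hp, Pi.add_apply, add_smul])
      (fun c f φ => by
        simp only [schrodingerInt]
        rw [← integral_smul]
        refine integral_congr_ae ?_
        filter_upwards [Lp.coeFn_smul c f] with p hp
        rw [hp, Pi.smul_apply, smul_assoc])
      (fun f φ ψ => by
        simp only [schrodingerInt]
        rw [← integral_add (integrable_smul_schrodinger hlam (L1.integrable_coeFn f) φ)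
          (integrable_smul_schrodinger hlam (L1.integrable_coeFn f) ψ)]
        refine integral_congr_ae (Filter.Eventually.of_forall fun p => ?_)
        simp only [← schrodingerₗᵢ_apply, map_add, smul_add])
      (fun c f φ => by
        simp only [schrodingerInt]
        rw [← integral_smul]
        refine integral_congr_ae (Filter.Eventually.of_forall fun p => ?_)
        simp only [← schrodingerₗᵢ_apply, map_smul]
        rw [smul_comm])) 1 (fun f φ => by
      simp only [LinearMap.mk₂_apply, one_mul, schrodingerInt]
      refine (norm_integral_le_integral_norm _).trans ?_
      simp only [norm_smul, norm_schrodinger]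
      rw [integral_mul_const, L1.norm_eq_integral_norm])

@[simp] theorem schrodingerIntCLM_apply (hlam : lam ≠ 0) (f : L1 n) (φ : V n) :
    schrodingerIntCLM hlam f φ = schrodingerInt lam f φ := rfl

theorem schrodingerInt_toL1 {f : H n → ℂ} (hf : Integrable f) (φ : V n) :
    schrodingerInt lam (hf.toL1 f) φ = ∫ p, f p • schrodinger lam p φ := by
  refine integral_congr_ae ?_
  filter_upwards [hf.coeFn_toL1] with p hp
  rw [hp]

end Representation

end HeisenbergGroup

namespace HeisenbergGroup

open scoped ENNReal NNReal

/-! ### Measure preserving maps on `ℍⁿ` -/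

section Measure

variable {n : ℕ}

theorem map_prodMap_smul {c d : ℝ} (hc : c ≠ 0) (hd : d ≠ 0) :
    Measure.map (Prod.map (fun x : E n => c • x) fun x : E n => d • x) volume =
      ENNReal.ofReal |((c * d) ^ n)⁻¹| • (volume : Measure (E n × E n)) := by
  have h := Measure.map_prod_map (f := fun x : E n => c • x) (g := fun x : E n => d • x)
    volume volume (by fun_prop) (by fun_prop)
  rw [Measure.volume_eq_prod, ← h, Measure.map_addHaar_smul _ hc, Measure.map_addHaar_smul _ hd,
    Measure.prod_smul_left, Measure.prod_smul_right, smul_smul, ← ENNReal.ofReal_mul (abs_nonneg _),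
    ← abs_mul, ← mul_inv, mul_pow]
  simp

theorem quasiMeasurePreserving_prodMap_smul {c d : ℝ} (hc : c ≠ 0) (hd : d ≠ 0) :
    Measure.QuasiMeasurePreserving (Prod.map (fun x : E n => c • x) fun x : E n => d • x) := by
  refine ⟨by fun_prop, ?_⟩
  rw [map_prodMap_smul hc hd]
  exact Measure.smul_absolutelyContinuous

theorem measurePreserving_prodMap_smul {c d : ℝ} (h : c * d = -1) :
    MeasurePreserving (Prod.map (fun x : E n => c • x) fun x : E n => d • x) := by
  have hc : c ≠ 0 := by rintro rfl; simp at h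
  have hd : d ≠ 0 := by rintro rfl; simp at h
  refine ⟨by fun_prop, ?_⟩
  rw [map_prodMap_smul hc hd, h]
  simp [abs_inv, abs_pow]

/-- The map `(x, u, t) ↦ (A(x, u), t)` preserves the measure if `A` does. -/
theorem measurePreserving_assoc {A : E n × E n → E n × E n} (hA : MeasurePreserving A) :
    MeasurePreserving fun p : H n => ((A (p.1, p.2.1)).1, (A (p.1, p.2.1)).2, p.2.2) := by
  have h1 : MeasurePreserving (MeasurableEquiv.prodAssoc : (E n × E n) × ℝ ≃ᵐ H n) :=
    volume_preserving_prodAssoc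
  exact (h1.comp (hA.prod (MeasurePreserving.id (volume : Measure ℝ)))).comp
    (h1.symm MeasurableEquiv.prodAssoc)

/-- Exchange of the first two variables. -/
def swapVar : H n ≃ᵐ H n :=
  Homeomorph.toMeasurableEquiv
    { toFun := fun p => (p.2.1, p.1, p.2.2)
      invFun := fun p => (p.2.1, p.1, p.2.2)
      left_inv := fun _ => rfl
      right_inv := fun _ => rfl
      continuous_toFun := by fun_prop
      continuous_invFun := by fun_prop }

theorem measurePreserving_swapVar : MeasurePreserving (swapVar : H n ≃ᵐ H n) :=
  measurePreserving_assoc (A := Prod.swap) Measure.measurePreserving_swap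

/-- In `kern` the variable `u` is a parameter while `x` and `t` are integrated, which dictates this
order of the quantifiers. -/
theorem ae_iterated {P : H n → Prop} (h : ∀ᵐ p, P p) : ∀ᵐ u, ∀ᵐ x, ∀ᵐ t, P (x, u, t) := by
  have h1 : ∀ᵐ p : H n, P (swapVar p) :=
    measurePreserving_swapVar.quasiMeasurePreserving.ae h
  have h2 := Measure.ae_ae_of_ae_prod (show ∀ᵐ p ∂(volume.prod volume), P (swapVar p) from h1)
  filter_upwards [h2] with u hu
  exact Measure.ae_ae_of_ae_prod (show ∀ᵐ p ∂(volume.prod volume), P (swapVar (u, p)) from hu)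

theorem ae_integrable_slice {F : H n → ℂ} (hF : Integrable F) :
    ∀ᵐ u, Integrable fun w : E n × ℝ => F (w.1, u, w.2) := by
  have h1 : Integrable (F ∘ swapVar) :=
    (measurePreserving_swapVar.integrable_comp_emb swapVar.measurableEmbedding).2 hF
  exact Integrable.prod_right_ae (show Integrable (F ∘ swapVar) (volume.prod volume) from h1)

theorem integral_iterated {F : H n → ℂ} (hF : Integrable F) :
    ∫ p, F p = ∫ u, ∫ x, ∫ t, F (x, u, t) := by
  have h1 : Integrable (F ∘ swapVar) :=
    (measurePreserving_swapVar.integrable_comp_emb swapVar.measurableEmbedding).2 hF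
  rw [← measurePreserving_swapVar.integral_comp' F]
  rw [show (∫ p : H n, F (swapVar p)) = ∫ p, (F ∘ swapVar) p ∂(volume.prod volume) from rfl,
    integral_prod _ h1]
  refine integral_congr_ae ?_
  filter_upwards [ae_integrable_slice hF] with u hu
  exact integral_prod (fun w : E n × ℝ => F (w.1, u, w.2)) hu

variable {lam : ℝ}

theorem measurePreserving_fourierAut (hlam : lam ≠ 0) :
    MeasurePreserving (fourierAut lam : H n → H n) := by
  have h1 : 2 * Real.pi / lam * -(lam / (2 * Real.pi)) = -1 := by
    have := Real.pi_ne_zero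
    field_simp
  have h2 : MeasurePreserving (fun z : E n × E n => z.swap) := Measure.measurePreserving_swap
  have h := measurePreserving_assoc ((measurePreserving_prodMap_smul (n := n) h1).comp h2)
  convert h using 2 with p
  simp [fourierAut]

theorem continuous_fourierAut : Continuous (fourierAut lam : H n → H n) := by
  unfold fourierAut; fun_prop

theorem fourierAut_fourierAut (hlam : lam ≠ 0) (p : H n) :
    fourierAut lam (fourierAut lam p) = (-p.1, -p.2.1, p.2.2) := by
  have h1 : 2 * Real.pi / lam * (lam / (2 * Real.pi)) = 1 := by
    have := Real.pi_ne_zero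
    field_simp
  have h2 : lam / (2 * Real.pi) * (2 * Real.pi / lam) = 1 := by rw [mul_comm, h1]
  simp [fourierAut, smul_smul, h1, h2]

/-- Like the Fourier transform, the automorphism squares to a reflection and has fourth power the
identity; its cube therefore serves as its inverse below. -/
theorem fourierAut_four (hlam : lam ≠ 0) (p : H n) :
    fourierAut lam (fourierAut lam (fourierAut lam (fourierAut lam p))) = p := by
  rw [fourierAut_fourierAut hlam, fourierAut_fourierAut hlam]; simp

theorem measurableEmbedding_fourierAut (hlam : lam ≠ 0) :
    MeasurableEmbedding (fourierAut lam : H n → H n) := by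
  refine continuous_fourierAut.measurableEmbedding fun p q h => ?_
  rw [← fourierAut_four hlam p, h, fourierAut_four hlam]

theorem integral_comp_fourierAut {F : Type*} [NormedAddCommGroup F] [NormedSpace ℝ F]
    (hlam : lam ≠ 0) (f : H n → F) : ∫ p, f (fourierAut lam p) = ∫ p, f p :=
  (measurePreserving_fourierAut hlam).integral_comp (measurableEmbedding_fourierAut hlam) f

end Measure

/-! ### The kernel of the integrated representation -/

section Kernel

variable {n : ℕ} (lam : ℝ)

/-- `∫∫ f(x,u,t) e^{i lam (t + m·x)} dt dx`; the operator `π_lam(f)` has the integral kernel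
`(ξ, η) ↦ kern lam f ((ξ + η) / 2) (η - ξ)`. -/
def kern (f : H n → ℂ) (m u : E n) : ℂ :=
  ∫ x, centralFourier lam f x u * Complex.exp (Complex.I * ((lam * inner ℝ m x : ℝ) : ℂ))

/-- The kernel of `f` decays exponentially. -/
def KernDecay (f : H n → ℂ) : Prop :=
  ∃ t : ℝ, 0 < t ∧ ∃ C : ℝ, ∀ᵐ z : E n × E n,
    ‖kern lam f z.1 z.2‖ ≤ C * Real.exp (-t * (‖z.1‖ + ‖z.2‖))

variable {lam}

theorem kern_congr {f g : H n → ℂ} (h : f =ᵐ[volume] g) :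
    ∀ᵐ u, ∀ m, kern lam f m u = kern lam g m u := by
  filter_upwards [ae_iterated h] with u hu m
  refine integral_congr_ae ?_
  filter_upwards [hu] with x hx
  congr 1
  refine integral_congr_ae ?_
  filter_upwards [hx] with t ht
  rw [ht]

theorem KernDecay.congr {f g : H n → ℂ} (hf : KernDecay lam f) (h : f =ᵐ[volume] g) :
    KernDecay lam g := by
  obtain ⟨t, ht, C, hC⟩ := hf
  refine ⟨t, ht, C, ?_⟩
  have h1 : ∀ᵐ z : E n × E n, ∀ m, kern lam f m z.2 = kern lam g m z.2 :=
    Measure.quasiMeasurePreserving_snd.ae (kern_congr h)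
  filter_upwards [hC, h1] with z hz h2
  rwa [← h2]

/-- Exponential bounds survive a change of variables that respects null sets and a passage to a
comparable weight; only the rate and the constant change. This is why the exact weights in the
definition of `𝓑^lam` do not matter. -/
theorem ae_decay_transfer {F G : E n → E n → ℂ} {w w' : E n × E n → ℝ} {k c : ℝ} (hk : 0 < k)
    (hc : 0 ≤ c) {T : E n × E n → E n × E n} (hT : Measure.QuasiMeasurePreserving T)
    (hG : ∀ z, ‖G z.1 z.2‖ ≤ c * ‖F (T z).1 (T z).2‖) (hw : ∀ z, k * w' z ≤ w (T z))
    (h : ∃ t : ℝ, 0 < t ∧ ∃ C : ℝ, ∀ᵐ z : E n × E n, ‖F z.1 z.2‖ ≤ C * Real.exp (-t * w z)) :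
    ∃ t : ℝ, 0 < t ∧ ∃ C : ℝ, ∀ᵐ z : E n × E n, ‖G z.1 z.2‖ ≤ C * Real.exp (-t * w' z) := by
  obtain ⟨t, ht, C, hC⟩ := h
  refine ⟨t * k, by positivity, c * |C|, ?_⟩
  filter_upwards [hT.ae hC] with z hz
  calc _ ≤ c * ‖F (T z).1 (T z).2‖ := hG z
    _ ≤ c * (|C| * Real.exp (-(t * k) * w' z)) := by
      refine mul_le_mul_of_nonneg_left (hz.trans ?_) hc
      refine mul_le_mul (le_abs_self C) (Real.exp_le_exp.2 ?_) (Real.exp_pos _).le (abs_nonneg C)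
      have := mul_le_mul_of_nonneg_left (hw z) ht.le
      linarith
    _ = _ := by ring

theorem le_sqrt_weight {a b k : ℝ} (ha : 2 * k ^ 2 ≤ a) (hb : 2 * k ^ 2 ≤ b)
    (x y : ℝ) : k * (|x| + |y|) ≤ √(a * x ^ 2 + b * y ^ 2) := by
  refine Real.le_sqrt_of_sq_le ?_
  rw [← sq_abs x, ← sq_abs y]
  nlinarith [sq_nonneg (|x| - |y|), mul_le_mul_of_nonneg_right ha (sq_nonneg |x|),
    mul_le_mul_of_nonneg_right hb (sq_nonneg |y|), mul_nonneg (sq_nonneg k) (sq_nonneg (|x| - |y|))]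

theorem sqrt_weight_le {a b k : ℝ} (hk : 0 ≤ k) (ha : a ≤ k ^ 2) (hb : b ≤ k ^ 2)
    (x y : ℝ) : √(a * x ^ 2 + b * y ^ 2) ≤ k * (|x| + |y|) := by
  refine Real.sqrt_le_iff.2 ⟨by positivity, ?_⟩
  rw [← sq_abs x, ← sq_abs y]
  nlinarith [mul_le_mul_of_nonneg_right ha (sq_nonneg |x|),
    mul_le_mul_of_nonneg_right hb (sq_nonneg |y|),
    mul_nonneg (sq_nonneg k) (mul_nonneg (abs_nonneg x) (abs_nonneg y))]

theorem exists_weight_bounds {a b c d : ℝ} (ha : 0 < a) (hb : 0 < b) (hc : c ≠ 0) (hd : d ≠ 0) :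
    ∃ k : ℝ, 0 < k ∧ (∀ x y : E n, k * (‖x‖ + ‖y‖) ≤ √(a * ‖c • x‖ ^ 2 + b * ‖d • y‖ ^ 2)) ∧
      ∀ x y : E n, k * √(a * ‖x‖ ^ 2 + b * ‖y‖ ^ 2) ≤ ‖c⁻¹ • x‖ + ‖d⁻¹ • y‖ := by
  set m := min (min (a * c ^ 2) (b * d ^ 2)) 1 with hm
  have hm0 : 0 < m := lt_min (lt_min (by positivity) (by positivity)) one_pos
  set M := max (a * c ^ 2) (b * d ^ 2) + 1 with hM
  have hM0 : 0 < M := by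
    have : 0 < a * c ^ 2 := by positivity
    have := le_max_left (a * c ^ 2) (b * d ^ 2)
    linarith
  have hM1 : 1 ≤ M := by
    have : 0 < a * c ^ 2 := by positivity
    have := le_max_left (a * c ^ 2) (b * d ^ 2)
    linarith
  have hmM : m ≤ M := by
    have := min_le_right (min (a * c ^ 2) (b * d ^ 2)) 1
    linarith
  have key : ∀ x y : E n, a * ‖c • x‖ ^ 2 + b * ‖d • y‖ ^ 2 =
      (a * c ^ 2) * ‖x‖ ^ 2 + (b * d ^ 2) * ‖y‖ ^ 2 := fun x y => by
    rw [norm_smul, norm_smul, mul_pow, mul_pow, Real.norm_eq_abs, Real.norm_eq_abs, sq_abs, sq_abs]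
    ring
  have hkm : min (m / 2) M⁻¹ ≤ m / 2 := min_le_left _ _
  have hkM : min (m / 2) M⁻¹ ≤ M⁻¹ := min_le_right _ _
  have hm1 : m ≤ 1 := min_le_right _ _
  -- The cap `m ≤ 1` gives `2(m/2)² ≤ m`, as needed for the lower bound, and `M ≥ 1` gives `M ≤ M²`,
  -- as needed for the upper one.
  refine ⟨min (m / 2) M⁻¹, lt_min (by positivity) (by positivity), fun x y => ?_, fun x y => ?_⟩
  · rw [key]
    have h2 : 2 * (m / 2) ^ 2 ≤ m := by nlinarith
    have := le_sqrt_weight (a := a * c ^ 2) (b := b * d ^ 2) (k := m / 2)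
      (h2.trans ((min_le_left _ _).trans (min_le_left _ _)))
      (h2.trans ((min_le_left _ _).trans (min_le_right _ _))) ‖x‖ ‖y‖
    rw [abs_norm, abs_norm] at this
    exact (mul_le_mul_of_nonneg_right hkm (by positivity)).trans this
  · have hMM : M ≤ M ^ 2 := by nlinarith
    have := sqrt_weight_le (a := a * c ^ 2) (b := b * d ^ 2) (k := M) hM0.le
      (by linarith [le_max_left (a * c ^ 2) (b * d ^ 2)])
      (by linarith [le_max_right (a * c ^ 2) (b * d ^ 2)]) ‖c⁻¹ • x‖ ‖d⁻¹ • y‖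
    rw [← key, smul_inv_smul₀ hc, smul_inv_smul₀ hd, abs_norm, abs_norm] at this
    calc _ ≤ M⁻¹ * √(a * ‖x‖ ^ 2 + b * ‖y‖ ^ 2) :=
          mul_le_mul_of_nonneg_right hkM (Real.sqrt_nonneg _)
      _ ≤ M⁻¹ * (M * (‖c⁻¹ • x‖ + ‖d⁻¹ • y‖)) := mul_le_mul_of_nonneg_left this (by positivity)
      _ = _ := by field_simp

theorem kern_eq_fourier1 (f : H n → ℂ) (m u : E n) :
    kern lam f m u = (((2 * Real.pi) ^ ((n : ℝ) / 2) : ℝ) : ℂ) *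
      fourier1 (centralFourier lam f) ((-lam) • m) u := by
  have h2 : (2 * Real.pi) ^ ((n : ℝ) / 2) * (2 * Real.pi) ^ (-(n : ℝ) / 2) = 1 := by
    rw [← Real.rpow_add (by positivity), neg_div, add_neg_cancel, Real.rpow_zero]
  rw [fourier1, ← mul_assoc, ← Complex.ofReal_mul, h2, Complex.ofReal_one, one_mul, kern]
  refine integral_congr_ae (Filter.Eventually.of_forall fun x => ?_)
  simp only [real_inner_smul_left]
  congr 2
  push_cast
  ring

/-- The automorphism exchanges `x` and `u`, so integrating `f ∘ fourierAut lam` in its first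
variable is integrating `f` in its second. The absolute value is the Jacobian of `x ↦ -(lam/2π) x`.
-/
theorem kern_comp_fourierAut (hlam : lam ≠ 0) (f : H n → ℂ) (m u : E n) :
    kern lam (f ∘ fourierAut lam) m u =
      ((|((-(lam / (2 * Real.pi))) ^ n)⁻¹| * (2 * Real.pi) ^ ((n : ℝ) / 2) : ℝ) : ℂ) *
      fourier2 (centralFourier lam f) ((2 * Real.pi / lam) • u) ((2 * Real.pi) • m) := by
  have h2 : (2 * Real.pi) ^ ((n : ℝ) / 2) * (2 * Real.pi) ^ (-(n : ℝ) / 2) = 1 := by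
    rw [← Real.rpow_add (by positivity), neg_div, add_neg_cancel, Real.rpow_zero]
  rw [fourier2, ← mul_assoc, ← Complex.ofReal_mul, mul_assoc, h2, mul_one, kern]
  have h3 := Measure.integral_comp_smul (volume : Measure (E n)) (fun v : E n =>
    centralFourier lam f ((2 * Real.pi / lam) • u) v *
      Complex.exp (-Complex.I * ((inner ℝ ((2 * Real.pi) • m) v : ℝ) : ℂ)))
      (-(lam / (2 * Real.pi)))
  rw [finrank_euclideanSpace_fin, Complex.real_smul] at h3
  rw [← h3]
  refine integral_congr_ae (Filter.Eventually.of_forall fun x => ?_)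
  simp only [centralFourier, Function.comp, fourierAut, neg_smul, real_inner_smul_left,
    inner_neg_right, real_inner_smul_right]
  congr 2
  have : (Real.pi : ℂ) ≠ 0 := by exact_mod_cast Real.pi_ne_zero
  have : (lam : ℂ) ≠ 0 := by exact_mod_cast hlam
  push_cast
  field_simp

theorem kernDecay_iff_fourier1 (hlam : lam ≠ 0) (f : H n → ℂ) : KernDecay lam f ↔
    ∃ t : ℝ, 0 < t ∧ ∃ C : ℝ, ∀ᵐ z : E n × E n, ‖fourier1 (centralFourier lam f) z.1 z.2‖ ≤
      C * Real.exp (-t * √((1 / |lam|) * ‖z.1‖ ^ 2 + (|lam| / 4) * ‖z.2‖ ^ 2)) := by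
  have hl : 0 < |lam| := abs_pos.2 hlam
  obtain ⟨k, hk, h1, h2⟩ := exists_weight_bounds (n := n) (a := 1 / |lam|) (b := |lam| / 4)
    (by positivity) (by positivity) (neg_ne_zero.2 hlam) one_ne_zero
  constructor
  · refine ae_decay_transfer (w := fun z => ‖z.1‖ + ‖z.2‖) (F := kern lam f)
      (G := fourier1 (centralFourier lam f)) hk (c := (2 * Real.pi) ^ (-(n : ℝ) / 2))
      (by positivity) (quasiMeasurePreserving_prodMap_smul (inv_ne_zero (neg_ne_zero.2 hlam))
        (inv_ne_zero one_ne_zero)) (fun z => ?_) fun z => h2 z.1 z.2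
    have h2 : (2 * Real.pi) ^ (-(n : ℝ) / 2) * (2 * Real.pi) ^ ((n : ℝ) / 2) = 1 := by
      rw [← Real.rpow_add (by positivity), neg_div, neg_add_cancel, Real.rpow_zero]
    simp only [Prod.map_fst, Prod.map_snd, kern_eq_fourier1, smul_inv_smul₀ (neg_ne_zero.2 hlam)]
    rw [norm_mul, Complex.norm_real, Real.norm_of_nonneg (by positivity), ← mul_assoc, h2, one_mul]
    simp
  · refine ae_decay_transfer (w' := fun z => ‖z.1‖ + ‖z.2‖) (G := kern lam f)
      (F := fourier1 (centralFourier lam f)) hk (c := (2 * Real.pi) ^ ((n : ℝ) / 2))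
      (by positivity) (quasiMeasurePreserving_prodMap_smul (neg_ne_zero.2 hlam)
        one_ne_zero) (fun z => ?_) fun z => h1 z.1 z.2
    simp only [Prod.map_fst, Prod.map_snd, kern_eq_fourier1]
    rw [norm_mul, Complex.norm_real, Real.norm_of_nonneg (by positivity)]
    simp

theorem kernDecay_comp_iff_fourier2 (hlam : lam ≠ 0) (f : H n → ℂ) :
    KernDecay lam (f ∘ fourierAut lam) ↔
    ∃ t : ℝ, 0 < t ∧ ∃ C : ℝ, ∀ᵐ z : E n × E n, ‖fourier2 (centralFourier lam f) z.1 z.2‖ ≤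
      C * Real.exp (-t * √((|lam| / 4) * ‖z.1‖ ^ 2 + (1 / |lam|) * ‖z.2‖ ^ 2)) := by
  have hl : 0 < |lam| := abs_pos.2 hlam
  have hpi := Real.pi_pos
  have hc : 2 * Real.pi / lam ≠ 0 := by positivity
  have hd : 2 * Real.pi ≠ 0 := by positivity
  obtain ⟨k, hk, h1, h2⟩ := exists_weight_bounds (n := n) (a := |lam| / 4) (b := 1 / |lam|)
    (by positivity) (by positivity) hc hd
  set K : ℝ := |((-(lam / (2 * Real.pi))) ^ n)⁻¹| * (2 * Real.pi) ^ ((n : ℝ) / 2) with hK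
  have hK0 : 0 < K := by
    have : -(lam / (2 * Real.pi)) ≠ 0 := by
      rw [neg_ne_zero]; positivity
    positivity
  have hswap : Measure.QuasiMeasurePreserving (Prod.swap : E n × E n → E n × E n) :=
    Measure.measurePreserving_swap.quasiMeasurePreserving
  constructor
  · refine ae_decay_transfer (w := fun z => ‖z.1‖ + ‖z.2‖) (F := kern lam (f ∘ fourierAut lam))
      (G := fourier2 (centralFourier lam f)) hk (c := K⁻¹) (by positivity)
      (hswap.comp (quasiMeasurePreserving_prodMap_smul (inv_ne_zero hc) (inv_ne_zero hd)))
      (fun z => ?_) fun z => (h2 z.1 z.2).trans_eq (add_comm _ _)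
    simp only [Function.comp_apply, Prod.fst_swap, Prod.snd_swap, Prod.map_fst, Prod.map_snd]
    have := kern_comp_fourierAut hlam f ((2 * Real.pi)⁻¹ • z.2) ((2 * Real.pi / lam)⁻¹ • z.1)
    rw [smul_inv_smul₀ hc, smul_inv_smul₀ hd, ← hK] at this
    rw [Function.comp_def] at this
    simp only [Function.comp_def, this]
    rw [norm_mul, Complex.norm_real, Real.norm_of_nonneg hK0.le, inv_mul_cancel_left₀ hK0.ne']
  · refine ae_decay_transfer (w' := fun z => ‖z.1‖ + ‖z.2‖) (G := kern lam (f ∘ fourierAut lam))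
      (F := fourier2 (centralFourier lam f)) hk (c := K) (by positivity)
      ((quasiMeasurePreserving_prodMap_smul hc hd).comp hswap)
      (fun z => ?_) fun z => (le_of_eq (by rw [add_comm])).trans (h1 z.2 z.1)
    rw [kern_comp_fourierAut hlam, ← hK, norm_mul, Complex.norm_real, Real.norm_of_nonneg hK0.le]
    simp

/-- Membership in `𝓑^lam` in terms of the kernels of `f` and of its twist. -/
theorem mem_B_iff (hlam : lam ≠ 0) (f : L1 n) :
    f ∈ B n lam ↔ KernDecay lam f ∧ KernDecay lam (f ∘ fourierAut lam) := by
  rw [kernDecay_iff_fourier1 hlam, kernDecay_comp_iff_fourier2 hlam]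
  constructor
  · rintro ⟨t, ht, C, h1, h2⟩
    exact ⟨⟨t, ht, C, h1⟩, ⟨t, ht, C, h2⟩⟩
  · rintro ⟨⟨t, ht, C, h1⟩, ⟨s, hs, D, h2⟩⟩
    -- The definition of `𝓑^lam` asks for a single pair `(t, C)`, so the two bounds are weakened to
    -- the smaller rate and the larger constant.
    have mono : ∀ {a b A M w : ℝ}, b ≤ a → A ≤ M → 0 ≤ M → 0 ≤ w →
        A * Real.exp (-a * w) ≤ M * Real.exp (-b * w) := fun hab hAM hM hw =>
      mul_le_mul hAM (Real.exp_le_exp.2 (by nlinarith)) (Real.exp_pos _).le hM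
    have hM : 0 ≤ max |C| |D| := (abs_nonneg C).trans (le_max_left _ _)
    refine ⟨min t s, lt_min ht hs, max |C| |D|, ?_, ?_⟩
    · filter_upwards [h1] with z hz
      exact hz.trans (mono (min_le_left _ _) ((le_abs_self C).trans (le_max_left _ _)) hM
        (Real.sqrt_nonneg _))
    · filter_upwards [h2] with z hz
      exact hz.trans (mono (min_le_right _ _) ((le_abs_self D).trans (le_max_right _ _)) hM
        (Real.sqrt_nonneg _))

end Kernel

end HeisenbergGroup

namespace HeisenbergGroup

open FourierTransform
open scoped ENNReal NNReal

/-! ### The integrated representation as an integral operator -/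

section IntegralOperator

variable {n : ℕ} {lam : ℝ}

theorem quasiMeasurePreserving_add_translation :
    Measure.QuasiMeasurePreserving (fun z : H n × E n => z.2 + z.1.2.1)
      (volume.prod volume) volume := by
  have h : MeasurePreserving (fun z : H n × E n => (z.1, z.2 + z.1.2.1))
      (volume.prod volume) (volume.prod volume) :=
    MeasurePreserving.skew_product (f := fun p : H n => p) (g := fun p ξ => ξ + p.2.1)
      (MeasurePreserving.id volume) (Continuous.measurable (by fun_prop))
      (Filter.Eventually.of_forall fun p => (measurePreserving_add_right volume p.2.1).map_eq)
  exact Measure.quasiMeasurePreserving_snd.comp h.quasiMeasurePreserving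

/-- The hypothesis of Fubini for the weak form of `π_lam(f)`: by Cauchy–Schwarz and unitarity the
`ξ`-integral of the modulus at `p` is at most `|f(p)| ‖g‖ ‖φ‖`. -/
theorem integrable_mul_schrodingerFun {f : H n → ℂ} (hf : Integrable f) (g φ : V n) :
    Integrable (fun z : H n × E n =>
      f z.1 * (starRingEnd ℂ (g z.2) * schrodingerFun lam z.1 φ z.2)) (volume.prod volume) := by
  have hm : AEStronglyMeasurable (fun z : H n × E n =>
      f z.1 * (starRingEnd ℂ (g z.2) * schrodingerFun lam z.1 φ z.2)) (volume.prod volume) := by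
    refine hf.1.comp_fst.mul (AEStronglyMeasurable.mul ?_ (AEStronglyMeasurable.mul ?_ ?_))
    · exact Complex.continuous_conj.comp_aestronglyMeasurable (Lp.memLp g).1.comp_snd
    · have hc : Continuous fun z : H n × E n =>
          Complex.exp (Complex.I * ((lam * z.1.2.2 : ℝ) : ℂ)) * Complex.exp (Complex.I *
          ((lam * (inner ℝ z.1.1 z.2 + (1 / 2) * inner ℝ z.1.1 z.1.2.1) : ℝ) : ℂ)) := by
        fun_prop
      exact hc.aestronglyMeasurable
    · exact (Lp.memLp φ).1.comp_quasiMeasurePreserving quasiMeasurePreserving_add_translation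
  rw [integrable_prod_iff hm]
  have hpair : ∀ p : H n, Integrable fun ξ =>
      starRingEnd ℂ (g ξ) * schrodingerFun lam p φ ξ := fun p => by
    have h1 := (Lp.memLp g).star
    exact h1.integrable_mul (memLp_schrodingerFun lam p φ)
  refine ⟨Filter.Eventually.of_forall fun p => (hpair p).const_mul (f p), ?_⟩
  refine (hf.norm.mul_const (‖g‖ * ‖φ‖)).mono' hm.norm.integral_prod_right'
    (Filter.Eventually.of_forall fun p => ?_)
  rw [Real.norm_of_nonneg (integral_nonneg fun _ => norm_nonneg _)]
  simp only [norm_mul (f p)]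
  rw [integral_const_mul]
  refine mul_le_mul_of_nonneg_left ?_ (norm_nonneg _)
  have h2 : ∫ ξ, ‖starRingEnd ℂ (g ξ) * schrodingerFun lam p φ ξ‖ =
      ∫ ξ, ‖g ξ‖ * ‖schrodinger lam p φ ξ‖ := by
    refine integral_congr_ae ?_
    filter_upwards [schrodinger_coeFn lam p φ] with ξ hξ
    rw [hξ, norm_mul, RCLike.norm_conj]
  rw [h2]
  have hg : MemLp (fun ξ => ‖g ξ‖) 2 volume := (Lp.memLp g).norm
  have hs : MemLp (fun ξ => ‖schrodinger lam p φ ξ‖) 2 volume := (Lp.memLp _).norm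
  have h3 := real_inner_le_norm hg.toLp hs.toLp
  rw [L2.inner_def, Lp.norm_toLp, Lp.norm_toLp, eLpNorm_norm, eLpNorm_norm, ← Lp.norm_def,
    ← Lp.norm_def, norm_schrodinger] at h3
  refine le_trans (le_of_eq (integral_congr_ae ?_)) h3
  filter_upwards [hg.coeFn_toLp, hs.coeFn_toLp] with ξ e1 e2
  rw [e1, e2, real_inner_comm, RCLike.inner_apply, conj_trivial]

/-- The kernel formula for `π_lam(f)`, in weak form so that no pointwise value of an `L²`-valued
integral is needed. Integrating out `t` and `x` first, the phase is `lam (t + (ξ + u/2)·x)`, which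
is why the kernel is read at the midpoint of `ξ` and `ξ + u`. -/
theorem inner_integral_smul_schrodinger (hlam : lam ≠ 0) {f : H n → ℂ} (hf : Integrable f)
    (g φ : V n) : inner ℂ g (∫ p, f p • schrodinger lam p φ) =
      ∫ ξ, ∫ u, starRingEnd ℂ (g ξ) * (kern lam f (ξ + (1 / 2 : ℝ) • u) u * φ (ξ + u)) := by
  rw [← integral_inner (integrable_smul_schrodinger hlam hf φ)]
  have e1 : ∀ p : H n, inner ℂ g (f p • schrodinger lam p φ) =
      ∫ ξ, f p * (starRingEnd ℂ (g ξ) * schrodingerFun lam p φ ξ) := fun p => by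
    rw [inner_smul_right, L2.inner_def, integral_const_mul]
    congr 1
    refine integral_congr_ae ?_
    filter_upwards [schrodinger_coeFn lam p φ] with ξ hξ
    rw [hξ, RCLike.inner_apply']
  simp only [e1]
  have hi := integrable_mul_schrodingerFun (lam := lam) hf g φ
  rw [integral_integral_swap hi]
  refine integral_congr_ae ?_
  filter_upwards [hi.prod_left_ae] with ξ hξ
  rw [integral_iterated hξ]
  refine integral_congr_ae (Filter.Eventually.of_forall fun u => ?_)
  simp only [kern, centralFourier]
  rw [← integral_mul_const, ← integral_const_mul]
  refine integral_congr_ae (Filter.Eventually.of_forall fun x => ?_)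
  simp only
  rw [← integral_mul_const, ← integral_mul_const, ← integral_const_mul]
  refine integral_congr_ae (Filter.Eventually.of_forall fun t => ?_)
  simp only [schrodingerFun]
  have : inner ℝ (ξ + (1 / 2 : ℝ) • u) x = inner ℝ x ξ + 1 / 2 * inner ℝ x u := by
    rw [inner_add_left, real_inner_smul_left, real_inner_comm, real_inner_comm u]
  rw [this]
  ring

theorem norm_add_norm_le (ξ u : E n) :
    ‖ξ‖ + ‖ξ + u‖ ≤ 2 * (‖ξ + (1 / 2 : ℝ) • u‖ + ‖u‖) := by
  have h1 : ‖ξ‖ ≤ ‖ξ + (1 / 2 : ℝ) • u‖ + ‖(1 / 2 : ℝ) • u‖ := by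
    simpa using norm_sub_le (ξ + (1 / 2 : ℝ) • u) ((1 / 2 : ℝ) • u)
  have h2 : ‖ξ + u‖ ≤ ‖ξ + (1 / 2 : ℝ) • u‖ + ‖(1 / 2 : ℝ) • u‖ := by
    have : ξ + u = (ξ + (1 / 2 : ℝ) • u) + (1 / 2 : ℝ) • u := by module
    rw [this]
    exact norm_add_le _ _
  have h3 : ‖(1 / 2 : ℝ) • u‖ = 1 / 2 * ‖u‖ := by
    rw [norm_smul, Real.norm_of_nonneg (by norm_num)]
  linarith [norm_nonneg u]

theorem measurePreserving_shear (c : ℝ) :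
    MeasurePreserving fun z : E n × E n => (z.1 + c • z.2, z.2) := by
  have h : MeasurePreserving (fun z : E n × E n => (z.1, z.2 + c • z.1))
      (volume.prod volume) (volume.prod volume) :=
    MeasurePreserving.skew_product (f := fun p : E n => p) (g := fun p ξ => ξ + c • p)
      (MeasurePreserving.id volume) (Continuous.measurable (by fun_prop))
      (Filter.Eventually.of_forall fun p => (measurePreserving_add_right volume (c • p)).map_eq)
  exact (Measure.measurePreserving_swap.comp h).comp Measure.measurePreserving_swap

/-- The kernel bound in the variables `(ξ, η)` with `η = ξ + u`. -/
theorem KernDecay.ae_bound {f : H n → ℂ} (hf : KernDecay lam f) :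
    ∃ t : ℝ, 0 < t ∧ ∃ C : ℝ, 0 ≤ C ∧ ∀ᵐ z : E n × E n,
      ‖kern lam f (z.1 + (1 / 2 : ℝ) • z.2) z.2‖ ≤
        C * (Real.exp (-t * ‖z.1‖) * Real.exp (-t * ‖z.1 + z.2‖)) := by
  obtain ⟨t, ht, C, hC⟩ := hf
  refine ⟨t / 2, by positivity, |C|, abs_nonneg C, ?_⟩
  filter_upwards [(measurePreserving_shear (1 / 2)).quasiMeasurePreserving.ae hC] with z hz
  refine hz.trans ?_
  rw [← Real.exp_add]
  refine mul_le_mul (le_abs_self C) (Real.exp_le_exp.2 ?_) (Real.exp_pos _).le (abs_nonneg C)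
  have := mul_le_mul_of_nonneg_left (norm_add_norm_le z.1 z.2) ht.le
  linarith

/-- Operators whose kernel decays exponentially map `L²` to exponentially decaying functions. -/
theorem KernDecay.expWeighted (hlam : lam ≠ 0) {f : L1 n} (hf : KernDecay lam f) (φ : V n) :
    ExpWeighted (schrodingerInt lam f φ : V n) := by
  obtain ⟨t, ht, C, hC0, hC⟩ := hf.ae_bound
  set M := ∫ η, Real.exp (-t * ‖η‖) * ‖φ η‖ with hM
  have hint : Integrable fun η : E n => Real.exp (-t * ‖η‖) * ‖φ η‖ :=
    (memLp_exp_neg_mul_norm ht).integrable_mul (Lp.memLp φ).norm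
  have hM0 : 0 ≤ M := integral_nonneg fun _ => by positivity
  have hw : MemLp (fun ξ : E n => C * M * Real.exp (-t * ‖ξ‖)) 2 volume :=
    (memLp_exp_neg_mul_norm ht).const_mul (C * M)
  -- The kernel bound is a product of a function of `ξ` and a function of `η = ξ + u`, so by duality
  -- the image is dominated by `C M e^{-t|ξ|}`.
  have hb := norm_le_of_inner_le (schrodingerInt lam f φ) hw (fun ξ => by positivity) fun g => by
    rw [schrodingerInt, inner_integral_smul_schrodinger hlam (L1.integrable_coeFn f)]
    refine norm_integral_le_of_norm_le ((Lp.memLp g).norm.integrable_mul hw) ?_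
    filter_upwards [Measure.ae_ae_of_ae_prod hC] with ξ hξ
    have h1 := hint.comp_add_left ξ
    have h2 : ∫ u, Real.exp (-t * ‖ξ + u‖) * ‖φ (ξ + u)‖ = M :=
      integral_add_left_eq_self (fun η => Real.exp (-t * ‖η‖) * ‖φ η‖) ξ
    refine (norm_integral_le_of_norm_le (h1.const_mul (‖g ξ‖ * C * Real.exp (-t * ‖ξ‖))) ?_).trans
      (le_of_eq ?_)
    · filter_upwards [hξ] with u hu
      rw [norm_mul, norm_mul, RCLike.norm_conj]
      calc _ ≤ ‖g ξ‖ * ((C * (Real.exp (-t * ‖ξ‖) * Real.exp (-t * ‖ξ + u‖))) * ‖φ (ξ + u)‖) := by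
            gcongr
        _ = _ := by ring
    · rw [integral_const_mul, h2]
      ring
  refine ⟨t / 2, by positivity, ?_⟩
  refine (memLp_exp_neg_mul_norm (half_pos ht)).of_le_mul (c := C * M) ?_ ?_
  · exact AEStronglyMeasurable.mul (Continuous.aestronglyMeasurable (by fun_prop))
      (Lp.memLp _).1.norm
  · filter_upwards [hb] with ξ hξ
    rw [Real.norm_of_nonneg (by positivity), Real.norm_of_nonneg (by positivity)]
    calc _ ≤ Real.exp (t / 2 * ‖ξ‖) * (C * M * Real.exp (-t * ‖ξ‖)) := by gcongr
      _ = C * M * (Real.exp (t / 2 * ‖ξ‖) * Real.exp (-t * ‖ξ‖)) := by ring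
      _ = _ := by rw [← Real.exp_add]; congr 2; ring

/-- The Fourier transform passes under the integral, intertwines the representation with its twist,
and the twist preserves Haar measure. -/
theorem fourier_integral_smul_schrodinger (hlam : lam ≠ 0) {f : H n → ℂ} (hf : Integrable f)
    (φ : V n) : (𝓕 (∫ p, f (fourierAut lam p) • schrodinger lam p φ : V n) : V n) =
      ∫ p, f p • schrodinger lam p (𝓕 φ) := by
  have hi : Integrable (fun p => f (fourierAut lam p)) :=
    (measurePreserving_fourierAut hlam).integrable_comp_of_integrable hf
  have h := ((Lp.fourierTransformₗᵢ (E n) ℂ).toContinuousLinearEquiv :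
    V n →L[ℂ] V n).integral_comp_comm (integrable_smul_schrodinger hlam hi φ)
  refine h.symm.trans ?_
  rw [← integral_comp_fourierAut hlam fun p => f p • schrodinger lam p (𝓕 φ)]
  refine integral_congr_ae (Filter.Eventually.of_forall fun p => ?_)
  simp only [← fourier_schrodinger hlam]
  exact (Lp.fourierTransformₗᵢ (E n) ℂ).map_smul _ _

end IntegralOperator

end HeisenbergGroup

namespace HeisenbergGroup

open FourierTransform
open scoped ENNReal NNReal Topology

/-! ### Functions that decay exponentially together with their Fourier transform -/

section DecayPair

variable {n : ℕ} {lam : ℝ}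

/-- `ψ` is continuous and decays exponentially, as does its Fourier transform. -/
structure DecayPair (ψ : E n → ℂ) : Prop where
  continuous : Continuous ψ
  decay : ExpDecay ψ
  decay_fourier : ExpDecay (𝓕 ψ)

theorem DecayPair.integrable {ψ : E n → ℂ} (h : DecayPair ψ) : Integrable ψ :=
  h.decay.integrable h.continuous.aestronglyMeasurable

theorem DecayPair.memLp {ψ : E n → ℂ} (h : DecayPair ψ) : MemLp ψ 2 volume :=
  h.decay.memLp h.continuous.aestronglyMeasurable

theorem ExpDecay.comp_neg {φ : E n → ℂ} (h : ExpDecay φ) : ExpDecay fun ξ => φ (-ξ) := by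
  obtain ⟨t, ht, C, hC⟩ := h
  exact ⟨t, ht, C, fun ξ => by simpa using hC (-ξ)⟩

theorem DecayPair.integrable_fourier {ψ : E n → ℂ} (h : DecayPair ψ) : Integrable (𝓕 ψ) :=
  h.decay_fourier.integrable (continuous_fourier h.integrable).aestronglyMeasurable

theorem DecayPair.fourierInv {ψ : E n → ℂ} (h : DecayPair ψ) : DecayPair (𝓕⁻ ψ) where
  continuous := by
    rw [Real.fourierInv_eq_fourier_comp_neg]
    exact continuous_fourier h.integrable.comp_neg
  decay := by
    rw [funext fun w => Real.fourierInv_eq_fourier_neg ψ w]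
    exact h.decay_fourier.comp_neg
  decay_fourier := by
    rw [h.continuous.fourier_fourierInv_eq h.integrable h.integrable_fourier]
    exact h.decay

theorem DecayPair.fourier {ψ : E n → ℂ} (h : DecayPair ψ) : DecayPair (𝓕 ψ) where
  continuous := continuous_fourier h.integrable
  decay := h.decay_fourier
  decay_fourier := by
    have := h.continuous.fourierInv_fourier_eq h.integrable h.integrable_fourier
    have h2 : 𝓕 (𝓕 ψ) = fun w => ψ (-w) := by
      funext w
      rw [← congrFun this (-w), Real.fourierInv_eq_fourier_neg, neg_neg]
    rw [h2]
    exact h.decay.comp_neg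

/-- The exponential weight on `𝓕 ψ` makes `ψ` Lipschitz, and the weight on `ψ` makes `𝓕 ψ`
Lipschitz; each then decays pointwise by `ExpWeighted.expDecay`. The good representative is the
inverse Fourier integral of `𝓕 ψ`. -/
theorem exists_decayPair (ψ : V n) (h1 : ExpWeighted ψ) (h2 : ExpWeighted (𝓕 ψ : V n)) :
    ∃ ψ₀ : E n → ℂ, DecayPair ψ₀ ∧ ψ =ᵐ[volume] ψ₀ := by
  set η : V n := 𝓕 ψ with hη
  obtain ⟨hψi, hψi1⟩ := h1.integrable_mul (Lp.memLp ψ).1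
  obtain ⟨hηi, hηi1⟩ := h2.integrable_mul (Lp.memLp η).1
  have hψη : ψ = 𝓕⁻ η := ((Lp.fourierTransformₗᵢ (E n) ℂ).symm_apply_apply ψ).symm
  set ψ₀ : E n → ℂ := 𝓕⁻ (η : E n → ℂ) with hψ₀
  have e1 : ψ =ᵐ[volume] ψ₀ := by
    have := fourierInv_ae_eq η hηi
    rwa [← hψη] at this
  have e2 : 𝓕 ψ₀ = 𝓕 (ψ : E n → ℂ) := funext fun w => Real.fourier_congr_ae e1.symm w
  have e3 : η =ᵐ[volume] 𝓕 ψ₀ := by rw [e2]; exact fourier_ae_eq ψ hψi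
  have e4 : ψ₀ = fun w => 𝓕 (η : E n → ℂ) (-w) :=
    funext fun w => Real.fourierInv_eq_fourier_neg _ w
  refine ⟨ψ₀, ⟨?_, ?_, ?_⟩, e1⟩
  · rw [e4]; exact (continuous_fourier hηi).comp continuous_neg
  · obtain ⟨K, hK, hL⟩ := lipschitz_fourier hηi hηi1
    refine (h1.congr e1).expDecay hK (M := ∫ v, ‖η v‖) (fun a b => ?_) fun a => ?_
    · rw [e4]
      refine (hL _ _).trans_eq ?_
      rw [← norm_neg (-a - -b)]
      congr 2
      abel
    · rw [e4]; exact norm_fourier_le _ _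
  · obtain ⟨K, hK, hL⟩ := lipschitz_fourier hψi hψi1
    refine (h2.congr e3).expDecay hK (M := ∫ v, ‖ψ v‖) (fun a b => ?_) fun a => ?_
    · rw [e2]; exact hL a b
    · rw [e2]; exact norm_fourier_le _ _

theorem KernDecay.comp_neg {f : H n → ℂ} (h : KernDecay lam f) :
    KernDecay lam fun p => f (-p.1, -p.2.1, p.2.2) := by
  obtain ⟨t, ht, C, hC⟩ := h
  refine ⟨t, ht, C, ?_⟩
  have hq := quasiMeasurePreserving_prodMap_smul (n := n) (c := -1) (d := -1)
    (by norm_num) (by norm_num)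
  filter_upwards [hq.ae hC] with z hz
  simp only [Prod.map_fst, Prod.map_snd, neg_smul, one_smul, norm_neg] at hz
  refine le_trans (le_of_eq ?_) hz
  congr 1
  rw [kern, kern, ← integral_neg_eq_self]
  refine integral_congr_ae (Filter.Eventually.of_forall fun x => ?_)
  simp [centralFourier]

/-- Vectors in the range of `π_lam(𝓑^lam)` decay exponentially with their Fourier transform. -/
theorem exists_decayPair_schrodingerInt (hlam : lam ≠ 0) {f : L1 n} (hf : f ∈ B n lam) (φ : V n) :
    ∃ ψ₀ : E n → ℂ, DecayPair ψ₀ ∧ schrodingerInt lam f φ =ᵐ[volume] ψ₀ := by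
  obtain ⟨h1, h2⟩ := (mem_B_iff hlam f).1 hf
  refine exists_decayPair _ (h1.expWeighted hlam φ) ?_
  -- The cube of the automorphism is the automorphism after a reflection, so the second half of
  -- `mem_B_iff` applies. Since the fourth power is the identity, this twisted function represents
  -- `𝓕 π_lam(f) 𝓕⁻¹`.
  have h3 : KernDecay lam fun p => f (fourierAut lam (fourierAut lam (fourierAut lam p))) := by
    have := h2.comp_neg
    simpa only [← fourierAut_fourierAut hlam, Function.comp_apply] using this
  have hm := measurePreserving_fourierAut (n := n) hlam
  have hi : Integrable fun p => f (fourierAut lam (fourierAut lam (fourierAut lam p))) :=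
    (hm.comp (hm.comp hm)).integrable_comp_of_integrable (L1.integrable_coeFn f)
  have h4 := fourier_integral_smul_schrodinger hlam hi φ
  simp only [fourierAut_four hlam] at h4
  rw [← schrodingerInt_toL1 hi] at h4
  rw [schrodingerInt, h4]
  exact (h3.congr hi.coeFn_toL1.symm).expWeighted hlam _

end DecayPair

/-! ### Analytic vectors decay exponentially -/

section AnalyticVector

variable {n : ℕ} {lam : ℝ}

/-- The modulation `ψ ↦ e^{i lam s a·ξ} ψ`. -/
def modulation (lam : ℝ) (a : E n) (s : ℝ) (ψ : V n) : V n := schrodinger lam (s • a, 0, 0) ψ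

theorem modulation_coeFn (a : E n) (s : ℝ) (ψ : V n) : modulation lam a s ψ =ᵐ[volume]
    fun ξ => Complex.exp (s * (Complex.I * ((lam * inner ℝ a ξ : ℝ) : ℂ))) * ψ ξ := by
  filter_upwards [schrodinger_coeFn lam (s • a, 0, 0) ψ] with ξ hξ
  refine hξ.trans ?_
  simp only [schrodingerFun, mul_zero, Complex.ofReal_zero, Complex.exp_zero, one_mul,
    inner_zero_right, add_zero, real_inner_smul_left]
  congr 2
  push_cast
  ring

theorem modulation_add (a : E n) (s t : ℝ) (ψ : V n) :
    modulation lam a (s + t) ψ = modulation lam a s (modulation lam a t ψ) := by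
  rw [modulation, modulation, modulation, schrodinger_mul]
  congr 1
  simp [mul, add_smul]

theorem modulation_zero (a : E n) (ψ : V n) : modulation lam a 0 ψ = ψ := by
  rw [modulation, zero_smul]
  exact schrodinger_zero lam ψ

/-- Difference quotients along `1/(k+1)` converge in `L²`, hence almost everywhere along a
subsequence, while pointwise they converge to the derivative of the exponential. A countable
sequence keeps the union of exceptional sets null. -/
theorem ae_eq_of_hasDerivAt_modulation {a : E n} {ψ c : V n}
    (h : HasDerivAt (fun s => modulation lam a s ψ) c 0) :
    c =ᵐ[volume] fun ξ => (Complex.I * ((lam * inner ℝ a ξ : ℝ) : ℂ)) * ψ ξ := by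
  have h1 := h.tendsto_slope_zero
  have hs : Filter.Tendsto (fun k : ℕ => (1 / ((k : ℝ) + 1))) Filter.atTop (𝓝[≠] 0) := by
    refine tendsto_nhdsWithin_iff.2 ⟨tendsto_one_div_add_atTop_nhds_zero_nat, ?_⟩
    exact Filter.Eventually.of_forall fun k => by
      simp only [Set.mem_compl_iff, Set.mem_singleton_iff]; positivity
  have h2 := h1.comp hs
  have h3 := tendstoInMeasure_of_tendsto_Lp h2
  obtain ⟨ns, hns, h4⟩ := h3.exists_seq_tendsto_ae
  have h5 : ∀ᵐ ξ : E n, ∀ k : ℕ, (modulation lam a (0 + 1 / ((k : ℝ) + 1)) ψ) ξ =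
      Complex.exp (((0 + 1 / ((k : ℝ) + 1) : ℝ) : ℂ) *
        (Complex.I * ((lam * inner ℝ a ξ : ℝ) : ℂ))) * ψ ξ :=
    ae_all_iff.2 fun k => modulation_coeFn a _ ψ
  have h6 : ∀ᵐ ξ : E n, ∀ k : ℕ,
      ((1 / ((k : ℝ) + 1))⁻¹ • (modulation lam a (0 + 1 / ((k : ℝ) + 1)) ψ -
        modulation lam a 0 ψ) : V n) ξ = (1 / ((k : ℝ) + 1))⁻¹ •
        ((modulation lam a (0 + 1 / ((k : ℝ) + 1)) ψ) ξ - (modulation lam a 0 ψ) ξ) :=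
    ae_all_iff.2 fun k => by
      filter_upwards [Lp.coeFn_smul (1 / ((k : ℝ) + 1))⁻¹
        (modulation lam a (0 + 1 / ((k : ℝ) + 1)) ψ - modulation lam a 0 ψ),
        Lp.coeFn_sub (modulation lam a (0 + 1 / ((k : ℝ) + 1)) ψ) (modulation lam a 0 ψ)]
        with ξ e1 e2
      rw [e1, Pi.smul_apply, e2, Pi.sub_apply]
  filter_upwards [h4, h5, h6] with ξ h4 h5 h6
  refine tendsto_nhds_unique h4 ?_
  set z : ℂ := Complex.I * ((lam * inner ℝ a ξ : ℝ) : ℂ) with hz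
  have hd : HasDerivAt (fun s : ℝ => Complex.exp ((s : ℂ) * z) * ψ ξ) (z * ψ ξ) 0 := by
    have e1 : HasDerivAt (fun s : ℝ => (s : ℂ) * z) z 0 := by
      simpa using (Complex.ofRealCLM.hasDerivAt (x := (0 : ℝ))).mul_const z
    simpa using e1.cexp.mul_const (ψ ξ)
  have h7 := (hd.tendsto_slope_zero.comp hs).comp hns.tendsto_atTop
  refine h7.congr fun k => ?_
  simp only [Function.comp_apply]
  rw [h6, h5, modulation_zero]
  simp

/-- Modulations form a one-parameter group of bounded operators, so the derivative at `t` is the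
modulated derivative at `0`. -/
theorem hasDerivAt_modulation {a : E n} {ψ c : V n}
    (h : HasDerivAt (fun s => modulation lam a s ψ) c 0) (t : ℝ) :
    HasDerivAt (fun s => modulation lam a s ψ) (modulation lam a t c) t := by
  have h1 : HasDerivAt (fun s => modulation lam a (s - t) ψ) c t := by
    have := HasDerivAt.comp_sub_const t t (f := fun s => modulation lam a s ψ) (by simpa using h)
    exact this
  have h2 := (((schrodingerₗᵢ lam (t • a, 0, 0)).toContinuousLinearMap.restrictScalars ℝ).hasFDerivAt
    (x := modulation lam a (t - t) ψ)).comp_hasDerivAt t h1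
  refine h2.congr_of_eventuallyEq (Filter.Eventually.of_forall fun s => ?_)
  change modulation lam a s ψ = modulation lam a t (modulation lam a (s - t) ψ)
  rw [← modulation_add, add_sub_cancel]

/-- Smoothness places `ψ` in the domain of every power of the generator, multiplication by `i lam
a·ξ`. The formula is carried for all `s`, not just `s = 0`, so that it can be differentiated again.
-/
theorem exists_iteratedDeriv_modulation {a : E n} {ψ : V n}
    (h : ContDiff ℝ (⊤ : ℕ∞) fun s => modulation lam a s ψ) (k : ℕ) :
    ∃ c : V n, (c =ᵐ[volume] fun ξ => (Complex.I * ((lam * inner ℝ a ξ : ℝ) : ℂ)) ^ k * ψ ξ) ∧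
      iteratedDeriv k (fun s => modulation lam a s ψ) = fun s => modulation lam a s c := by
  induction k with
  | zero => exact ⟨ψ, Filter.Eventually.of_forall fun ξ => by simp, by simp⟩
  | succ k ih =>
    obtain ⟨c, hc, hk⟩ := ih
    have hd := h.differentiable_iteratedDeriv k (by exact_mod_cast ENat.natCast_lt_top k)
    rw [hk] at hd
    have h0 := (hd 0).hasDerivAt
    refine ⟨deriv (fun s => modulation lam a s c) 0, ?_, ?_⟩
    rotate_left
    · rw [iteratedDeriv_succ, hk]
      exact funext fun t => (hasDerivAt_modulation h0 t).deriv
    · filter_upwards [hc, ae_eq_of_hasDerivAt_modulation h0] with ξ h1 h2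
      rw [h2, h1, pow_succ]
      ring

theorem norm_iteratedDeriv_le_of_analyticAt {F : Type*} [NormedAddCommGroup F] [NormedSpace ℝ F]
    [CompleteSpace F] {g : ℝ → F} (hg : AnalyticAt ℝ g 0) :
    ∃ R : ℝ, 0 < R ∧ ∃ C : ℝ, 0 ≤ C ∧ ∀ k : ℕ,
      ‖iteratedDeriv k g 0‖ ≤ C * R ^ k * k.factorial := by
  obtain ⟨p, r, hp⟩ := hg
  obtain ⟨ρ, hρ0, hρ⟩ := ENNReal.lt_iff_exists_nnreal_btwn.1 (hp.r_pos.trans_le hp.r_le)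
  have hρ0' : (0 : ℝ) < ρ := by exact_mod_cast hρ0
  obtain ⟨C, hC, hb⟩ := p.norm_mul_pow_le_of_lt_radius hρ
  refine ⟨(ρ : ℝ)⁻¹, by positivity, C, hC.le, fun k => ?_⟩
  rw [iteratedDeriv_eq_iteratedFDeriv, ← hp.factorial_smul, ← Nat.cast_smul_eq_nsmul ℝ, norm_smul]
  have h1 : ‖p k fun _ => (1 : ℝ)‖ ≤ ‖p k‖ := by
    simp
  have h2 : ‖p k‖ ≤ C * (ρ : ℝ)⁻¹ ^ k := by
    rw [inv_pow, ← div_eq_mul_inv, le_div_iff₀ (by positivity)]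
    exact hb k
  rw [Real.norm_of_nonneg (by positivity), mul_comm]
  gcongr
  exact h1.trans h2

/-- If the modulations of `ψ` in the direction `a` depend analytically on the parameter, then
`e^{r|a·ξ|} ψ` is square integrable for small `r`. -/
theorem exists_memLp_exp_mul {a : E n} {ψ : V n} (hlam : lam ≠ 0)
    (h : AnalyticOnNhd ℝ (fun s => modulation lam a s ψ) Set.univ) :
    ∃ r : ℝ, 0 < r ∧ MemLp (fun ξ => Real.exp (r * |inner ℝ a ξ|) * ‖ψ ξ‖) 2 volume := by
  obtain ⟨R, hR, C, hC, hb⟩ := norm_iteratedDeriv_le_of_analyticAt (h 0 (Set.mem_univ _))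
  have hcd : ContDiff ℝ (⊤ : ℕ∞) fun s => modulation lam a s ψ := by
    rw [← contDiffOn_univ]
    exact h.contDiffOn uniqueDiffOn_univ
  choose c hc hk using exists_iteratedDeriv_modulation hcd
  have hcn : ∀ k, ‖c k‖ ≤ C * R ^ k * k.factorial := fun k => by
    have := hb k
    rw [hk] at this
    simpa only [modulation_zero] using this
  -- With this choice `(sR)² = 1/4`, so the bounds on the terms of the `cosh` series are summable.
  set s : ℝ := (2 * R)⁻¹ with hs
  have hs0 : 0 < s := by positivity
  set y : E n → ℝ := fun ξ => lam * inner ℝ a ξ with hy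
  -- The `2k`-th moment of `|ψ|²` is the squared norm of the `k`-th derivative, at most `C² R^{2k}
  -- (k!)²`; the factorials cancel because `(k!)² ≤ (2k)!`.
  have hterm : ∀ k : ℕ, ∫⁻ ξ, ENNReal.ofReal ((s * y ξ) ^ (2 * k) / (2 * k).factorial * ‖ψ ξ‖ ^ 2) ≤
      ENNReal.ofReal (C ^ 2 * (1 / 4) ^ k) := fun k => by
    have e1 : ∀ᵐ ξ, (s * y ξ) ^ (2 * k) / (2 * k).factorial * ‖ψ ξ‖ ^ 2 =
        (s ^ (2 * k) / (2 * k).factorial) * ‖c k ξ‖ ^ 2 := by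
      filter_upwards [hc k] with ξ hξ
      rw [hξ, norm_mul, norm_pow, norm_mul, Complex.norm_I, one_mul, Complex.norm_real,
        Real.norm_eq_abs, mul_pow s, mul_pow _ ‖ψ ξ‖, pow_right_comm, sq_abs, ← pow_mul]
      ring
    rw [lintegral_congr_ae (e1.mono fun ξ h => congrArg ENNReal.ofReal h)]
    have hsq : Integrable fun ξ => ‖c k ξ‖ ^ 2 :=
      (memLp_two_iff_integrable_sq_norm (Lp.memLp (c k)).1).1 (Lp.memLp (c k))
    rw [← ofReal_integral_eq_lintegral_ofReal (hsq.const_mul _)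
      (Filter.Eventually.of_forall fun ξ => by positivity), integral_const_mul]
    refine ENNReal.ofReal_le_ofReal ?_
    have e2 : ∫ ξ, ‖c k ξ‖ ^ 2 = ‖c k‖ ^ 2 := by
      have := inner_self_eq_norm_sq_to_K (𝕜 := ℂ) (c k)
      rw [L2.inner_def] at this
      simp only [inner_self_eq_norm_sq_to_K] at this
      rw [← Complex.ofReal_inj, ← integral_complex_ofReal]
      simpa using this
    rw [e2]
    have hfac : ((k.factorial : ℝ)) ^ 2 ≤ (2 * k).factorial := by
      have := Nat.le_of_dvd (Nat.factorial_pos _) (Nat.factorial_mul_factorial_dvd_factorial_add k k)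
      rw [← two_mul] at this
      rw [sq]
      exact_mod_cast this
    calc s ^ (2 * k) / (2 * k).factorial * ‖c k‖ ^ 2
        ≤ s ^ (2 * k) / (2 * k).factorial * (C * R ^ k * k.factorial) ^ 2 := by
          gcongr
          exact hcn k
      _ = C ^ 2 * ((s * R) ^ 2) ^ k * ((k.factorial : ℝ) ^ 2 / (2 * k).factorial) := by ring_nf
      _ ≤ C ^ 2 * ((s * R) ^ 2) ^ k * 1 := by
          gcongr
          rw [div_le_one (by positivity)]
          exact hfac
      _ = _ := by
          have : s * R = 1 / 2 := by rw [hs]; field_simp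
          rw [this]; norm_num
  have hym : Continuous y := by fun_prop
  have hcosh : ∫⁻ ξ, ENNReal.ofReal (Real.cosh (s * y ξ) * ‖ψ ξ‖ ^ 2) < ⊤ := by
    have e1 : ∀ ξ, ENNReal.ofReal (Real.cosh (s * y ξ) * ‖ψ ξ‖ ^ 2) =
        ∑' k : ℕ, ENNReal.ofReal ((s * y ξ) ^ (2 * k) / (2 * k).factorial * ‖ψ ξ‖ ^ 2) := fun ξ => by
      have h1 := (Real.hasSum_cosh (s * y ξ)).mul_right (‖ψ ξ‖ ^ 2)
      rw [← ENNReal.ofReal_tsum_of_nonneg (fun k => ?_) h1.summable, h1.tsum_eq]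
      have : 0 ≤ (s * y ξ) ^ (2 * k) := by rw [pow_mul]; positivity
      positivity
    simp only [e1]
    rw [lintegral_tsum fun k => ?_]
    · refine (ENNReal.tsum_le_tsum hterm).trans_lt ?_
      rw [← ENNReal.ofReal_tsum_of_nonneg (fun k => by positivity)
        ((summable_geometric_of_lt_one (by norm_num) (by norm_num)).mul_left _)]
      exact ENNReal.ofReal_lt_top
    · refine AEMeasurable.ennreal_ofReal ?_
      exact (Continuous.aemeasurable (by fun_prop)).mul ((Lp.memLp ψ).1.norm.aemeasurable.pow_const 2)
  have hl : 0 < |lam| := abs_pos.2 hlam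
  -- The half compensates for squaring: the square of the weight is `e^{|s y|} ≤ 2 cosh(s y)`.
  refine ⟨s * |lam| / 2, by positivity, ?_⟩
  have hm : AEStronglyMeasurable (fun ξ => Real.exp (s * |lam| / 2 * |inner ℝ a ξ|) * ‖ψ ξ‖)
      volume :=
    AEStronglyMeasurable.mul (Continuous.aestronglyMeasurable (by fun_prop)) (Lp.memLp ψ).1.norm
  rw [memLp_two_iff_integrable_sq hm]
  have hci : Integrable fun ξ => Real.cosh (s * y ξ) * ‖ψ ξ‖ ^ 2 := by
    refine ⟨(Continuous.aestronglyMeasurable (by fun_prop)).mul ((Lp.memLp ψ).1.norm.pow 2), ?_⟩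
    rw [hasFiniteIntegral_iff_ofReal (Filter.Eventually.of_forall fun ξ => by positivity)]
    exact hcosh
  refine (hci.const_mul 2).mono' (hm.pow 2) (Filter.Eventually.of_forall fun ξ => ?_)
  rw [Real.norm_of_nonneg (by positivity), mul_pow, ← Real.exp_nat_mul, ← mul_assoc 2 (Real.cosh _)]
  refine mul_le_mul_of_nonneg_right ?_ (by positivity)
  have e3 : ((2 : ℕ) : ℝ) * (s * |lam| / 2 * |inner ℝ a ξ|) = |s * y ξ| := by
    simp only [hy, abs_mul, abs_of_pos hs0]; push_cast; ring
  rw [e3, ← Real.cosh_abs, Real.cosh_eq]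
  linarith [Real.exp_pos (-|s * y ξ|)]

theorem expWeighted_of_mem_analyticVectors (hlam : lam ≠ 0) {ψ : V n}
    (h : ψ ∈ analyticVectors n lam) : ExpWeighted ψ := by
  have h1 : ∀ j : Fin n, ∃ r : ℝ, 0 < r ∧
      MemLp (fun ξ : E n => Real.exp (r * |ξ j|) * ‖ψ ξ‖) 2 volume := fun j => by
    have ha : AnalyticOnNhd ℝ
        (fun s => modulation lam (EuclideanSpace.single j (1 : ℝ) : E n) s ψ) Set.univ := by
      intro s _
      have hlin : AnalyticAt ℝ
          (fun s : ℝ => ((s • EuclideanSpace.single j (1 : ℝ), 0, 0) : H n)) s :=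
        (analyticAt_id.smul analyticAt_const).prod analyticAt_const
      exact (h _ (Set.mem_univ _)).fun_comp hlin
    obtain ⟨r, hr, h2⟩ := exists_memLp_exp_mul hlam ha
    refine ⟨r, hr, ?_⟩
    simpa [EuclideanSpace.inner_single_left] using h2
  choose r hr h2 using h1
  obtain ⟨ρ, hρ0, hρ⟩ : ∃ ρ : ℝ, 0 < ρ ∧ ∀ j, ρ ≤ r j := by
    rcases isEmpty_or_nonempty (Fin n) with hn | hn
    · exact ⟨1, one_pos, fun j => hn.elim j⟩
    · obtain ⟨j, hj⟩ := Finite.exists_min r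
      exact ⟨r j, hr j, hj⟩
  refine ⟨ρ / (n + 1), by positivity, ?_⟩
  -- The weight in `|ξ|` is dominated by the weight of the largest coordinate. The separate summand
  -- `‖ψ ξ‖` is for `n = 0`, where the sum over coordinates is empty.
  have h3 : MemLp (fun ξ : E n => ‖ψ ξ‖ + ∑ j, Real.exp (r j * |ξ j|) * ‖ψ ξ‖) 2 volume :=
    (Lp.memLp ψ).norm.add (memLp_finsetSum _ fun j _ => h2 j)
  refine h3.of_le ?_ (Filter.Eventually.of_forall fun ξ => ?_)
  · exact AEStronglyMeasurable.mul (Continuous.aestronglyMeasurable (by fun_prop))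
      (Lp.memLp ψ).1.norm
  rw [Real.norm_of_nonneg (by positivity), Real.norm_of_nonneg (by positivity), ← Finset.sum_mul,
    ← one_add_mul]
  refine mul_le_mul_of_nonneg_right ?_ (norm_nonneg _)
  rcases isEmpty_or_nonempty (Fin n) with hn | hn
  · have : ξ = 0 := by ext j; exact hn.elim j
    rw [this]
    simp
  · obtain ⟨j, hj⟩ := Finite.exists_max fun i => |ξ i|
    have h4 : ‖ξ‖ ≤ (n + 1) * |ξ j| := by
      rw [EuclideanSpace.norm_eq]
      refine Real.sqrt_le_iff.2 ⟨by positivity, ?_⟩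
      calc ∑ i, ‖ξ i‖ ^ 2 ≤ ∑ _i : Fin n, |ξ j| ^ 2 :=
            Finset.sum_le_sum fun i _ => pow_le_pow_left₀ (norm_nonneg _) (hj i) 2
        _ = n * |ξ j| ^ 2 := by simp
        _ ≤ (n + 1) ^ 2 * |ξ j| ^ 2 := by
            gcongr
            have : (0 : ℝ) ≤ n := by positivity
            nlinarith
        _ = _ := by ring
    have h5 : ρ / (n + 1) * ‖ξ‖ ≤ r j * |ξ j| := by
      calc ρ / (n + 1) * ‖ξ‖ ≤ ρ / (n + 1) * ((n + 1) * |ξ j|) := by gcongr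
        _ = ρ * |ξ j| := by field_simp
        _ ≤ _ := by gcongr; exact hρ j
    have h6 := Finset.single_le_sum (f := fun i => Real.exp (r i * |ξ i|))
      (fun i _ => (Real.exp_pos _).le) (Finset.mem_univ j)
    have h7 := Real.exp_le_exp.2 h5
    linarith

theorem analyticAt_fourierAut (p : H n) : AnalyticAt ℝ (fourierAut lam : H n → H n) p := by
  let L : H n →ₗ[ℝ] H n :=
    { toFun := fourierAut lam
      map_add' := fun p q => by simp [fourierAut, add_comm]
      map_smul' := fun c p => by simp [fourierAut, smul_comm c] }
  exact (LinearMap.toContinuousLinearMap L).analyticAt p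

/-- The orbit of `𝓕 ψ` is the orbit of `ψ` precomposed with the cube of a linear map and followed by
a bounded operator. -/
theorem fourier_mem_analyticVectors (hlam : lam ≠ 0) {ψ : V n} (h : ψ ∈ analyticVectors n lam) :
    (𝓕 ψ : V n) ∈ analyticVectors n lam := by
  intro p _
  have e : (fun p : H n => schrodinger lam p (𝓕 ψ)) = fun p =>
      ((Lp.fourierTransformₗᵢ (E n) ℂ).toContinuousLinearEquiv : V n →L[ℂ] V n).restrictScalars ℝ
        (schrodinger lam (fourierAut lam (fourierAut lam (fourierAut lam p))) ψ) := by
    funext p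
    conv_lhs => rw [← fourierAut_four hlam p]
    exact (fourier_schrodinger hlam _ ψ).symm
  rw [e]
  refine (ContinuousLinearMap.analyticAt _ _).fun_comp ((h _ (Set.mem_univ _)).fun_comp ?_)
  exact (analyticAt_fourierAut _).fun_comp ((analyticAt_fourierAut _).fun_comp (analyticAt_fourierAut _))

theorem exists_decayPair_of_mem_analyticVectors (hlam : lam ≠ 0) {ψ : V n}
    (h : ψ ∈ analyticVectors n lam) : ∃ ψ₀ : E n → ℂ, DecayPair ψ₀ ∧ ψ =ᵐ[volume] ψ₀ :=
  exists_decayPair ψ (expWeighted_of_mem_analyticVectors hlam h)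
    (expWeighted_of_mem_analyticVectors hlam (fourier_mem_analyticVectors hlam h))

end AnalyticVector

end HeisenbergGroup

namespace HeisenbergGroup

open FourierTransform
open scoped ENNReal NNReal Topology

/-! ### Coherent states -/

section Gaussian

variable {n : ℕ} {lam : ℝ}

/-- The Gaussian `e^{-π|ξ|²}`. -/
def gauss (ξ : E n) : ℂ := Complex.exp (-(Real.pi : ℂ) * (‖ξ‖ : ℂ) ^ 2)

theorem continuous_gauss : Continuous (gauss : E n → ℂ) := by unfold gauss; fun_prop

theorem gauss_eq_ofReal (ξ : E n) : gauss ξ = ((Real.exp (-Real.pi * ‖ξ‖ ^ 2) : ℝ) : ℂ) := by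
  simp [gauss]

theorem conj_gauss (ξ : E n) : starRingEnd ℂ (gauss ξ) = gauss ξ := by
  rw [gauss_eq_ofReal, Complex.conj_ofReal]

/-- The inequality `a|ξ| ≤ a² + π|ξ|²` lets a Gaussian absorb any prescribed exponential rate. -/
theorem norm_gauss_le (a : ℝ) :
    ∃ C : ℝ, 0 ≤ C ∧ ∀ ξ : E n, ‖gauss ξ‖ ≤ C * Real.exp (-a * ‖ξ‖) := by
  refine ⟨Real.exp (a ^ 2), (Real.exp_pos _).le, fun ξ => ?_⟩
  rw [gauss_eq_ofReal, Complex.norm_real, Real.norm_of_nonneg (Real.exp_pos _).le, ← Real.exp_add]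
  refine Real.exp_le_exp.2 ?_
  nlinarith [Real.pi_gt_three, sq_nonneg (a - ‖ξ‖), sq_nonneg ‖ξ‖, sq_nonneg a]

theorem fourier_gauss : 𝓕 (gauss : E n → ℂ) = gauss := by
  funext w
  have hpi : (Real.pi : ℂ) ≠ 0 := by exact_mod_cast Real.pi_ne_zero
  have h := fourier_gaussian_innerProductSpace (V := E n) (b := (Real.pi : ℂ))
    (by simpa using Real.pi_pos) w
  refine h.trans ?_
  rw [div_self hpi, Complex.one_cpow, one_mul, gauss]
  congr 1
  field_simp

theorem expDecay_gauss : ExpDecay (gauss : E n → ℂ) := by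
  obtain ⟨C, -, hC⟩ := norm_gauss_le (n := n) 1
  exact ⟨1, one_pos, C, hC⟩

theorem decayPair_gauss : DecayPair (gauss : E n → ℂ) where
  continuous := continuous_gauss
  decay := expDecay_gauss
  decay_fourier := by rw [fourier_gauss]; exact expDecay_gauss

/-- The element of `L²` given by a function that decays with its Fourier transform. -/
def DecayPair.toV {ψ : E n → ℂ} (h : DecayPair ψ) : V n := h.memLp.toLp

theorem DecayPair.coeFn_toV {ψ : E n → ℂ} (h : DecayPair ψ) : h.toV =ᵐ[volume] ψ :=
  h.memLp.coeFn_toLp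

theorem DecayPair.fourier_toV {ψ : E n → ℂ} (h : DecayPair ψ) :
    (𝓕 h.toV : V n) = h.fourier.toV := by
  refine Lp.ext ?_
  have hi : Integrable h.toV := (integrable_congr h.coeFn_toV).2 h.integrable
  refine (fourier_ae_eq _ hi).trans (Filter.EventuallyEq.trans ?_ h.fourier.coeFn_toV.symm)
  exact Filter.Eventually.of_forall fun w => Real.fourier_congr_ae h.coeFn_toV w

/-- The Gaussian as an element of `L²`. -/
def gaussV (n : ℕ) : V n := (decayPair_gauss (n := n)).toV

theorem gaussV_coeFn : gaussV n =ᵐ[volume] gauss := decayPair_gauss.coeFn_toV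

theorem fourier_gaussV : (𝓕 (gaussV n) : V n) = gaussV n := by
  refine Lp.ext ?_
  have h := (decayPair_gauss (n := n)).fourier_toV
  rw [gaussV, h]
  refine (decayPair_gauss (n := n)).fourier.coeFn_toV.trans ?_
  rw [fourier_gauss]
  exact gaussV_coeFn.symm

/-- The matrix coefficient `⟨π_lam(x,u,0) gauss, ψ⟩`, as a Fourier integral. -/
def coeff (lam : ℝ) (ψ : E n → ℂ) (x u : E n) : ℂ :=
  𝓕 (fun m => ψ (m - (1 / 2 : ℝ) • u) * gauss (m + (1 / 2 : ℝ) • u)) ((lam / (2 * Real.pi)) • x)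

theorem coeff_eq_inner {ψ : E n → ℂ} (h : DecayPair ψ) (x u : E n) :
    coeff lam ψ x u = inner ℂ (schrodinger lam (x, u, 0) (gaussV n)) h.toV := by
  have e1 : inner ℂ (schrodinger lam (x, u, 0) (gaussV n)) h.toV =
      ∫ ξ, starRingEnd ℂ (schrodingerFun lam (x, u, 0) gauss ξ) * ψ ξ := by
    rw [L2.inner_def]
    refine integral_congr_ae ?_
    filter_upwards [schrodinger_coeFn lam (x, u, 0) (gaussV n),
      schrodingerFun_congr lam (x, u, 0) gaussV_coeFn, h.coeFn_toV] with ξ h1 h2 h3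
    rw [h1, h2, h3, RCLike.inner_apply']
  -- Centring at the midpoint, `ξ = m - u/2`, cancels the phase `x·u/2` and leaves a pure Fourier
  -- integral in `m`.
  rw [e1, coeff, Real.fourier_eq', ← integral_sub_right_eq_self
    (fun ξ => starRingEnd ℂ (schrodingerFun lam (x, u, 0) gauss ξ) * ψ ξ) ((1 / 2 : ℝ) • u)]
  refine integral_congr_ae (Filter.Eventually.of_forall fun m => ?_)
  have e2 : m - (1 / 2 : ℝ) • u + u = m + (1 / 2 : ℝ) • u := by module
  simp only [schrodingerFun, map_mul, e2, conj_gauss, smul_eq_mul, mul_zero, Complex.ofReal_zero,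
    Complex.exp_zero, one_mul, ← Complex.exp_conj, Complex.conj_I, Complex.conj_ofReal]
  rw [mul_comm (ψ _), ← mul_assoc]
  congr 3
  simp only [inner_sub_right, real_inner_smul_right]
  rw [real_inner_comm m x]
  have hpi : (Real.pi : ℂ) ≠ 0 := by exact_mod_cast Real.pi_ne_zero
  push_cast
  field_simp
  ring

/-- Plancherel, with the Gaussian fixed by the Fourier transform. The exchange of `x` and `u` turns
decay of `𝓕 ψ` into decay of the coefficient in `x`. -/
theorem coeff_eq_coeff_fourier (hlam : lam ≠ 0) {ψ : E n → ℂ} (h : DecayPair ψ) (x u : E n) :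
    coeff lam ψ x u =
      coeff lam (𝓕 ψ) ((2 * Real.pi / lam) • u) (-((lam / (2 * Real.pi)) • x)) := by
  rw [coeff_eq_inner h, coeff_eq_inner h.fourier, ← h.fourier_toV,
    ← Lp.inner_fourier_eq, fourier_schrodinger hlam, fourier_gaussV]
  rfl

theorem continuous_coeff (hlam : lam ≠ 0) {ψ : E n → ℂ} (h : DecayPair ψ) :
    Continuous fun p : H n => coeff lam ψ p.1 p.2.1 := by
  simp only [coeff_eq_inner h]
  exact Continuous.inner ((continuous_schrodinger hlam (gaussV n)).comp
    (f := fun p : H n => ((p.1, p.2.1, 0) : H n)) (by fun_prop)) continuous_const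

/-- The points `m ∓ u/2` have difference `u` and sum `2m` up to sign, so decay at both of them is
decay in `m` and `u`. -/
theorem exists_mul_gauss_le {ψ : E n → ℂ} (h : ExpDecay ψ) :
    ∃ t : ℝ, 0 < t ∧ ∃ C : ℝ, 0 ≤ C ∧ ∀ m u : E n,
      ‖ψ (m - (1 / 2 : ℝ) • u) * gauss (m + (1 / 2 : ℝ) • u)‖ ≤
        C * Real.exp (-t * (‖m‖ + ‖u‖)) := by
  obtain ⟨t, ht, C, hC⟩ := h
  obtain ⟨D, hD, hG⟩ := norm_gauss_le (n := n) t
  refine ⟨t / 2, by positivity, |C| * D, by positivity, fun m u => ?_⟩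
  rw [norm_mul]
  have h1 : ‖u‖ ≤ ‖m - (1 / 2 : ℝ) • u‖ + ‖m + (1 / 2 : ℝ) • u‖ := by
    have := norm_sub_le (m + (1 / 2 : ℝ) • u) (m - (1 / 2 : ℝ) • u)
    have e : m + (1 / 2 : ℝ) • u - (m - (1 / 2 : ℝ) • u) = u := by module
    rw [e] at this
    linarith
  have h2 : 2 * ‖m‖ ≤ ‖m - (1 / 2 : ℝ) • u‖ + ‖m + (1 / 2 : ℝ) • u‖ := by
    have := norm_add_le (m - (1 / 2 : ℝ) • u) (m + (1 / 2 : ℝ) • u)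
    have e : m - (1 / 2 : ℝ) • u + (m + (1 / 2 : ℝ) • u) = (2 : ℝ) • m := by module
    rw [e, norm_smul, Real.norm_two] at this
    exact this
  calc _ ≤ (|C| * Real.exp (-t * ‖m - (1 / 2 : ℝ) • u‖)) *
        (D * Real.exp (-t * ‖m + (1 / 2 : ℝ) • u‖)) := by
        refine mul_le_mul ((hC _).trans ?_) (hG _) (norm_nonneg _) (by positivity)
        gcongr
        exact le_abs_self C
    _ = |C| * D * Real.exp (-t * (‖m - (1 / 2 : ℝ) • u‖ + ‖m + (1 / 2 : ℝ) • u‖)) := by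
        rw [mul_add, Real.exp_add]; ring
    _ ≤ _ := by
        refine mul_le_mul_of_nonneg_left (Real.exp_le_exp.2 ?_) (by positivity)
        nlinarith [norm_nonneg m]

theorem DecayPair.continuous_mul_gauss {ψ : E n → ℂ} (h : DecayPair ψ) (u : E n) :
    Continuous fun m => ψ (m - (1 / 2 : ℝ) • u) * gauss (m + (1 / 2 : ℝ) • u) :=
  (h.continuous.comp (by fun_prop)).mul (continuous_gauss.comp (by fun_prop))

theorem exists_coeff_le_snd {ψ : E n → ℂ} (h : ExpDecay ψ) :
    ∃ t : ℝ, 0 < t ∧ ∃ C : ℝ, 0 ≤ C ∧ ∀ x u : E n,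
      ‖coeff lam ψ x u‖ ≤ C * Real.exp (-t * ‖u‖) := by
  obtain ⟨t, ht, C, hC, hb⟩ := exists_mul_gauss_le h
  have hi := integrable_exp_neg_mul_norm (n := n) ht
  refine ⟨t, ht, C * ∫ m : E n, Real.exp (-t * ‖m‖), mul_nonneg hC
    (integral_nonneg fun _ => (Real.exp_pos _).le), fun x u => (norm_fourier_le _ _).trans ?_⟩
  calc ∫ m, ‖ψ (m - (1 / 2 : ℝ) • u) * gauss (m + (1 / 2 : ℝ) • u)‖
      ≤ ∫ m : E n, (C * Real.exp (-t * ‖u‖)) * Real.exp (-t * ‖m‖) := by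
        refine integral_mono_of_nonneg (Filter.Eventually.of_forall fun _ => norm_nonneg _)
          (hi.const_mul _) (Filter.Eventually.of_forall fun m => (hb m u).trans_eq ?_)
        simp only [mul_add, Real.exp_add]
        ring
    _ = _ := by rw [integral_const_mul]; ring

theorem exists_coeff_le (hlam : lam ≠ 0) {ψ : E n → ℂ} (h : DecayPair ψ) :
    ∃ t : ℝ, 0 < t ∧ ∃ C : ℝ, 0 ≤ C ∧ ∀ x u : E n,
      ‖coeff lam ψ x u‖ ≤ C * Real.exp (-t * (‖x‖ + ‖u‖)) := by
  obtain ⟨t, ht, C, hC, h1⟩ := exists_coeff_le_snd (lam := lam) h.decay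
  obtain ⟨s, hs, D, hD, h2⟩ := exists_coeff_le_snd (lam := lam) h.decay_fourier
  have hk : 0 < |lam / (2 * Real.pi)| := abs_pos.2 (by have := Real.pi_pos; positivity)
  set k := |lam / (2 * Real.pi)| with hk'
  set τ := min t (s * k) with hτ
  have hτ0 : 0 < τ := lt_min ht (by positivity)
  refine ⟨τ / 2, by positivity, max C D, hC.trans (le_max_left _ _), fun x u => ?_⟩
  -- Decay in `u` comes from `ψ`, decay in `x` from `𝓕 ψ`; the larger of the two norms is at least
  -- half of their sum, which explains the rate `τ / 2`.
  rcases le_total ‖x‖ ‖u‖ with hxu | hxu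
  · refine (h1 x u).trans (mul_le_mul (le_max_left _ _) (Real.exp_le_exp.2 ?_)
      (Real.exp_pos _).le (hC.trans (le_max_left _ _)))
    have : τ * ‖u‖ ≤ t * ‖u‖ := mul_le_mul_of_nonneg_right (min_le_left _ _) (norm_nonneg _)
    nlinarith
  · rw [coeff_eq_coeff_fourier hlam h]
    refine (h2 _ _).trans (mul_le_mul (le_max_right _ _) (Real.exp_le_exp.2 ?_)
      (Real.exp_pos _).le (hC.trans (le_max_left _ _)))
    rw [norm_neg, norm_smul, Real.norm_eq_abs, ← hk']
    have : τ * ‖x‖ ≤ s * k * ‖x‖ := mul_le_mul_of_nonneg_right (min_le_right _ _) (norm_nonneg _)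
    nlinarith

/-- A Gaussian on the centre with `∫ χ(t) e^{i lam t} dt = 1`. -/
def centralGauss (lam t : ℝ) : ℂ :=
  Complex.exp ((lam : ℂ) ^ 2 / (4 * Real.pi)) * Complex.exp (-(Real.pi : ℂ) * (t : ℂ) ^ 2)

theorem integral_centralGauss :
    ∫ t : ℝ, centralGauss lam t * Complex.exp (Complex.I * ((lam * t : ℝ) : ℂ)) = 1 := by
  have hpi : (Real.pi : ℂ) ≠ 0 := by exact_mod_cast Real.pi_ne_zero
  have h := fourierIntegral_gaussian (b := (Real.pi : ℂ)) (by simpa using Real.pi_pos) (lam : ℂ)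
  rw [div_self hpi, Complex.one_cpow, one_mul] at h
  calc _ = ∫ t : ℝ, Complex.exp ((lam : ℂ) ^ 2 / (4 * Real.pi)) *
        (Complex.exp (Complex.I * lam * t) * Complex.exp (-(Real.pi : ℂ) * (t : ℂ) ^ 2)) := by
        refine integral_congr_ae (Filter.Eventually.of_forall fun t => ?_)
        simp only [centralGauss]
        push_cast
        rw [mul_assoc Complex.I]
        ring
    _ = 1 := by
        rw [integral_const_mul, h, ← Complex.exp_add, neg_div, add_neg_cancel, Complex.exp_zero]

theorem integrable_centralGauss : Integrable (centralGauss lam) := by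
  have h := (integrable_cexp_neg_mul_sq (b := (Real.pi : ℂ)) (by simpa using Real.pi_pos))
  exact h.const_mul _

/-- The function on `ℍⁿ` whose operator is the rank one operator `⟨gauss, ·⟩ ψ`. -/
def coherent (lam : ℝ) (ψ : E n → ℂ) (p : H n) : ℂ :=
  ((|(lam / (2 * Real.pi)) ^ n| : ℝ) : ℂ) * (centralGauss lam p.2.2 * coeff lam ψ p.1 p.2.1)

theorem continuous_coherent (hlam : lam ≠ 0) {ψ : E n → ℂ} (h : DecayPair ψ) :
    Continuous (coherent lam ψ) := by
  refine continuous_const.mul (Continuous.mul ?_ (continuous_coeff hlam h))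
  unfold centralGauss
  fun_prop

theorem exists_integrable_exp_coherent (hlam : lam ≠ 0) {ψ : E n → ℂ} (h : DecayPair ψ) :
    ∃ r : ℝ, 0 < r ∧ Integrable fun p : H n =>
      Real.exp (r * (‖p.1‖ + ‖p.2.1‖)) * ‖coherent lam ψ p‖ := by
  obtain ⟨t, ht, C, hC, hb⟩ := exists_coeff_le hlam h
  refine ⟨t / 2, by positivity, ?_⟩
  have h1 := integrable_exp_neg_mul_norm (n := n) (half_pos ht)
  have h2 : Integrable fun p : H n => Real.exp (-(t / 2) * ‖p.1‖) *
      (Real.exp (-(t / 2) * ‖p.2.1‖) * ‖centralGauss lam p.2.2‖) :=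
    h1.mul_prod (h1.mul_prod (integrable_centralGauss (lam := lam)).norm)
  refine (h2.const_mul (|(lam / (2 * Real.pi)) ^ n| * C)).mono' ?_
    (Filter.Eventually.of_forall fun p => ?_)
  · exact (Continuous.mul (by fun_prop) (continuous_coherent hlam h).norm).aestronglyMeasurable
  · rw [Real.norm_of_nonneg (by positivity), coherent, norm_mul, norm_mul, Complex.norm_real,
      Real.norm_of_nonneg (abs_nonneg _)]
    calc _ ≤ Real.exp (t / 2 * (‖p.1‖ + ‖p.2.1‖)) * (|(lam / (2 * Real.pi)) ^ n| *
          (‖centralGauss lam p.2.2‖ * (C * Real.exp (-t * (‖p.1‖ + ‖p.2.1‖))))) := by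
          gcongr; exact hb _ _
      _ = |(lam / (2 * Real.pi)) ^ n| * C * ((Real.exp (t / 2 * (‖p.1‖ + ‖p.2.1‖)) *
          Real.exp (-t * (‖p.1‖ + ‖p.2.1‖))) * ‖centralGauss lam p.2.2‖) := by ring
      _ = |(lam / (2 * Real.pi)) ^ n| * C * ((Real.exp (-(t / 2) * ‖p.1‖) *
          Real.exp (-(t / 2) * ‖p.2.1‖)) * ‖centralGauss lam p.2.2‖) := by
          rw [← Real.exp_add, ← Real.exp_add]
          congr 3
          ring
      _ = _ := by ring

theorem integrable_coherent (hlam : lam ≠ 0) {ψ : E n → ℂ} (h : DecayPair ψ) :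
    Integrable (coherent lam ψ) := by
  obtain ⟨r, hr, hi⟩ := exists_integrable_exp_coherent hlam h
  refine hi.mono' (continuous_coherent hlam h).aestronglyMeasurable
    (Filter.Eventually.of_forall fun p => ?_)
  exact le_mul_of_one_le_left (norm_nonneg _) (Real.one_le_exp (by positivity))

/-- Fourier inversion in `m`: the coefficient is a Fourier transform at `(lam/2π) x`, and `kern`
inverts it. The scalar in `coherent` cancels the Jacobian, and the central Gaussian integrates to
one. At `m = (ξ+η)/2`, `u = η-ξ` the value is `ψ(ξ) gauss(η)`, a rank one kernel. -/
theorem kern_coherent (hlam : lam ≠ 0) {ψ : E n → ℂ} (h : DecayPair ψ) (m u : E n) :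
    kern lam (coherent lam ψ) m u =
      ψ (m - (1 / 2 : ℝ) • u) * gauss (m + (1 / 2 : ℝ) • u) := by
  have hpi := Real.pi_pos
  have hR : lam / (2 * Real.pi) ≠ 0 := by positivity
  set R := lam / (2 * Real.pi) with hRdef
  set G : E n → ℂ := fun m => ψ (m - (1 / 2 : ℝ) • u) * gauss (m + (1 / 2 : ℝ) • u) with hG
  have hGc : Continuous G := h.continuous_mul_gauss u
  have hGi : Integrable G := by
    obtain ⟨t, ht, C, hC, hb⟩ := exists_mul_gauss_le h.decay
    refine ((integrable_exp_neg_mul_norm (n := n) ht).const_mul C).mono' hGc.aestronglyMeasurable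
      (Filter.Eventually.of_forall fun m => (hb m u).trans ?_)
    refine mul_le_mul_of_nonneg_left (Real.exp_le_exp.2 ?_) hC
    nlinarith [norm_nonneg u]
  have hFi : Integrable (𝓕 G) := by
    obtain ⟨t, ht, C, hC, hb⟩ := exists_coeff_le hlam h
    have ht' : 0 < t * |R⁻¹| := by positivity
    refine ((integrable_exp_neg_mul_norm (n := n) ht').const_mul C).mono'
      (continuous_fourier hGi).aestronglyMeasurable (Filter.Eventually.of_forall fun y => ?_)
    have h1 := hb (R⁻¹ • y) u
    rw [coeff, ← hRdef, smul_inv_smul₀ hR] at h1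
    refine h1.trans (mul_le_mul_of_nonneg_left (Real.exp_le_exp.2 ?_) hC)
    rw [norm_smul, Real.norm_eq_abs]
    nlinarith [norm_nonneg u]
  have hinv := congrFun (hGc.fourierInv_fourier_eq hGi hFi) m
  rw [Real.fourierInv_eq'] at hinv
  have hcomp := Measure.integral_comp_smul (volume : Measure (E n)) (fun y : E n =>
    Complex.exp (((2 * Real.pi * inner ℝ y m : ℝ) : ℂ) * Complex.I) • 𝓕 G y) R
  rw [hinv, finrank_euclideanSpace_fin, Complex.real_smul] at hcomp
  have hcentral : ∀ x : E n, centralFourier lam (coherent lam ψ) x u =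
      ((|R ^ n| : ℝ) : ℂ) * coeff lam ψ x u := fun x => by
    have e : ∀ t : ℝ, coherent lam ψ (x, u, t) * Complex.exp (Complex.I * ((lam * t : ℝ) : ℂ)) =
        (((|R ^ n| : ℝ) : ℂ) * coeff lam ψ x u) *
          (centralGauss lam t * Complex.exp (Complex.I * ((lam * t : ℝ) : ℂ))) := fun t => by
      simp only [coherent, ← hRdef]; ring
    simp only [centralFourier, e]
    rw [integral_const_mul, integral_centralGauss, mul_one]
  have hfin : kern lam (coherent lam ψ) m u = ((|R ^ n| : ℝ) : ℂ) * ∫ x : E n,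
      Complex.exp (((2 * Real.pi * inner ℝ (R • x) m : ℝ) : ℂ) * Complex.I) • 𝓕 G (R • x) := by
    rw [kern, ← integral_const_mul]
    refine integral_congr_ae (Filter.Eventually.of_forall fun x => ?_)
    simp only [hcentral, smul_eq_mul]
    rw [coeff, ← hRdef, ← hG]
    have e : lam * inner ℝ m x = 2 * Real.pi * inner ℝ (R • x) m := by
      rw [real_inner_smul_left, hRdef, real_inner_comm]; field_simp
    rw [e, mul_comm Complex.I]
    ring
  rw [hfin, hcomp, ← mul_assoc, ← Complex.ofReal_mul, ← abs_mul,
    mul_inv_cancel₀ (pow_ne_zero n hR)]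
  simp [hG]

theorem kernDecay_coherent (hlam : lam ≠ 0) {ψ : E n → ℂ} (h : DecayPair ψ) :
    KernDecay lam (coherent lam ψ) := by
  obtain ⟨t, ht, C, -, hb⟩ := exists_mul_gauss_le h.decay
  refine ⟨t, ht, C, Filter.Eventually.of_forall fun z => ?_⟩
  rw [kern_coherent hlam h]
  exact hb _ _

/-- This makes the two decay conditions of `mem_B_iff` one and the same estimate, applied to `ψ` and
to `𝓕⁻ ψ`. -/
theorem coherent_comp_fourierAut (hlam : lam ≠ 0) {ψ : E n → ℂ} (h : DecayPair ψ) :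
    coherent lam ψ ∘ fourierAut lam = coherent lam (𝓕⁻ ψ) := by
  funext p
  have e := coeff_eq_coeff_fourier hlam h.fourierInv p.1 p.2.1
  rw [h.continuous.fourier_fourierInv_eq h.integrable h.integrable_fourier] at e
  simp only [Function.comp_apply, coherent, fourierAut, e]

theorem coherent_mem_B (hlam : lam ≠ 0) {ψ : E n → ℂ} (h : DecayPair ψ) :
    (integrable_coherent hlam h).toL1 (coherent lam ψ) ∈ B n lam := by
  rw [mem_B_iff hlam]
  have e := (integrable_coherent hlam h).coeFn_toL1
  refine ⟨(kernDecay_coherent hlam h).congr e.symm, ?_⟩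
  have h2 := kernDecay_coherent hlam h.fourierInv
  rw [← coherent_comp_fourierAut hlam h] at h2
  exact h2.congr ((measurePreserving_fourierAut hlam).quasiMeasurePreserving.ae e.symm)

theorem integral_gauss_mul_gaussV_ne_zero : ∫ η : E n, gauss η * gaussV n η ≠ 0 := by
  have e : ∫ η : E n, gauss η * gaussV n η =
      ∫ η : E n, Complex.exp (-(2 * Real.pi : ℂ) * (‖η‖ : ℂ) ^ 2) := by
    refine integral_congr_ae ?_
    filter_upwards [gaussV_coeFn (n := n)] with η hη
    rw [hη, gauss, ← Complex.exp_add]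
    congr 1
    ring
  rw [e, GaussianFourier.integral_cexp_neg_mul_sq_norm (by simpa using Real.pi_pos)]
  have hpi : (Real.pi : ℂ) ≠ 0 := by exact_mod_cast Real.pi_ne_zero
  rw [Complex.cpow_def_of_ne_zero (div_ne_zero hpi (by simp))]
  exact Complex.exp_ne_zero _

theorem integral_coherent_smul_gaussV (hlam : lam ≠ 0) {ψ : E n → ℂ} (h : DecayPair ψ) :
    ∫ p, coherent lam ψ p • schrodinger lam p (gaussV n) =
      (∫ η : E n, gauss η * gaussV n η) • h.toV := by
  refine ext_inner_left ℂ fun g => ?_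
  rw [inner_integral_smul_schrodinger hlam (integrable_coherent hlam h), inner_smul_right,
    L2.inner_def, ← integral_const_mul]
  refine integral_congr_ae ?_
  filter_upwards [h.coeFn_toV] with ξ hξ
  rw [hξ, RCLike.inner_apply']
  have e : ∀ u, starRingEnd ℂ (g ξ) * (kern lam (coherent lam ψ) (ξ + (1 / 2 : ℝ) • u) u *
      gaussV n (ξ + u)) = starRingEnd ℂ (g ξ) * ψ ξ * (gauss (ξ + u) * gaussV n (ξ + u)) := by
    intro u
    rw [kern_coherent hlam h]
    have e1 : ξ + (1 / 2 : ℝ) • u - (1 / 2 : ℝ) • u = ξ := by module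
    have e2 : ξ + (1 / 2 : ℝ) • u + (1 / 2 : ℝ) • u = ξ + u := by module
    rw [e1, e2]
    ring
  simp only [e]
  rw [integral_const_mul, integral_add_left_eq_self (fun η => gauss η * gaussV n η) ξ]
  ring

/-- Every function that decays with its Fourier transform is in `π_lam(𝓑^lam)V`. -/
theorem DecayPair.toV_eq (hlam : lam ≠ 0) {ψ : E n → ℂ} (h : DecayPair ψ) :
    h.toV = ∫ p, coherent lam ψ p • schrodinger lam p
      ((∫ η : E n, gauss η * gaussV n η)⁻¹ • gaussV n) := by
  simp only [← schrodingerₗᵢ_apply, map_smul]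
  simp only [schrodingerₗᵢ_apply, smul_comm (coherent lam ψ _)]
  rw [integral_smul, integral_coherent_smul_gaussV hlam h, smul_smul,
    inv_mul_cancel₀ integral_gauss_mul_gaussV_ne_zero, one_smul]

end Gaussian

end HeisenbergGroup

namespace HeisenbergGroup

open FourierTransform
open scoped ENNReal NNReal Topology

/-! ### Analyticity of orbits -/

section Orbit

variable {n : ℕ} {lam : ℝ}

theorem analyticAt_inner {F : Type*} [NormedAddCommGroup F] [NormedSpace ℝ F] {f g : F → E n}
    {p : F} (hf : AnalyticAt ℝ f p) (hg : AnalyticAt ℝ g p) :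
    AnalyticAt ℝ (fun q => inner ℝ (f q) (g q)) p :=
  AnalyticAt.fun_comp (g := fun z : E n × E n => inner ℝ z.1 z.2) (f := fun q => (f q, g q))
    ((innerSL ℝ : E n →L[ℝ] E n →L[ℝ] ℝ).analyticAt_bilinear (f p, g p)) (hf.prod hg)

theorem analyticAt_cexp_real {F : Type*} [NormedAddCommGroup F] [NormedSpace ℝ F] {f : F → ℂ}
    {p : F} (hf : AnalyticAt ℝ f p) : AnalyticAt ℝ (fun q => Complex.exp (f q)) p :=
  (analyticAt_cexp.restrictScalars (𝕜 := ℝ)).fun_comp hf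

theorem analyticAt_ofReal {F : Type*} [NormedAddCommGroup F] [NormedSpace ℝ F] {f : F → ℝ}
    {p : F} (hf : AnalyticAt ℝ f p) : AnalyticAt ℝ (fun q => (f q : ℂ)) p :=
  (Complex.ofRealCLM.analyticAt _).fun_comp hf

theorem analyticAt_mul_left (p q : H n) : AnalyticAt ℝ (fun q => mul p q) q := by
  have h1 : AnalyticAt ℝ (fun q : H n => q.1) q := analyticAt_fst
  have h2 : AnalyticAt ℝ (fun q : H n => q.2.1) q := analyticAt_fst.fun_comp analyticAt_snd
  have h3 : AnalyticAt ℝ (fun q : H n => q.2.2) q := analyticAt_snd.fun_comp analyticAt_snd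
  refine (analyticAt_const.add h1).prod ((analyticAt_const.add h2).prod
    ((analyticAt_const.add h3).add (analyticAt_const.mul ?_)))
  exact (analyticAt_inner analyticAt_const h1).sub (analyticAt_inner h2 analyticAt_const)

theorem mul_inv_cancel_left (p q : H n) : mul p (mul (inv p) q) = q := by
  refine Prod.ext ?_ (Prod.ext ?_ ?_)
  · simp [mul, inv]
  · simp [mul, inv]
  · simp only [mul, inv, inner_add_left, inner_add_right, inner_neg_left, inner_neg_right]
    ring

/-- Homogeneity: `π(q) = π(p) π(p⁻¹q)`, with `π(p)` bounded and left translation analytic. -/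
theorem mem_analyticVectors_of_analyticAt_zero {ψ : V n}
    (h : AnalyticAt ℝ (fun p : H n => schrodinger lam p ψ) 0) : ψ ∈ analyticVectors n lam := by
  intro p _
  have e : (fun q : H n => schrodinger lam q ψ) = fun q =>
      (schrodingerₗᵢ lam p).toContinuousLinearMap.restrictScalars ℝ
        (schrodinger lam (mul (inv p) q) ψ) := by
    funext q
    change _ = schrodinger lam p _
    rw [schrodinger_mul, mul_inv_cancel_left]
  have h0 : mul (inv p) p = 0 := by
    refine Prod.ext ?_ (Prod.ext ?_ ?_)
    · simp [mul, inv]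
    · simp [mul, inv]
    · simp [mul, inv, real_inner_comm]
  rw [e]
  refine (ContinuousLinearMap.analyticAt _ _).fun_comp ?_
  refine AnalyticAt.fun_comp (g := fun q : H n => schrodinger lam q ψ) ?_ (analyticAt_mul_left _ _)
  rw [h0]
  exact h

theorem schrodinger_comm (p q : H n) (φ : V n) :
    schrodinger lam q (schrodinger lam p φ) =
      Complex.exp (Complex.I * ((lam * (inner ℝ q.2.1 p.1 - inner ℝ p.2.1 q.1) : ℝ) : ℂ)) •
        schrodinger lam p (schrodinger lam q φ) := by
  rw [← schrodinger_central, schrodinger_mul, schrodinger_mul, schrodinger_mul]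
  congr 1
  refine Prod.ext ?_ (Prod.ext ?_ ?_)
  · simp [mul, add_comm]
  · simp [mul, add_comm]
  · simp only [mul, inner_zero_left, inner_zero_right, zero_add]
    ring

/-- The real linear form `q ↦ i lam (v·x - u·y)` for `p = (x,u,t)`, `q = (y,v,s)`. -/
def commForm (lam : ℝ) (p : H n) : H n →L[ℝ] ℂ :=
  LinearMap.mkContinuous
    { toFun := fun q =>
        Complex.I * ((lam * (inner ℝ q.2.1 p.1 - inner ℝ p.2.1 q.1) : ℝ) : ℂ)
      map_add' := fun q r => by
        simp only [Prod.snd_add, Prod.fst_add, inner_add_left, inner_add_right]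
        push_cast
        ring
      map_smul' := fun c q => by
        simp only [Prod.smul_snd, Prod.smul_fst, real_inner_smul_left, real_inner_smul_right,
          RingHom.id_apply, Complex.real_smul]
        push_cast
        ring }
    (|lam| * (‖p.1‖ + ‖p.2.1‖)) (fun q => by
      simp only [LinearMap.coe_mk, AddHom.coe_mk]
      rw [norm_mul, Complex.norm_I, one_mul, Complex.norm_real, norm_mul, Real.norm_eq_abs lam,
        mul_assoc]
      refine mul_le_mul_of_nonneg_left ?_ (abs_nonneg _)
      have h1 : ‖q.2.1‖ ≤ ‖q‖ := (norm_fst_le q.2).trans (norm_snd_le q)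
      have h2 : ‖q.1‖ ≤ ‖q‖ := norm_fst_le q
      calc ‖inner ℝ q.2.1 p.1 - inner ℝ p.2.1 q.1‖
          ≤ ‖q.2.1‖ * ‖p.1‖ + ‖p.2.1‖ * ‖q.1‖ :=
            (norm_sub_le _ _).trans (add_le_add (norm_inner_le_norm _ _) (norm_inner_le_norm _ _))
        _ ≤ ‖q‖ * ‖p.1‖ + ‖p.2.1‖ * ‖q‖ := by gcongr
        _ = _ := by ring)

theorem commForm_apply (p q : H n) : commForm lam p q =
    Complex.I * ((lam * (inner ℝ q.2.1 p.1 - inner ℝ p.2.1 q.1) : ℝ) : ℂ) := rfl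

theorem norm_commForm_le (p : H n) : ‖commForm lam p‖ ≤ |lam| * (‖p.1‖ + ‖p.2.1‖) :=
  LinearMap.mkContinuous_norm_le _ (by positivity) _

/-- The real linear form `q ↦ (i lam y - 2π v)·ξ` for `q = (y,v,s)`. -/
def gaussForm (lam : ℝ) (ξ : E n) : H n →L[ℝ] ℂ :=
  LinearMap.mkContinuous
    { toFun := fun q => Complex.I * ((lam * inner ℝ q.1 ξ : ℝ) : ℂ) -
        ((2 * Real.pi * inner ℝ q.2.1 ξ : ℝ) : ℂ)
      map_add' := fun q r => by
        simp only [Prod.snd_add, Prod.fst_add, inner_add_left]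
        push_cast
        ring
      map_smul' := fun c q => by
        simp only [Prod.smul_snd, Prod.smul_fst, real_inner_smul_left,
          RingHom.id_apply, Complex.real_smul]
        push_cast
        ring }
    ((|lam| + 2 * Real.pi) * ‖ξ‖) (fun q => by
      simp only [LinearMap.coe_mk, AddHom.coe_mk]
      have hpi := Real.pi_pos
      have h1 : ‖q.2.1‖ ≤ ‖q‖ := (norm_fst_le q.2).trans (norm_snd_le q)
      have h2 : ‖q.1‖ ≤ ‖q‖ := norm_fst_le q
      calc _ ≤ |lam| * (‖q.1‖ * ‖ξ‖) + 2 * Real.pi * (‖q.2.1‖ * ‖ξ‖) := by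
            refine (norm_sub_le _ _).trans (add_le_add ?_ ?_)
            · rw [norm_mul, Complex.norm_I, one_mul, Complex.norm_real, norm_mul,
                Real.norm_eq_abs lam]
              gcongr
              exact norm_inner_le_norm _ _
            · rw [Complex.norm_real, norm_mul, Real.norm_of_nonneg (by positivity)]
              gcongr
              exact norm_inner_le_norm _ _
        _ ≤ |lam| * (‖q‖ * ‖ξ‖) + 2 * Real.pi * (‖q‖ * ‖ξ‖) := by gcongr
        _ = _ := by ring)

theorem gaussForm_apply (ξ : E n) (q : H n) : gaussForm lam ξ q =
    Complex.I * ((lam * inner ℝ q.1 ξ : ℝ) : ℂ) - ((2 * Real.pi * inner ℝ q.2.1 ξ : ℝ) : ℂ) := rfl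

theorem norm_gaussForm_le (ξ : E n) : ‖gaussForm lam ξ‖ ≤ (|lam| + 2 * Real.pi) * ‖ξ‖ :=
  LinearMap.mkContinuous_norm_le _ (by have := Real.pi_pos; positivity) _

/-- The scalar factor in the orbit of the Gaussian. -/
def gaussFactor (lam : ℝ) (q : H n) : ℂ :=
  Complex.exp (Complex.I * ((lam * (q.2.2 + 1 / 2 * inner ℝ q.1 q.2.1) : ℝ) : ℂ) -
    ((Real.pi * inner ℝ q.2.1 q.2.1 : ℝ) : ℂ))

theorem gaussFactor_ne_zero (q : H n) : gaussFactor lam q ≠ 0 := Complex.exp_ne_zero _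

theorem analyticAt_gaussFactor (q : H n) : AnalyticAt ℝ (gaussFactor lam : H n → ℂ) q := by
  have h1 : AnalyticAt ℝ (fun q : H n => q.1) q := analyticAt_fst
  have h2 : AnalyticAt ℝ (fun q : H n => q.2.1) q := analyticAt_fst.fun_comp analyticAt_snd
  have h3 : AnalyticAt ℝ (fun q : H n => q.2.2) q := analyticAt_snd.fun_comp analyticAt_snd
  refine analyticAt_cexp_real ((analyticAt_const.mul (analyticAt_ofReal
    (analyticAt_const.mul (h3.add (analyticAt_const.mul (analyticAt_inner h1 h2)))))).sub
    (analyticAt_ofReal (analyticAt_const.mul (analyticAt_inner h2 h2))))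

/-- Expanding `|ξ + v|²` separates the exponent into a part linear in `q` for fixed `ξ`, suited to
`analyticAt_expMultiplier`, and a scalar independent of `ξ`. -/
theorem schrodingerFun_gauss (q : H n) (ξ : E n) : schrodingerFun lam q gauss ξ =
    gaussFactor lam q * (Complex.exp (gaussForm lam ξ q) * gauss ξ) := by
  have e : (‖ξ + q.2.1‖ : ℂ) ^ 2 = ((‖ξ‖ ^ 2 + 2 * inner ℝ q.2.1 ξ + inner ℝ q.2.1 q.2.1 : ℝ) : ℂ) := by
    rw [← Complex.ofReal_pow, norm_add_sq_real, real_inner_self_eq_norm_sq, real_inner_comm]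
  rw [schrodingerFun, gauss, gauss, gaussFactor, gaussForm_apply, e]
  simp only [← Complex.exp_add]
  congr 1
  push_cast
  ring

/-- The Gaussian is an analytic vector. -/
theorem analyticAt_schrodinger_gaussV :
    AnalyticAt ℝ (fun q : H n => schrodinger lam q (gaussV n)) 0 := by
  have hpi := Real.pi_pos
  -- The rate exceeds the bound for `gaussForm` by one, so that `e^{-|ξ|}` remains after the weight
  -- is applied.
  obtain ⟨C, hC, hb⟩ := norm_gauss_le (n := n) (|lam| + 2 * Real.pi + 1)
  have hmem : MemLp (fun ξ : E n => Real.exp (1 * ((|lam| + 2 * Real.pi) * ‖ξ‖)) * ‖gauss ξ‖) 2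
      volume := by
    refine (memLp_exp_neg_mul_norm (n := n) one_pos).of_le_mul (c := C)
      (Continuous.aestronglyMeasurable ((by fun_prop : Continuous fun ξ : E n =>
        Real.exp (1 * ((|lam| + 2 * Real.pi) * ‖ξ‖))).mul continuous_gauss.norm))
      (Filter.Eventually.of_forall fun ξ => ?_)
    rw [Real.norm_of_nonneg (by positivity), Real.norm_of_nonneg (by positivity)]
    calc _ ≤ Real.exp (1 * ((|lam| + 2 * Real.pi) * ‖ξ‖)) *
          (C * Real.exp (-(|lam| + 2 * Real.pi + 1) * ‖ξ‖)) := by gcongr; exact hb ξ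
      _ = C * (Real.exp (1 * ((|lam| + 2 * Real.pi) * ‖ξ‖)) *
          Real.exp (-(|lam| + 2 * Real.pi + 1) * ‖ξ‖)) := by ring
      _ = _ := by rw [← Real.exp_add]; congr 2; ring
  have hG : AnalyticAt ℝ (fun q : H n =>
      (gaussFactor lam q)⁻¹ • schrodinger lam q (gaussV n)) 0 := by
    refine analyticAt_expMultiplier (L := gaussForm lam)
      (N := fun ξ => (|lam| + 2 * Real.pi) * ‖ξ‖) (fun q => ?_)
      norm_gaussForm_le continuous_gauss.aestronglyMeasurable one_pos hmem fun q _ => ?_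
    · simp only [gaussForm_apply]
      exact Continuous.aestronglyMeasurable (by fun_prop)
    · filter_upwards [Lp.coeFn_smul (gaussFactor lam q)⁻¹ (schrodinger lam q (gaussV n)),
        schrodinger_coeFn lam q (gaussV n), schrodingerFun_congr lam q gaussV_coeFn]
        with ξ h1 h2 h3
      rw [h1, Pi.smul_apply, h2, h3, schrodingerFun_gauss, smul_eq_mul,
        inv_mul_cancel_left₀ (gaussFactor_ne_zero q)]
  refine ((analyticAt_gaussFactor (lam := lam) 0).smul hG).congr (Filter.Eventually.of_forall fun q => ?_)
  exact smul_inv_smul₀ (gaussFactor_ne_zero q) _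

theorem integrable_mul_exp_commForm {f : H n → ℂ} (hf : Integrable f) (q : H n) :
    Integrable fun p => Complex.exp (commForm lam p q) * f p := by
  refine hf.norm.mono' (AEStronglyMeasurable.mul ?_ hf.1) (Filter.Eventually.of_forall fun p => ?_)
  · simp only [commForm_apply]
    exact Continuous.aestronglyMeasurable (by fun_prop)
  · rw [norm_mul, commForm_apply, Complex.norm_exp_I_mul_ofReal, one_mul]

/-- `π_lam(f)` maps analytic vectors to analytic vectors if `f` decays exponentially. -/
theorem analyticAt_schrodinger_integral (hlam : lam ≠ 0) {f : H n → ℂ} (hf : Integrable f)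
    {r : ℝ} (hr : 0 < r)
    (hfr : Integrable fun p : H n => Real.exp (r * (‖p.1‖ + ‖p.2.1‖)) * ‖f p‖) {φ : V n}
    (hφ : AnalyticAt ℝ (fun q : H n => schrodinger lam q φ) 0) :
    AnalyticAt ℝ (fun q : H n => schrodinger lam q (∫ p, f p • schrodinger lam p φ)) 0 := by
  have hl : 0 < |lam| := abs_pos.2 hlam
  -- The exponential decay of `f` in `(x, u)` is used here, and gives radius at least `r / |lam|`
  -- because the commutator form has norm at most `|lam| (‖x‖ + ‖u‖)`.
  have hΘ : AnalyticAt ℝ (fun q : H n => ((integrable_mul_exp_commForm (lam := lam) hf q).toL1 _ :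
      L1 n)) 0 := by
    refine analyticAt_expMultiplier (L := commForm lam) (φ := f)
      (N := fun p => |lam| * (‖p.1‖ + ‖p.2.1‖)) (fun q => ?_) norm_commForm_le hf.1
      (div_pos hr hl) ?_ fun q _ => Integrable.coeFn_toL1 _
    · simp only [commForm_apply]
      exact Continuous.aestronglyMeasurable (by fun_prop)
    · rw [memLp_one_iff_integrable]
      refine hfr.congr (Filter.Eventually.of_forall fun p => ?_)
      have : r / |lam| * (|lam| * (‖p.1‖ + ‖p.2.1‖)) = r * (‖p.1‖ + ‖p.2.1‖) := by field_simp
      simp only [this]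
  -- Moving `π(q)` past `π(p)` costs a central scalar, which is absorbed into `f`. The orbit becomes
  -- a bounded bilinear map of two analytic maps.
  have e : (fun q : H n => schrodinger lam q (∫ p, f p • schrodinger lam p φ)) = fun q =>
      schrodingerIntCLM hlam ((integrable_mul_exp_commForm (lam := lam) hf q).toL1 _)
        (schrodinger lam q φ) := by
    funext q
    rw [schrodingerIntCLM_apply, schrodingerInt_toL1]
    have h := (schrodingerₗᵢ lam q).toContinuousLinearMap.integral_comp_comm
      (integrable_smul_schrodinger hlam hf φ)
    refine h.symm.trans (integral_congr_ae (Filter.Eventually.of_forall fun p => ?_))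
    simp only [LinearIsometry.coe_toContinuousLinearMap, map_smul, schrodingerₗᵢ_apply]
    rw [schrodinger_comm, smul_smul, commForm_apply, mul_comm]
  rw [e]
  have hbil := (schrodingerIntCLM (n := n) hlam).analyticAt_bilinear
    (((integrable_mul_exp_commForm (lam := lam) hf 0).toL1 _ : L1 n), schrodinger lam 0 φ)
  exact AnalyticAt.fun_comp (g := fun z : L1 n × V n => schrodingerIntCLM hlam z.1 z.2)
    (f := fun q : H n => (((integrable_mul_exp_commForm (lam := lam) hf q).toL1 _ : L1 n),
      schrodinger lam q φ)) (hbil.restrictScalars (𝕜 := ℝ)) (hΘ.prod hφ)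

theorem DecayPair.toV_mem_analyticVectors (hlam : lam ≠ 0) {ψ : E n → ℂ} (h : DecayPair ψ) :
    h.toV ∈ analyticVectors n lam := by
  refine mem_analyticVectors_of_analyticAt_zero ?_
  obtain ⟨r, hr, hi⟩ := exists_integrable_exp_coherent hlam h
  rw [h.toV_eq hlam]
  refine analyticAt_schrodinger_integral hlam (integrable_coherent hlam h) hr hi ?_
  have e : (fun q : H n => schrodinger lam q
      ((∫ η : E n, gauss η * gaussV n η)⁻¹ • gaussV n)) = fun q =>
      (∫ η : E n, gauss η * gaussV n η)⁻¹ • schrodinger lam q (gaussV n) := by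
    funext q
    simp only [← schrodingerₗᵢ_apply, map_smul]
  rw [e]
  exact (analyticAt_const (v := (∫ η : E n, gauss η * gaussV n η)⁻¹)).smul
    (analyticAt_schrodinger_gaussV (n := n) (lam := lam))

/-- The range of `π_lam(𝓑^lam)` is the space of analytic vectors. -/
theorem range_schrodingerInt_eq_analyticVectors (hlam : lam ≠ 0) :
    {ψ : V n | ∃ f ∈ B n lam, ∃ φ : V n, ψ = schrodingerInt lam f φ} = analyticVectors n lam := by
  ext ψ
  constructor
  · rintro ⟨f, hf, φ, rfl⟩
    obtain ⟨ψ₀, h, e⟩ := exists_decayPair_schrodingerInt hlam hf φ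
    rw [Lp.ext (e.trans h.coeFn_toV.symm)]
    exact h.toV_mem_analyticVectors hlam
  · intro hψ
    obtain ⟨ψ₀, h, e⟩ := exists_decayPair_of_mem_analyticVectors hlam hψ
    refine ⟨_, coherent_mem_B hlam h, (∫ η : E n, gauss η * gaussV n η)⁻¹ • gaussV n, ?_⟩
    rw [schrodingerInt_toL1, ← h.toV_eq hlam]
    exact Lp.ext (e.trans h.coeFn_toV.symm)

end Orbit

end HeisenbergGroup

namespace HeisenbergGroup

open scoped ENNReal NNReal

/-! ### Convolution -/

section Convolution

variable {n : ℕ}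

theorem measurePreserving_translate (a b : E n) {l : E n → E n → ℝ}
    (hl : Continuous fun z : E n × E n => l z.1 z.2) :
    MeasurePreserving fun p : H n => (p.1 + a, p.2.1 + b, p.2.2 + l p.1 p.2.1) := by
  refine MeasurePreserving.skew_product (f := fun x : E n => x + a)
    (g := fun (x : E n) (w : E n × ℝ) => (w.1 + b, w.2 + l x w.1))
    (measurePreserving_add_right volume a) ?_ (Filter.Eventually.of_forall fun x => ?_)
  · exact Continuous.measurable (by
      have : Continuous fun z : E n × E n × ℝ => l z.1 z.2.1 :=
        hl.comp (continuous_fst.prodMk (continuous_fst.comp continuous_snd))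
      fun_prop)
  · refine (MeasurePreserving.skew_product (f := fun u : E n => u + b)
      (g := fun (u : E n) (t : ℝ) => t + l x u)
      (measurePreserving_add_right volume b) ?_ (Filter.Eventually.of_forall fun u => ?_)).map_eq
    · exact Continuous.measurable (by
        have : Continuous fun z : E n × ℝ => l x z.1 :=
          hl.comp (continuous_const.prodMk continuous_fst)
        fun_prop)
    · exact (measurePreserving_add_right (volume : Measure ℝ) (l x u)).map_eq

theorem measurePreserving_mul_right (q : H n) : MeasurePreserving fun p : H n => mul p q := by
  have h := measurePreserving_translate q.1 q.2.1
    (l := fun x u => q.2.2 + (1 / 2) * (inner ℝ u q.1 - inner ℝ q.2.1 x)) (by fun_prop)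
  simpa only [mul, add_assoc] using h

theorem measurePreserving_mul_left (p : H n) : MeasurePreserving fun q : H n => mul p q := by
  have h := measurePreserving_translate p.1 p.2.1
    (l := fun y v => p.2.2 + (1 / 2) * (inner ℝ p.2.1 y - inner ℝ v p.1)) (by fun_prop)
  convert h using 2 with q
  simp only [mul, add_comm _ q.1, add_comm _ q.2.1, add_comm p.2.2 q.2.2, add_assoc]

theorem measurePreserving_inv : MeasurePreserving (inv : H n → H n) :=
  (Measure.measurePreserving_neg (volume : Measure (E n))).prod
    ((Measure.measurePreserving_neg (volume : Measure (E n))).prod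
      (Measure.measurePreserving_neg (volume : Measure ℝ)))

theorem quasiMeasurePreserving_mul_inv (p : H n) :
    Measure.QuasiMeasurePreserving fun q : H n => mul p (inv q) :=
  ((measurePreserving_mul_left p).comp measurePreserving_inv).quasiMeasurePreserving

theorem continuous_mul_inv : Continuous fun z : H n × H n => mul z.1 (inv z.2) := by
  unfold mul inv; fun_prop

theorem mul_mul_inv_mul_inv (p q r : H n) :
    mul (mul p (inv q)) (inv (mul r (inv q))) = mul p (inv r) := by
  refine Prod.ext ?_ (Prod.ext ?_ ?_)
  · simp [mul, inv]
  · simp [mul, inv]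
  · simp only [mul, inv, inner_add_left, inner_add_right, inner_neg_left, inner_neg_right,
      real_inner_comm]
    ring

theorem integral_comp_mul_inv (f : H n → ℂ) (q : H n) : ∫ r, f (mul r (inv q)) = ∫ r, f r := by
  refine (measurePreserving_mul_right (inv q)).integral_comp
    (Continuous.measurableEmbedding ?_ fun p r h => ?_) f
  · unfold mul inv; fun_prop
  · simp only [mul, inv, Prod.mk.injEq] at h
    obtain ⟨h1, h2, h3⟩ := h
    have e1 : p.1 = r.1 := add_right_cancel h1
    have e2 : p.2.1 = r.2.1 := add_right_cancel h2
    refine Prod.ext e1 (Prod.ext e2 ?_)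
    rw [e1, e2] at h3
    linarith

/-- Convolution of functions on `ℍⁿ`. -/
def convF (f g : H n → ℂ) (p : H n) : ℂ := ∫ q, f (mul p (inv q)) * g q

/-- Equality holds at every `p`, since `q ↦ p q⁻¹` pulls null sets back to null sets for each fixed
`p`. -/
theorem convF_congr {f f' g g' : H n → ℂ} (hf : f =ᵐ[volume] f') (hg : g =ᵐ[volume] g') :
    convF f g = convF f' g' := by
  funext p
  refine integral_congr_ae ?_
  filter_upwards [(quasiMeasurePreserving_mul_inv p).ae hf, hg] with q h1 h2
  rw [h1, h2]

theorem integrable_mul_inv_prod {f g : H n → ℂ} (hf : Integrable f) (hg : Integrable g) :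
    Integrable (fun z : H n × H n => f (mul z.1 (inv z.2)) * g z.2) (volume.prod volume) :=
  (measurePreserving_mul_inv n).integrable_comp_of_integrable (hf.mul_prod hg)

theorem ae_integrable_mul_inv {f g : H n → ℂ} (hf : Integrable f) (hg : Integrable g) :
    ∀ᵐ p, Integrable fun q => f (mul p (inv q)) * g q :=
  (integrable_mul_inv_prod hf hg).prod_right_ae

theorem conv_coeFn (f g : L1 n) : conv f g =ᵐ[volume] convF f g :=
  Integrable.coeFn_toL1 _

theorem add_conv (f g h : L1 n) : conv (f + g) h = conv f h + conv g h := by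
  refine Lp.ext ?_
  filter_upwards [conv_coeFn (f + g) h, conv_coeFn f h, conv_coeFn g h,
    Lp.coeFn_add (conv f h) (conv g h),
    ae_integrable_mul_inv (L1.integrable_coeFn f) (L1.integrable_coeFn h),
    ae_integrable_mul_inv (L1.integrable_coeFn g) (L1.integrable_coeFn h)] with p h1 h2 h3 h4 h5 h6
  rw [h1, h4, Pi.add_apply, h2, h3, convF_congr (Lp.coeFn_add f g) (Filter.EventuallyEq.refl _ h)]
  simp only [convF, Pi.add_apply, add_mul]
  exact integral_add h5 h6

theorem conv_add (f g h : L1 n) : conv f (g + h) = conv f g + conv f h := by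
  refine Lp.ext ?_
  filter_upwards [conv_coeFn f (g + h), conv_coeFn f g, conv_coeFn f h,
    Lp.coeFn_add (conv f g) (conv f h),
    ae_integrable_mul_inv (L1.integrable_coeFn f) (L1.integrable_coeFn g),
    ae_integrable_mul_inv (L1.integrable_coeFn f) (L1.integrable_coeFn h)] with p h1 h2 h3 h4 h5 h6
  rw [h1, h4, Pi.add_apply, h2, h3, convF_congr (Filter.EventuallyEq.refl _ f) (Lp.coeFn_add g h)]
  simp only [convF, Pi.add_apply, mul_add]
  exact integral_add h5 h6

theorem smul_conv (c : ℂ) (f g : L1 n) : conv (c • f) g = c • conv f g := by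
  refine Lp.ext ?_
  filter_upwards [conv_coeFn (c • f) g, conv_coeFn f g, Lp.coeFn_smul c (conv f g)] with p h1 h2 h3
  rw [h1, h3, Pi.smul_apply, h2, convF_congr (Lp.coeFn_smul c f) (Filter.EventuallyEq.refl _ g)]
  simp only [convF, Pi.smul_apply, smul_eq_mul, mul_assoc]
  exact integral_const_mul _ _

theorem conv_smul (c : ℂ) (f g : L1 n) : conv f (c • g) = c • conv f g := by
  refine Lp.ext ?_
  filter_upwards [conv_coeFn f (c • g), conv_coeFn f g, Lp.coeFn_smul c (conv f g)] with p h1 h2 h3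
  rw [h1, h3, Pi.smul_apply, h2, convF_congr (Filter.EventuallyEq.refl _ f) (Lp.coeFn_smul c g)]
  simp only [convF, Pi.smul_apply, smul_eq_mul, mul_left_comm _ c]
  exact integral_const_mul _ _

instance : SFinite ((volume : Measure (H n)).prod (volume : Measure (H n))) :=
  Measure.prod.instSFinite

theorem measurePreserving_mul_inv_fst : MeasurePreserving
    (fun z : H n × (H n × H n) => (mul z.1 (inv z.2.1), z.2))
      (volume.prod (volume.prod volume)) (volume.prod (volume.prod volume)) := by
  have h1 : MeasurePreserving (fun z : (H n × H n) × H n => (z.1, mul z.2 (inv z.1.1)))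
      ((volume.prod volume).prod volume) ((volume.prod volume).prod volume) := by
    refine MeasurePreserving.skew_product (f := fun w : H n × H n => w)
      (g := fun (w : H n × H n) (p : H n) => mul p (inv w.1)) (MeasurePreserving.id _) ?_
      (Filter.Eventually.of_forall fun w => (measurePreserving_mul_right (inv w.1)).map_eq)
    exact (continuous_mul_inv.comp
      (continuous_snd.prodMk (continuous_fst.comp continuous_fst))).measurable
  exact (Measure.measurePreserving_swap.comp h1).comp Measure.measurePreserving_swap

/-- Right invariance permits replacing `r` by `r q⁻¹` in the inner integral, where `(p q⁻¹)(r q⁻¹)⁻¹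
= p r⁻¹`; then Fubini at almost every `p`. -/
theorem convF_assoc {f g h : H n → ℂ} (hf : Integrable f) (hg : Integrable g) (hh : Integrable h) :
    convF (convF f g) h =ᵐ[volume] convF f (convF g h) := by
  have hi : Integrable (fun z : H n × (H n × H n) => f (mul z.1 (inv z.2.1)) *
      (g (mul z.2.1 (inv z.2.2)) * h z.2.2)) (volume.prod (volume.prod volume)) :=
    measurePreserving_mul_inv_fst.integrable_comp_of_integrable
      (hf.mul_prod (integrable_mul_inv_prod hg hh))
  filter_upwards [hi.prod_right_ae] with p hp
  calc convF (convF f g) h p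
      = ∫ q, ∫ r, f (mul p (inv r)) * (g (mul r (inv q)) * h q) := by
        refine integral_congr_ae (Filter.Eventually.of_forall fun q => ?_)
        simp only [← mul_assoc]
        rw [integral_mul_const, convF, ← integral_comp_mul_inv _ q]
        simp only [mul_mul_inv_mul_inv]
    _ = ∫ r, ∫ q, f (mul p (inv r)) * (g (mul r (inv q)) * h q) :=
        (integral_integral_swap hp).symm
    _ = convF f (convF g h) p := by simp only [integral_const_mul]; rfl

theorem conv_assoc (f g h : L1 n) : conv (conv f g) h = conv f (conv g h) := by
  refine Lp.ext ?_
  filter_upwards [conv_coeFn (conv f g) h, conv_coeFn f (conv g h),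
    convF_assoc (L1.integrable_coeFn f) (L1.integrable_coeFn g) (L1.integrable_coeFn h)]
    with p h1 h2 h3
  rw [h1, h2, convF_congr (conv_coeFn f g) (Filter.EventuallyEq.refl _ h),
    convF_congr (Filter.EventuallyEq.refl _ f) (conv_coeFn g h), h3]

/-- An automorphism preserving Haar measure commutes with convolution, so the second decay condition
reduces to the first. -/
theorem convF_comp_fourierAut {lam : ℝ} (hlam : lam ≠ 0) (f g : H n → ℂ) :
    convF f g ∘ fourierAut lam = convF (f ∘ fourierAut lam) (g ∘ fourierAut lam) := by
  funext p
  rw [Function.comp_apply, convF, ← integral_comp_fourierAut hlam]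
  have hinv : ∀ q : H n, inv (fourierAut lam q) = fourierAut lam (inv q) := fun q => by
    simp [inv, fourierAut]
  simp only [convF, Function.comp_apply, fourierAut_mul hlam, hinv]

end Convolution

end HeisenbergGroup

namespace HeisenbergGroup

open scoped ENNReal NNReal

/-! ### Kernels of sums and convolutions -/

section KernelConvolution

variable {n : ℕ} {lam : ℝ}

theorem kern_eq_integral_integral (f : H n → ℂ) (m u : E n) : kern lam f m u =
    ∫ x, ∫ t, f (x, u, t) * Complex.exp (Complex.I * ((lam * (t + inner ℝ m x) : ℝ) : ℂ)) := by
  refine integral_congr_ae (Filter.Eventually.of_forall fun x => ?_)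
  simp only [centralFourier]
  rw [← integral_mul_const]
  refine integral_congr_ae (Filter.Eventually.of_forall fun t => ?_)
  simp only
  rw [mul_assoc, ← Complex.exp_add]
  congr 2
  push_cast
  ring

theorem integrable_mul_phase {f : H n → ℂ} {u : E n}
    (h : Integrable fun w : E n × ℝ => f (w.1, u, w.2)) (m : E n) :
    Integrable fun w : E n × ℝ => f (w.1, u, w.2) *
      Complex.exp (Complex.I * ((lam * (w.2 + inner ℝ m w.1) : ℝ) : ℂ)) := by
  refine h.mono (h.1.mul (Continuous.aestronglyMeasurable (by fun_prop)))
    (Filter.Eventually.of_forall fun w => ?_)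
  rw [norm_mul, Complex.norm_exp_I_mul_ofReal, mul_one]

theorem kern_eq_integral_prod {f : H n → ℂ} {u : E n}
    (h : Integrable fun w : E n × ℝ => f (w.1, u, w.2)) (m : E n) :
    kern lam f m u = ∫ w : E n × ℝ, f (w.1, u, w.2) *
      Complex.exp (Complex.I * ((lam * (w.2 + inner ℝ m w.1) : ℝ) : ℂ)) := by
  rw [kern_eq_integral_integral]
  exact (integral_prod _ (integrable_mul_phase h m)).symm

theorem kern_add {f g : H n → ℂ} (hf : Integrable f) (hg : Integrable g) :
    ∀ᵐ u, ∀ m, kern lam (f + g) m u = kern lam f m u + kern lam g m u := by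
  filter_upwards [ae_integrable_slice hf, ae_integrable_slice hg] with u h1 h2 m
  rw [kern_eq_integral_prod h1, kern_eq_integral_prod h2, kern_eq_integral_prod (h1.add h2),
    ← integral_add (integrable_mul_phase h1 m) (integrable_mul_phase h2 m)]
  simp only [Pi.add_apply, add_mul]

theorem kern_smul (c : ℂ) (f : H n → ℂ) (m u : E n) :
    kern lam (c • f) m u = c * kern lam f m u := by
  simp only [kern_eq_integral_integral, Pi.smul_apply, smul_eq_mul, mul_assoc, integral_const_mul]

theorem KernDecay.add {f g : H n → ℂ} (hf : Integrable f) (hg : Integrable g)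
    (kf : KernDecay lam f) (kg : KernDecay lam g) : KernDecay lam (f + g) := by
  obtain ⟨t, ht, C, hC⟩ := kf
  obtain ⟨s, hs, D, hD⟩ := kg
  refine ⟨min t s, lt_min ht hs, |C| + |D|, ?_⟩
  have h1 : ∀ᵐ z : E n × E n, ∀ m, kern lam (f + g) m z.2 = kern lam f m z.2 + kern lam g m z.2 :=
    Measure.quasiMeasurePreserving_snd.ae (kern_add hf hg)
  filter_upwards [hC, hD, h1] with z h2 h3 h4
  have hw : 0 ≤ ‖z.1‖ + ‖z.2‖ := by positivity
  rw [h4, add_mul]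
  refine (norm_add_le _ _).trans (add_le_add (h2.trans ?_) (h3.trans ?_))
  · exact mul_le_mul (le_abs_self C) (Real.exp_le_exp.2 (mul_le_mul_of_nonneg_right
      (neg_le_neg (min_le_left _ _)) hw)) (Real.exp_pos _).le (abs_nonneg C)
  · exact mul_le_mul (le_abs_self D) (Real.exp_le_exp.2 (mul_le_mul_of_nonneg_right
      (neg_le_neg (min_le_right _ _)) hw)) (Real.exp_pos _).le (abs_nonneg D)

theorem KernDecay.smul (c : ℂ) {f : H n → ℂ} (kf : KernDecay lam f) : KernDecay lam (c • f) := by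
  obtain ⟨t, ht, C, hC⟩ := kf
  refine ⟨t, ht, ‖c‖ * C, ?_⟩
  filter_upwards [hC] with z hz
  rw [kern_smul, norm_mul, mul_assoc]
  gcongr

theorem KernDecay.zero : KernDecay lam (0 : H n → ℂ) := by
  refine ⟨1, one_pos, 0, Filter.Eventually.of_forall fun z => ?_⟩
  simp [kern, centralFourier]

theorem ae_integrable_slice_mul_inv {f g : H n → ℂ} (hf : Integrable f) (hg : Integrable g) :
    ∀ᵐ w : E n, Integrable (fun z : (E n × ℝ) × H n =>
      f (mul (z.1.1, w, z.1.2) (inv z.2)) * g z.2) (volume.prod volume) := by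
  have h1 : MeasurePreserving (MeasurableEquiv.prodAssoc : H n × H n ≃ᵐ E n × ((E n × ℝ) × H n)) :=
    volume_preserving_prodAssoc
  have h2 : MeasurePreserving (Prod.map (swapVar : H n ≃ᵐ H n) (id : H n → H n))
      (volume.prod volume) (volume.prod volume) :=
    measurePreserving_swapVar.prod (MeasurePreserving.id volume)
  have h3 := (h2.comp (h1.symm MeasurableEquiv.prodAssoc)).integrable_comp_of_integrable
    (integrable_mul_inv_prod hf hg)
  exact Integrable.prod_right_ae (ν := volume.prod volume) h3

theorem measurePreserving_shear_real (y v : E n) (c : ℝ) :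
    MeasurePreserving fun z : E n × ℝ => (z.1 + y, z.2 + (c - 1 / 2 * inner ℝ v (z.1 + y))) :=
  MeasurePreserving.skew_product (f := fun x : E n => x + y)
    (g := fun (x : E n) (t : ℝ) => t + (c - 1 / 2 * inner ℝ v (x + y)))
    (measurePreserving_add_right volume y) (Continuous.measurable (by fun_prop))
    (Filter.Eventually.of_forall fun _ => (measurePreserving_add_right volume _).map_eq)

theorem measurableEmbedding_shear_real (y v : E n) (c : ℝ) : MeasurableEmbedding
    fun z : E n × ℝ => (z.1 + y, z.2 + (c - 1 / 2 * inner ℝ v (z.1 + y))) := by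
  refine Continuous.measurableEmbedding (by fun_prop) fun a b h => ?_
  simp only [Prod.mk.injEq] at h
  have e : a.1 = b.1 := add_right_cancel h.1
  refine Prod.ext e ?_
  have h2 := h.2
  rw [e] at h2
  exact add_right_cancel h2

/-- The slice of the convolution integral at a fixed second factor. -/
theorem integral_slice_mul_inv (f g : H n → ℂ) (m w : E n) (q : H n) :
    (∫ z : E n × ℝ, f (mul (z.1, w, z.2) (inv q)) * g q *
      Complex.exp (Complex.I * ((lam * (z.2 + inner ℝ m z.1) : ℝ) : ℂ))) =
    (∫ z : E n × ℝ, f (z.1, w - q.2.1, z.2) * Complex.exp (Complex.I *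
      ((lam * (z.2 + inner ℝ (m - (1 / 2 : ℝ) • q.2.1) z.1) : ℝ) : ℂ))) *
    (g q * Complex.exp (Complex.I *
      ((lam * (q.2.2 + inner ℝ (m + (1 / 2 : ℝ) • (w - q.2.1)) q.1) : ℝ) : ℂ))) := by
  rw [← (measurePreserving_shear_real q.1 q.2.1 (q.2.2 + 1 / 2 * inner ℝ w q.1)).integral_comp
    (measurableEmbedding_shear_real _ _ _), ← integral_mul_const]
  refine integral_congr_ae (Filter.Eventually.of_forall fun z => ?_)
  -- The shear was chosen to make the argument of `f` equal to `(x, w - v, t)`. The phase then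
  -- factors into those of the two kernels.
  have e : mul (z.1 + q.1, w, z.2 + (q.2.2 + 1 / 2 * inner ℝ w q.1 -
      1 / 2 * inner ℝ q.2.1 (z.1 + q.1))) (inv q) = (z.1, w - q.2.1, z.2) := by
    refine Prod.ext ?_ (Prod.ext ?_ ?_)
    · simp [mul, inv]
    · simp [mul, inv, sub_eq_add_neg]
    · simp only [mul, inv, inner_neg_left, inner_neg_right]
      ring
  have e2 : ∀ a b c d : ℂ, a * b * (c * d) = a * c * (b * d) := fun a b c d => by ring
  simp only [e]
  rw [e2, ← Complex.exp_add]
  congr 2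
  simp only [inner_add_left, inner_add_right, inner_sub_left, real_inner_smul_left]
  push_cast
  ring

/-- The kernel of a convolution is the composition of the kernels. -/
theorem kern_convF {f g : H n → ℂ} (hf : Integrable f) (hg : Integrable g) :
    ∀ᵐ w, ∀ m, kern lam (convF f g) m w = ∫ v, kern lam f (m - (1 / 2 : ℝ) • v) (w - v) *
      kern lam g (m + (1 / 2 : ℝ) • (w - v)) v := by
  filter_upwards [ae_integrable_slice_mul_inv hf hg] with w hw m
  have hΨ : Integrable (fun z : (E n × ℝ) × H n => f (mul (z.1.1, w, z.1.2) (inv z.2)) * g z.2 *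
      Complex.exp (Complex.I * ((lam * (z.1.2 + inner ℝ m z.1.1) : ℝ) : ℂ)))
      (volume.prod volume) := by
    refine hw.mono (hw.1.mul (Continuous.aestronglyMeasurable (by fun_prop)))
      (Filter.Eventually.of_forall fun z => ?_)
    rw [norm_mul, Complex.norm_exp_I_mul_ofReal, mul_one]
  have hslice : ∀ᵐ q : H n, (∫ z : E n × ℝ, f (mul (z.1, w, z.2) (inv q)) * g q *
      Complex.exp (Complex.I * ((lam * (z.2 + inner ℝ m z.1) : ℝ) : ℂ))) =
      kern lam f (m - (1 / 2 : ℝ) • q.2.1) (w - q.2.1) * (g q * Complex.exp (Complex.I *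
        ((lam * (q.2.2 + inner ℝ (m + (1 / 2 : ℝ) • (w - q.2.1)) q.1) : ℝ) : ℂ))) := by
    have h1 : ∀ᵐ v : E n, Integrable fun z : E n × ℝ => f (z.1, w - v, z.2) :=
      (Measure.measurePreserving_sub_left volume w).quasiMeasurePreserving.ae (ae_integrable_slice hf)
    have h2 : ∀ᵐ q : H n, Integrable fun z : E n × ℝ => f (z.1, w - q.2.1, z.2) :=
      Measure.quasiMeasurePreserving_snd.ae (Measure.quasiMeasurePreserving_fst.ae h1)
    filter_upwards [h2] with q hq
    rw [integral_slice_mul_inv, kern_eq_integral_prod hq]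
  calc kern lam (convF f g) m w
      = ∫ x, ∫ t, ∫ q, f (mul (x, w, t) (inv q)) * g q *
        Complex.exp (Complex.I * ((lam * (t + inner ℝ m x) : ℝ) : ℂ)) := by
        simp only [kern_eq_integral_integral, convF, integral_mul_const]
    _ = ∫ z : E n × ℝ, ∫ q, f (mul (z.1, w, z.2) (inv q)) * g q *
        Complex.exp (Complex.I * ((lam * (z.2 + inner ℝ m z.1) : ℝ) : ℂ)) :=
        (integral_prod _ hΨ.integral_prod_left).symm
    _ = ∫ q, ∫ z : E n × ℝ, f (mul (z.1, w, z.2) (inv q)) * g q *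
        Complex.exp (Complex.I * ((lam * (z.2 + inner ℝ m z.1) : ℝ) : ℂ)) :=
        integral_integral_swap hΨ
    _ = ∫ q : H n, kern lam f (m - (1 / 2 : ℝ) • q.2.1) (w - q.2.1) * (g q *
        Complex.exp (Complex.I *
          ((lam * (q.2.2 + inner ℝ (m + (1 / 2 : ℝ) • (w - q.2.1)) q.1) : ℝ) : ℂ))) :=
        integral_congr_ae hslice
    _ = _ := by
        rw [integral_iterated (hΨ.integral_prod_right.congr hslice)]
        simp only [integral_const_mul, kern_eq_integral_integral]

/-- Put `ξ = m - w/2`, `η = m + w/2`, and `ζ = η - v` for the intermediate point. The integrand is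
at most a constant times `e^{-t|ξ|} e^{-t|ζ|} e^{-s|ζ|} e^{-s|η|}`: one factor in `ζ` is discarded,
the other integrated, and decay in `ξ, η` is decay in `m, w`. -/
theorem KernDecay.conv {f g : H n → ℂ} (hf : Integrable f) (hg : Integrable g)
    (kf : KernDecay lam f) (kg : KernDecay lam g) : KernDecay lam (convF f g) := by
  obtain ⟨t, ht, C, hC0, hC⟩ := kf.ae_bound
  obtain ⟨s, hs, D, hD0, hD⟩ := kg.ae_bound
  set M := ∫ v : E n, Real.exp (-t * ‖v‖) with hM
  have hM0 : 0 ≤ M := integral_nonneg fun _ => by positivity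
  have q1 : ∀ c : ℝ, Measure.QuasiMeasurePreserving fun z : E n × E n => z.1 + c • z.2 := fun c =>
    Measure.quasiMeasurePreserving_fst.comp (measurePreserving_shear c).quasiMeasurePreserving
  -- The bounds hold only almost everywhere in the plane. They are sliced at fixed `ξ` for `f` and,
  -- after a shear, at fixed `η` for `g`, so both are available for almost every `v`.
  have h1 := (q1 (-(1 / 2))).ae (Measure.ae_ae_of_ae_prod hC)
  have h2 := (q1 (1 / 2)).ae (Measure.ae_ae_of_ae_prod
    ((measurePreserving_shear (-1)).quasiMeasurePreserving.ae hD))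
  have h3 : ∀ᵐ z : E n × E n, ∀ m, kern lam (convF f g) m z.2 =
      ∫ v, kern lam f (m - (1 / 2 : ℝ) • v) (z.2 - v) *
        kern lam g (m + (1 / 2 : ℝ) • (z.2 - v)) v :=
    Measure.quasiMeasurePreserving_snd.ae (kern_convF hf hg)
  refine ⟨min t s / 2, half_pos (lt_min ht hs), C * D * M, ?_⟩
  filter_upwards [h1, h2, h3] with z h1 h2 h3
  obtain ⟨m, w⟩ := z
  simp only at h1 h2 h3 ⊢
  have hint := (integrable_exp_neg_mul_norm (n := n) ht).comp_sub_left (m + (1 / 2 : ℝ) • w)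
  have hval : ∫ v, Real.exp (-t * ‖m + (1 / 2 : ℝ) • w - v‖) = M :=
    integral_sub_left_eq_self (fun v : E n => Real.exp (-t * ‖v‖)) volume (m + (1 / 2 : ℝ) • w)
  rw [h3]
  set K := C * D * (Real.exp (-t * ‖m + (-(1 / 2) : ℝ) • w‖) *
    Real.exp (-s * ‖m + (1 / 2 : ℝ) • w‖)) with hK
  calc _ ≤ ∫ v, K * Real.exp (-t * ‖m + (1 / 2 : ℝ) • w - v‖) := by
        refine norm_integral_le_of_norm_le (hint.const_mul K) ?_
        filter_upwards [(Measure.measurePreserving_sub_left volume w).quasiMeasurePreserving.ae h1, h2]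
          with v hv1 hv2
        have e1 : m + (-(1 / 2) : ℝ) • w + (1 / 2 : ℝ) • (w - v) = m - (1 / 2 : ℝ) • v := by module
        have e2 : m + (-(1 / 2) : ℝ) • w + (w - v) = m + (1 / 2 : ℝ) • w - v := by module
        have e3 : m + (1 / 2 : ℝ) • w + (-1 : ℝ) • v + (1 / 2 : ℝ) • v =
          m + (1 / 2 : ℝ) • (w - v) := by module
        have e4 : m + (1 / 2 : ℝ) • w + (-1 : ℝ) • v + v = m + (1 / 2 : ℝ) • w := by module
        rw [e1, e2] at hv1
        rw [e3, e4] at hv2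
        have h5 : Real.exp (-s * ‖m + (1 / 2 : ℝ) • w + (-1 : ℝ) • v‖) ≤ 1 :=
          Real.exp_le_one_iff.2 (by nlinarith [norm_nonneg (m + (1 / 2 : ℝ) • w + (-1 : ℝ) • v)])
        rw [norm_mul]
        calc _ ≤ (C * (Real.exp (-t * ‖m + (-(1 / 2) : ℝ) • w‖) *
              Real.exp (-t * ‖m + (1 / 2 : ℝ) • w - v‖))) *
              (D * (1 * Real.exp (-s * ‖m + (1 / 2 : ℝ) • w‖))) := by
              refine mul_le_mul hv1 (hv2.trans ?_) (norm_nonneg _) (by positivity)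
              gcongr
          _ = _ := by rw [hK]; ring
    _ = C * D * M * (Real.exp (-t * ‖m + (-(1 / 2) : ℝ) • w‖) *
        Real.exp (-s * ‖m + (1 / 2 : ℝ) • w‖)) := by
        rw [integral_const_mul, hval, hK]; ring
    _ ≤ _ := by
        rw [← Real.exp_add]
        refine mul_le_mul_of_nonneg_left (Real.exp_le_exp.2 ?_) (by positivity)
        have n1 : ‖w‖ ≤ ‖m + (-(1 / 2) : ℝ) • w‖ + ‖m + (1 / 2 : ℝ) • w‖ := by
          have : w = (m + (1 / 2 : ℝ) • w) - (m + (-(1 / 2) : ℝ) • w) := by module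
          rw [add_comm]
          exact (congrArg norm this).trans_le (norm_sub_le _ _)
        have n2 : 2 * ‖m‖ ≤ ‖m + (-(1 / 2) : ℝ) • w‖ + ‖m + (1 / 2 : ℝ) • w‖ := by
          have : (2 : ℝ) • m = (m + (-(1 / 2) : ℝ) • w) + (m + (1 / 2 : ℝ) • w) := by module
          rw [show 2 * ‖m‖ = ‖(2 : ℝ) • m‖ by rw [norm_smul]; norm_num]
          exact (congrArg norm this).trans_le (norm_add_le _ _)
        have n3 : ‖m‖ + ‖w‖ ≤ 2 * (‖m + (-(1 / 2) : ℝ) • w‖ + ‖m + (1 / 2 : ℝ) • w‖) := by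
          linarith [norm_nonneg m]
        have n4 := mul_le_mul_of_nonneg_left n3 (half_pos (lt_min ht hs)).le
        have n5 := mul_le_mul_of_nonneg_right (min_le_left t s)
          (norm_nonneg (m + (-(1 / 2) : ℝ) • w))
        have n6 := mul_le_mul_of_nonneg_right (min_le_right t s)
          (norm_nonneg (m + (1 / 2 : ℝ) • w))
        linarith

/-- `𝓑^lam` is an algebra under convolution. -/
theorem isConvolutionAlgebra_B (hlam : lam ≠ 0) : IsConvolutionAlgebra (B n lam) := by
  have hJ : Measure.QuasiMeasurePreserving (fourierAut lam : H n → H n) :=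
    (measurePreserving_fourierAut hlam).quasiMeasurePreserving
  have hi : ∀ f : L1 n, Integrable ((f : H n → ℂ) ∘ fourierAut lam) := fun f =>
    (measurePreserving_fourierAut hlam).integrable_comp_of_integrable (L1.integrable_coeFn f)
  have hmem : ∀ (f : L1 n) (F : H n → ℂ), f =ᵐ[volume] F → KernDecay lam F →
      KernDecay lam (F ∘ fourierAut lam) → f ∈ B n lam := fun f F h h1 h2 =>
    (mem_B_iff hlam f).2 ⟨h1.congr h.symm, h2.congr (hJ.ae_eq_comp h).symm⟩
  refine ⟨?_, fun f hf g hg => ?_, fun c f hf => ?_, fun f hf g hg => ?_,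
    fun f _ g _ h _ => conv_assoc f g h, fun f _ g _ h _ => add_conv f g h,
    fun f _ g _ h _ => conv_add f g h, fun c f _ g _ => smul_conv c f g,
    fun c f _ g _ => conv_smul c f g⟩
  · exact hmem 0 0 (Lp.coeFn_zero _ _ _) KernDecay.zero KernDecay.zero
  · obtain ⟨f1, f2⟩ := (mem_B_iff hlam f).1 hf
    obtain ⟨g1, g2⟩ := (mem_B_iff hlam g).1 hg
    exact hmem _ _ (Lp.coeFn_add f g)
      (KernDecay.add (L1.integrable_coeFn f) (L1.integrable_coeFn g) f1 g1)
      (KernDecay.add (hi f) (hi g) f2 g2)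
  · obtain ⟨f1, f2⟩ := (mem_B_iff hlam f).1 hf
    exact hmem _ _ (Lp.coeFn_smul c f) (f1.smul c) (f2.smul c)
  · obtain ⟨f1, f2⟩ := (mem_B_iff hlam f).1 hf
    obtain ⟨g1, g2⟩ := (mem_B_iff hlam g).1 hg
    refine hmem _ _ (conv_coeFn f g)
      (KernDecay.conv (L1.integrable_coeFn f) (L1.integrable_coeFn g) f1 g1) ?_
    rw [convF_comp_fourierAut hlam]
    exact KernDecay.conv (hi f) (hi g) f2 g2

end KernelConvolution

end HeisenbergGroup

end

theorem theorem1p1 (n : ℕ) (lam : ℝ) (hlam : lam ≠ 0) :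
    HeisenbergGroup.IsConvolutionAlgebra (HeisenbergGroup.B n lam) ∧
    {ψ : HeisenbergGroup.V n | ∃ f ∈ HeisenbergGroup.B n lam, ∃ φ : HeisenbergGroup.V n,
        ψ = HeisenbergGroup.schrodingerInt lam f φ} =
      HeisenbergGroup.analyticVectors n lam :=
  ⟨HeisenbergGroup.isConvolutionAlgebra_B hlam,
    HeisenbergGroup.range_schrodingerInt_eq_analyticVectors hlam⟩
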